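/- **Setting.** Let $(\Omega,\mathcal M,\mu)$ be a probability space with no atoms, $\Sigma$ an index set and $(d_\sigma)_{\sigma\in\Sigma}$ a family of positive integers. A *uniformly bounded quantized orthonormal system* (u.b.q.o.s.) with these parameters is a family $\Phi=\{\varphi^\sigma:\Omega\to M_{d_\sigma}(\mathbb C)\}_{\sigma\in\Sigma}$ with measurable entries such that $$\int_\Omega \varphi^\sigma_{ij}\,\overline{\varphi^{\sigma'}_{i'j'}}\,d\mu=\tfrac1{d_\sigma}\,\delta_{\sigma\sigma'}\delta_{ii'}\delta_{jj'},\qquad \mathrm M_\Phi=\sup_{\sigma}\operatorname*{ess\,sup}_{\omega}\|\varphi^\sigma(\omega)\|_{\rm op}<\infty .$$ The *quantized Rademacher system* $\mathcal R=\{\rho^\sigma\}_{\sigma\in\Sigma}$ consists of independent random orthogonal matrices $\rho^\sigma:\Omega\to O(d_\sigma)$, each distributed according to normalized Haar measure. Let $E$ be an operator space, $1\le p\le 2$ and $p'$ the conjugate exponent. For finite $\Sigma_0\subset\Sigma$ let $\mathcal L^p_E(\Sigma_0)=\prod_{\sigma\in\Sigma_0}M_{d_\sigma}\otimes E$ with norm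 $\big(\sum_{\sigma\in\Sigma_0} d_\sigma\|A^\sigma\|^p_{S^p_{d_\sigma}(E)}\big)^{1/p}$ (a supremum over $\sigma$ if $p=\infty$), $S^p_n(E)$ being Pisier's $E$-valued Schatten class, and let $\Phi^p_E(\Sigma_0)=\operatorname{span}\{\varphi^\sigma_{ij}:\sigma\in\Sigma_0\}\otimes E\subset L^p_E(\Omega)$, both with their natural operator space structures. Put $$\mathcal K_{1p}(E,\Phi)=\sup_{\Sigma_0}\Big\|A\mapsto\sum_{\sigma\in\Sigma_0} d_\sigma\operatorname{tr}(A^\sigma\varphi^\sigma)\Big\|_{cb(\mathcal L^p_E(\Sigma_0),\,\Phi^{p'}_E(\Sigma_0))},\qquad \mathcal K_{2p'}(E,\Phi)=\sup_{\Sigma_0}\Big\|f\mapsto\Big(\int_\Omega f\,(\varphi^\sigma)^\star d\mu\Big)_{\sigma\in\Sigma_0}\Big\|_{cb(\Phi^p_E(\Sigma_0),\,\mathcal L^{p'}_E(\Sigma_0))},$$ the suprema being over the finite subsets $\Sigma_0$ of $\Sigma$. $E$ has $\Phi$-type $p$ if $\mathcal K_{1p}(E,\Phi)<\infty$, and $\Phi$-cotype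 $p'$ if $\mathcal K_{2p'}(E,\Phi)<\infty$; similarly for $\mathcal R$. **Proposition.** Let $1\le p\le 2$. For any operator space $E$ and any u.b.q.o.s. $\Phi$, with $\mathcal R$ the quantized Rademacher system on $\Omega$ with the same parameters: 1. If $E$ has $\Phi$-type $p$, then $E$ has $\mathcal R$-type $p$. 2. If $E$ has $\Phi$-cotype $p'$, then $E$ has $\mathcal R$-cotype $p'$. Moreover $\mathcal K_{1p}(E,\mathcal R)\le 2\,\mathrm M_\Phi\,\mathcal K_{1p}(E,\Phi)$ and $\mathcal K_{2p'}(E,\mathcal R)\le 2\,\mathrm M_\Phi\,\mathcal K_{2p'}(E,\Phi)$; if the matrices $\varphi^\sigma(\omega)$ are real for every $\sigma$ and almost every $\omega$, then the factor $2$ can be omitted in both estimates. -/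

import Mathlib

open MeasureTheory ProbabilityTheory
open scoped ENNReal

noncomputable section

namespace QuantizedSystem

/-- The operator norm of a complex (possibly rectangular) scalar matrix acting between
Euclidean spaces. -/
def opNorm {m n : Type*} [Fintype m] [Fintype n] (a : Matrix m n ℂ) : ℝ :=
  open scoped Classical Matrix.Norms.L2Operator in ‖a‖

/-- The two-sided action `a · x · b` of scalar matrices on a matrix with entries in a complex
vector space `V`. -/
def sandwich {V m k l n : Type*} [Fintype k] [Fintype l] [AddCommGroup V] [Module ℂ V]
    (a : Matrix m k ℂ) (x : Matrix k l V) (b : Matrix l n ℂ) : Matrix m n V :=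
  Matrix.of fun i j => ∑ r, ∑ s, (a i r * b s j) • x r s

/-- The direct sum `x ⊕ y ∈ M_{m+n}(V)` of `x ∈ M_m(V)` and `y ∈ M_n(V)`. -/
def directSum {V : Type*} [Zero V] {m n : ℕ} (x : Matrix (Fin m) (Fin m) V)
    (y : Matrix (Fin n) (Fin n) V) : Matrix (Fin (m + n)) (Fin (m + n)) V :=
  Matrix.reindex finSumFinEquiv finSumFinEquiv (Matrix.fromBlocks x 0 0 y)

/-- An (abstract) operator space structure, inducing the given norm, on a normed space `E`:
a norm on each `M_n(E)` satisfying Ruan's axioms. -/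
class OperatorSpace (E : Type*) [NormedAddCommGroup E] [NormedSpace ℂ E] where
  /-- the matrix norms: `matNorm n` is the norm of `M_n(E)` -/
  matNorm : ∀ n : ℕ, Seminorm ℂ (Matrix (Fin n) (Fin n) E)
  matNorm_eq_zero : ∀ (n : ℕ) (x : Matrix (Fin n) (Fin n) E), matNorm n x = 0 → x = 0
  matNorm_one : ∀ e : E, matNorm 1 (Matrix.of fun _ _ => e) = ‖e‖
  matNorm_directSum : ∀ (m n : ℕ) (x : Matrix (Fin m) (Fin m) E) (y : Matrix (Fin n) (Fin n) E),
    matNorm (m + n) (directSum x y) = max (matNorm m x) (matNorm n y)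
  matNorm_sandwich : ∀ (m n : ℕ) (a : Matrix (Fin n) (Fin m) ℂ) (x : Matrix (Fin m) (Fin m) E)
    (b : Matrix (Fin m) (Fin n) ℂ),
    matNorm n (sandwich a x b) ≤ opNorm a * matNorm m x * opNorm b

/-- The norm of `M_ι(E)` for an arbitrary finite index set `ι`, by enumerating `ι`
(the axioms make it independent of the enumeration). -/
def matNormOn {ι : Type*} [Fintype ι] {E : Type*} [NormedAddCommGroup E] [NormedSpace ℂ E]
    [OperatorSpace E] (x : Matrix ι ι E) : ℝ :=
  OperatorSpace.matNorm (Fintype.card ι)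
    (Matrix.reindex (Fintype.equivFin ι) (Fintype.equivFin ι) x)

/-- The Schatten `r`-norm of a scalar matrix, `1 ≤ r ≤ ∞`: the `ℓ^r`-norm of its singular values,
i.e. of the square roots of the eigenvalues of `a* a`. -/
def schattenNorm {ι : Type*} [Fintype ι] (r : ℝ≥0∞) (a : Matrix ι ι ℂ) : ℝ :=
  open scoped Classical in
  ‖(WithLp.toLp r fun i => √((Matrix.isHermitian_conjTranspose_mul_self a).eigenvalues i) :
    PiLp r fun _ : ι => ℝ)‖

/-- The norm of Pisier's `E`-valued Schatten class `S_ι^p(E)`, `1 ≤ p ≤ ∞`: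
`‖x‖ = inf ‖a‖_{2p} ‖y‖_{M_ι(E)} ‖b‖_{2p}` over all factorizations `x = a · y · b` with scalar
matrices `a`, `b` and `y ∈ M_ι(E)`. For `p = ∞` it is the norm of `M_ι(E)`. -/
def vectorSchattenNorm {ι : Type*} [Fintype ι] {E : Type*} [NormedAddCommGroup E]
    [NormedSpace ℂ E] [OperatorSpace E] (p : ℝ≥0∞) (x : Matrix ι ι E) : ℝ :=
  sInf {t : ℝ | ∃ (a : Matrix ι ι ℂ) (y : Matrix ι ι E) (b : Matrix ι ι ℂ),
    x = sandwich a y b ∧ t = schattenNorm (2 * p) a * matNormOn y * schattenNorm (2 * p) b}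

/-- A family of `[0,∞]`-valued functionals on the spaces `M_n(V)`. -/
abbrev MatrixGauge (V : Type*) := ∀ n : ℕ, Matrix (Fin n) (Fin n) V → ℝ≥0∞

/-- The matrix norms of the operator space `V` for which the norm of `S_n^p(V)` is `N n`:
`‖x‖_{M_n(V)} = sup ‖a · x · b‖_{S_n^p(V)}`, the supremum being over the unit balls of
`S_n^{2p}`. -/
def matrixGauge {V : Type*} [AddCommGroup V] [Module ℂ V] (p : ℝ≥0∞) (N : MatrixGauge V) :
    MatrixGauge V := fun n x =>
  ⨆ (a : Matrix (Fin n) (Fin n) ℂ) (b : Matrix (Fin n) (Fin n) ℂ)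
    (_ : schattenNorm (2 * p) a ≤ 1) (_ : schattenNorm (2 * p) b ≤ 1), N n (sandwich a x b)

/-- The completely bounded norm `sup_n ‖id ⊗ u : M_n(V) → M_n(W)‖` of a map `u`, with respect to
given matrix norms on `V` and `W` (`∞` if `u` is not completely bounded). -/
def cbNorm {V W : Type*} (NV : MatrixGauge V) (NW : MatrixGauge W) (u : V → W) : ℝ≥0∞ :=
  ⨆ (n : ℕ) (x : Matrix (Fin n) (Fin n) V) (_ : NV n x ≤ 1), NW n (x.map u)

/-- The natural matrix norms of `L_E^p(Ω)`, determined by `S_n^p(L_E^p(Ω)) = L^p(Ω; S_n^p(E))`.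
They are used for functions `Ω → E` that are finite sums `∑ fₖ eₖ` with `fₖ ∈ L^∞(Ω)`, `eₖ ∈ E`. -/
def functionGauge {Ω : Type*} [MeasurableSpace Ω] (μ : Measure Ω) (E : Type*)
    [NormedAddCommGroup E] [NormedSpace ℂ E] [OperatorSpace E] (p : ℝ≥0∞) :
    MatrixGauge (Ω → E) :=
  matrixGauge p fun _ f =>
    eLpNorm (fun ω => vectorSchattenNorm p (Matrix.of fun i j => f i j ω)) p μ

/-- The space underlying `𝓛_E^p(S)` for a finite set `S` of indices: `∏_{σ ∈ S} M_{d_σ} ⊗ E`. -/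
abbrev CoeffSpace {I : Type*} (d : I → ℕ) (E : Type*) (S : Finset I) :=
  ∀ σ : S, Matrix (Fin (d σ)) (Fin (d σ)) E

/-- The norm of `S_n^p(𝓛_E^p(S))`, which is
`(∑_{σ ∈ S} d_σ ‖A^σ‖^p)^{1/p}` (the maximum over `σ` if `p = ∞`), the norm of `A^σ` being that of
`S_n^p(S_{d_σ}^p(E)) = S_{n d_σ}^p(E)`. -/
def coeffSchattenGauge {I : Type*} (d : I → ℕ) (E : Type*)
    [NormedAddCommGroup E] [NormedSpace ℂ E] [OperatorSpace E] (S : Finset I) (p : ℝ≥0∞) :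
    MatrixGauge (CoeffSpace d E S) := fun n A =>
  let N : S → ℝ≥0∞ := fun σ => ENNReal.ofReal (vectorSchattenNorm p
    (Matrix.of fun (x y : Fin n × Fin (d σ)) => A x.1 y.1 σ x.2 y.2))
  if p = ∞ then ⨆ σ, N σ else (∑ σ : S, (d σ : ℝ≥0∞) * N σ ^ p.toReal) ^ (1 / p.toReal)

/-- The natural matrix norms of `𝓛_E^p(S)`, for a finite set `S` of indices. -/
def coeffGauge {I : Type*} (d : I → ℕ) (E : Type*)
    [NormedAddCommGroup E] [NormedSpace ℂ E] [OperatorSpace E] (S : Finset I) (p : ℝ≥0∞) :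
    MatrixGauge (CoeffSpace d E S) :=
  matrixGauge p (coeffSchattenGauge d E S p)

/-- A system of matrix-valued functions on `Ω` with sizes `d_σ`, `σ ∈ I`. -/
abbrev System (Ω : Type*) {I : Type*} (d : I → ℕ) :=
  ∀ σ : I, Ω → Matrix (Fin (d σ)) (Fin (d σ)) ℂ

/-- `Φ_E(S)`: the span of the functions `φ_{ij}^σ e`, `σ ∈ S`, `e ∈ E`. -/
def polySpace {Ω I : Type*} {d : I → ℕ} (E : Type*) [NormedAddCommGroup E] [NormedSpace ℂ E]
    (φ : System Ω d) (S : Finset I) : Submodule ℂ (Ω → E) :=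
  Submodule.span ℂ {f | ∃ σ ∈ S, ∃ (i j : Fin (d σ)) (e : E), f = fun ω => φ σ ω i j • e}

/-- The matrix norms of `Φ_E^p(S)`, i.e. of `Φ_E(S)` as a subspace of `L_E^p(Ω)`. -/
def polyGauge {Ω : Type*} [MeasurableSpace Ω] (μ : Measure Ω) {I : Type*} {d : I → ℕ}
    (E : Type*) [NormedAddCommGroup E] [NormedSpace ℂ E] [OperatorSpace E]
    (φ : System Ω d) (S : Finset I) (p : ℝ≥0∞) : MatrixGauge (polySpace E φ S) :=
  fun n f => functionGauge μ E p n (f.map Subtype.val)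

/-- The inverse transform `A ↦ ∑_{σ ∈ S} d_σ tr(A^σ φ^σ(·))`, with values in `Φ_E(S)`. -/
def inverseTransform {Ω I : Type*} {d : I → ℕ} (E : Type*) [NormedAddCommGroup E]
    [NormedSpace ℂ E] (φ : System Ω d) (S : Finset I) (A : CoeffSpace d E S) : polySpace E φ S :=
  ⟨fun ω => ∑ σ : S, (d σ : ℂ) • ∑ i, ∑ j, φ σ ω j i • A σ i j, by
    have h : (fun ω => ∑ σ : S, (d σ : ℂ) • ∑ i, ∑ j, φ σ ω j i • A σ i j) =
        ∑ σ : S, (d σ : ℂ) • ∑ i, ∑ j, fun ω => φ σ ω j i • A σ i j := by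
      ext ω
      simp only [Finset.sum_apply, Pi.smul_apply]
    rw [h]
    exact Submodule.sum_mem _ fun σ _ => Submodule.smul_mem _ _ <| Submodule.sum_mem _ fun i _ =>
      Submodule.sum_mem _ fun j _ => Submodule.subset_span ⟨σ, σ.2, j, i, A σ i j, rfl⟩⟩

/-- The transform `f ↦ (∫ f(ω) φ^σ(ω)* dμ(ω))_{σ ∈ S}` on `Φ_E(S)`. -/
def transform {Ω : Type*} [MeasurableSpace Ω] (μ : Measure Ω) {I : Type*} {d : I → ℕ} (E : Type*)
    [NormedAddCommGroup E] [NormedSpace ℂ E] (φ : System Ω d) (S : Finset I)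
    (f : polySpace E φ S) : CoeffSpace d E S :=
  fun σ => Matrix.of fun i j => ∫ ω, star (φ σ ω j i) • (f : Ω → E) ω ∂μ

/-- The Riesz type constant `𝒦_{1p}(E, Φ)`, with `p'` the conjugate exponent of `p`. -/
def typeConst {Ω : Type*} [MeasurableSpace Ω] (μ : Measure Ω) {I : Type*} {d : I → ℕ} (E : Type*)
    [NormedAddCommGroup E] [NormedSpace ℂ E] [OperatorSpace E] (φ : System Ω d) (p : ℝ≥0∞) :
    ℝ≥0∞ :=
  ⨆ S : Finset I, cbNorm (coeffGauge d E S p) (polyGauge μ E φ S p.conjExponent)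
    (inverseTransform E φ S)

/-- The Riesz cotype constant `𝒦_{2p'}(E, Φ)`, with `p'` the conjugate exponent of `p`. -/
def cotypeConst {Ω : Type*} [MeasurableSpace Ω] (μ : Measure Ω) {I : Type*} {d : I → ℕ}
    (E : Type*) [NormedAddCommGroup E] [NormedSpace ℂ E] [OperatorSpace E] (φ : System Ω d)
    (p : ℝ≥0∞) : ℝ≥0∞ :=
  ⨆ S : Finset I, cbNorm (polyGauge μ E φ S p) (coeffGauge d E S p.conjExponent)
    (transform μ E φ S)

/-- `E` has `Φ`-type `p`. -/
def HasType {Ω : Type*} [MeasurableSpace Ω] (μ : Measure Ω) {I : Type*} {d : I → ℕ} (E : Type*)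
    [NormedAddCommGroup E] [NormedSpace ℂ E] [OperatorSpace E] (φ : System Ω d) (p : ℝ≥0∞) :
    Prop :=
  typeConst μ E φ p < ∞

/-- `E` has `Φ`-cotype `p'`, with `p'` the conjugate exponent of `p`. -/
def HasConjCotype {Ω : Type*} [MeasurableSpace Ω] (μ : Measure Ω) {I : Type*} {d : I → ℕ}
    (E : Type*) [NormedAddCommGroup E] [NormedSpace ℂ E] [OperatorSpace E] (φ : System Ω d)
    (p : ℝ≥0∞) : Prop :=
  cotypeConst μ E φ p < ∞

/-- The uniform bound `M_Φ = sup_σ ess sup_ω ‖φ^σ(ω)‖`. -/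
def uniformBound {Ω : Type*} [MeasurableSpace Ω] (μ : Measure Ω) {I : Type*} {d : I → ℕ}
    (φ : System Ω d) : ℝ≥0∞ :=
  ⨆ σ : I, essSup (fun ω => ENNReal.ofReal (opNorm (φ σ ω))) μ

/-- The measure `μ` has no atoms: every set of positive measure contains a set of strictly smaller
positive measure. -/
def HasNoAtoms {Ω : Type*} [MeasurableSpace Ω] (μ : Measure Ω) : Prop :=
  ∀ s, MeasurableSet s → 0 < μ s → ∃ t ⊆ s, MeasurableSet t ∧ 0 < μ t ∧ μ t < μ s

/-- Uniformly bounded quantized orthonormal systems. -/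
structure IsUBQOS {Ω : Type*} [MeasurableSpace Ω] (μ : Measure Ω) {I : Type*} {d : I → ℕ}
    (φ : System Ω d) : Prop where
  isProbabilityMeasure : IsProbabilityMeasure μ
  hasNoAtoms : HasNoAtoms μ
  size_pos : ∀ σ, 0 < d σ
  measurable : ∀ σ i j, Measurable fun ω => φ σ ω i j
  orthonormal_self : ∀ (σ : I) (i j i' j' : Fin (d σ)),
    ∫ ω, φ σ ω i j * star (φ σ ω i' j') ∂μ = if i = i' ∧ j = j' then 1 / (d σ : ℂ) else 0
  orthogonal : ∀ (σ σ' : I), σ ≠ σ' → ∀ (i j : Fin (d σ)) (i' j' : Fin (d σ')),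
    ∫ ω, φ σ ω i j * star (φ σ' ω i' j') ∂μ = 0
  bounded : uniformBound μ φ < ∞

/-- The Borel `σ`-algebra of the orthogonal group `O(n)`. -/
instance orthogonalMeasurableSpace (n : ℕ) :
    MeasurableSpace (Matrix.orthogonalGroup (Fin n) ℝ) := borel _

/-- Quantized Rademacher systems: independent random orthogonal matrices `ρ^σ`, each distributed
according to the normalized Haar measure of `O(d_σ)` (the laws are probability measures). -/
structure IsQuantizedRademacher {Ω : Type*} [MeasurableSpace Ω] (μ : Measure Ω) {I : Type*}
    {d : I → ℕ} (ρ : ∀ σ : I, Ω → Matrix.orthogonalGroup (Fin (d σ)) ℝ) : Prop where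
  isProbabilityMeasure : IsProbabilityMeasure μ
  measurable : ∀ σ, Measurable (ρ σ)
  indep : iIndepFun ρ μ
  haar : ∀ σ, (μ.map (ρ σ)).IsHaarMeasure

/-- A family of random orthogonal matrices, as a system of complex matrix-valued functions. -/
def orthogonalSystem {Ω I : Type*} {d : I → ℕ}
    (ρ : ∀ σ : I, Ω → Matrix.orthogonalGroup (Fin (d σ)) ℝ) : System Ω d :=
  fun σ ω => ((ρ σ ω : Matrix.orthogonalGroup (Fin (d σ)) ℝ) :
    Matrix (Fin (d σ)) (Fin (d σ)) ℝ).map Complex.ofReal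

end QuantizedSystem

end

open QuantizedSystem

/-! Summing the orthonormality relations over a column index gives the reproducing formula 1 = ∫ φ^σ
(φ^σ)* dμ. The second tool is a contraction principle. For a seminorm M on families of matrices, C ↦
‖M(Cρ)‖_{L^q} is convex, and it takes one and the same value at all families of orthogonal matrices,
because the joint law of ρ is a product of Haar measures. Real contractions are convex combinations
of orthogonal matrices, so a real multiplier with ‖C^σ‖ ≤ c costs a factor c; splitting a complex
one into entrywise real and imaginary parts costs 2c (`rhoSeminorm_le_of_real`, `rhoSeminorm_le`).

Type. Jensen's inequality for the reproducing formula and the contraction principle for φ* give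
‖M(ρ)‖_{L^q} ≤ c ∫ ‖M(φ(ω)ρ)‖_{L^q} dμ(ω) with q = p'. After an exchange of the order of integration
ρ is frozen, and tr(Aφρ) = tr(ρAφ) exhibits a Φ-polynomial with coefficients ρA. Left multiplication
by orthogonal matrices does not increase the coefficient norm, so the Φ-type bound applies
(`typeConst_le_of_contraction`).

Cotype. Averaging yields a rotation u for which the Φ-polynomial with coefficients uA is controlled
by the Rademacher polynomial with coefficients A (`exists_rotation_le`). This u depends on the
scalar weights a, b that test the matrix norm, whereas a completely bounded norm asks for all
weights at once. The remedy is to take a = P^{1/2p}, b = Q^{1/2p} for faithful states P, Q and to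
normalize the weighted function by further weights into the unit ball of M_n(L_E^p)
(`exists_weights_of_eLpNorm_le_one`). Φ-cotype applies there, and A = α g β results with g
controlled and with tr(Pαα*), tr(Qβ*β) at most about c (`exists_factor_coeff`). A Hahn–Banach
minimax argument (`coeffGauge_le_of_forall_posDef`) exchanges the quantifiers: one such
factorization has αα* and β*β nearly below c·1.

Both the normalization and the minimax rest on convexity properties of E-valued Schatten norms,
derived directly from the factorization definition. Their common source is Lieb's concavity theorem
(`lieb_superadditive`), used through Epstein's theorem and its column form `sum_rs_normalized_le`.
The minimax needs in addition that the unit balls of the coefficient matrix norms are matrix convex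
(`coeffGauge_rowcol_le`). -/

noncomputable section

namespace QuantizedSystem

open Matrix
open scoped ComplexOrder

/-! ### Functional calculus of Hermitian matrices -/

section

variable {ι κ : Type*} [Fintype ι] [Fintype κ]

/-- The functional calculus of a Hermitian matrix (zero if the matrix is not Hermitian). -/
def mfun (H : Matrix ι ι ℂ) (f : ℝ → ℝ) : Matrix ι ι ℂ :=
  open scoped Classical in
  if h : H.IsHermitian then
    (h.eigenvectorUnitary : Matrix ι ι ℂ) * diagonal (fun i => (f (h.eigenvalues i) : ℂ)) *
      (h.eigenvectorUnitary : Matrix ι ι ℂ)ᴴ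
  else 0

/-- `H = U diag(l) U*` with `U` unitary. -/
structure IsDecomp [DecidableEq ι] (H U : Matrix ι ι ℂ) (l : ι → ℝ) : Prop where
  left : Uᴴ * U = 1
  right : U * Uᴴ = 1
  eq : H = U * diagonal (fun i => (l i : ℂ)) * Uᴴ

theorem IsDecomp.of_eigen [DecidableEq ι] {H : Matrix ι ι ℂ} (h : H.IsHermitian) :
    IsDecomp H (h.eigenvectorUnitary : Matrix ι ι ℂ) h.eigenvalues where
  left := by
    have := (Matrix.mem_unitaryGroup_iff' (A := (h.eigenvectorUnitary : Matrix ι ι ℂ))).1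
      h.eigenvectorUnitary.2
    simpa [star_eq_conjTranspose] using this
  right := by
    have := (Matrix.mem_unitaryGroup_iff (A := (h.eigenvectorUnitary : Matrix ι ι ℂ))).1
      h.eigenvectorUnitary.2
    simpa [star_eq_conjTranspose] using this
  eq := by
    have := h.spectral_theorem
    rw [Unitary.conjStarAlgAut_apply] at this
    exact this

theorem IsDecomp.isHermitian [DecidableEq ι] {H U : Matrix ι ι ℂ} {l : ι → ℝ}
    (h : IsDecomp H U l) : H.IsHermitian := by
  have hd : (diagonal fun i => (l i : ℂ))ᴴ = diagonal (fun i => (l i : ℂ)) := by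
    rw [diagonal_conjTranspose]; congr 1; ext i; simp
  rw [IsHermitian, h.eq, conjTranspose_mul, conjTranspose_mul, hd, conjTranspose_conjTranspose,
    Matrix.mul_assoc]

/-- In the two eigenbases `a` becomes a matrix `W` whose entries can be nonzero only where the
eigenvalues agree, so it also intertwines `f` of them. For `a = 1` this makes the functional
calculus independent of the diagonalization; for rectangular `a` it moves functions of `a* a` past
`a`. -/
theorem intertwine_diagonal [DecidableEq ι] [DecidableEq κ] {H U : Matrix ι ι ℂ}
    {H' U' : Matrix κ κ ℂ} {l : ι → ℝ} {l' : κ → ℝ} (h : IsDecomp H U l) (h' : IsDecomp H' U' l')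
    {a : Matrix κ ι ℂ} (ha : a * H = H' * a) (f : ℝ → ℝ) :
    a * (U * diagonal (fun i => (f (l i) : ℂ)) * Uᴴ) =
      (U' * diagonal (fun i => (f (l' i) : ℂ)) * U'ᴴ) * a := by
  set W := U'ᴴ * a * U with hW
  have aW : a = U' * W * Uᴴ := by
    have : U' * W * Uᴴ = (U' * U'ᴴ) * a * (U * Uᴴ) := by simp only [hW, Matrix.mul_assoc]
    rw [this, h.right, h'.right]; simp
  have key : W * diagonal (fun i => (l i : ℂ)) = diagonal (fun i => (l' i : ℂ)) * W := by
    have e1 : W * diagonal (fun i => (l i : ℂ)) = U'ᴴ * (a * H) * U := by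
      have : U'ᴴ * (a * H) * U = U'ᴴ * a * U * diagonal (fun i => (l i : ℂ)) * (Uᴴ * U) := by
        rw [h.eq]; simp only [Matrix.mul_assoc]
      rw [this, h.left, Matrix.mul_one]
    have e2 : diagonal (fun i => (l' i : ℂ)) * W = U'ᴴ * (H' * a) * U := by
      have : U'ᴴ * (H' * a) * U = (U'ᴴ * U') * diagonal (fun i => (l' i : ℂ)) * (U'ᴴ * a * U) := by
        rw [h'.eq]; simp only [Matrix.mul_assoc]
      rw [this, h'.left, Matrix.one_mul]
    rw [e1, e2, ha]
  have key2 : W * diagonal (fun i => (f (l i) : ℂ)) = diagonal (fun i => (f (l' i) : ℂ)) * W := by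
    ext i j
    have := congrFun (congrFun key i) j
    rw [mul_diagonal, diagonal_mul] at this ⊢
    by_cases hw : W i j = 0
    · simp [hw]
    · have : (l j : ℂ) = l' i := by
        rw [mul_comm] at this; exact mul_right_cancel₀ hw this
      rw [Complex.ofReal_inj.1 this, mul_comm]
  have e1 : a * (U * diagonal (fun i => (f (l i) : ℂ)) * Uᴴ) =
      U' * W * (Uᴴ * U) * diagonal (fun i => (f (l i) : ℂ)) * Uᴴ := by
    conv_lhs => rw [aW]
    simp only [Matrix.mul_assoc]
  have e2 : (U' * diagonal (fun i => (f (l' i) : ℂ)) * U'ᴴ) * a =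
      U' * diagonal (fun i => (f (l' i) : ℂ)) * (U'ᴴ * U') * W * Uᴴ := by
    conv_lhs => rw [aW]
    simp only [Matrix.mul_assoc]
  rw [e1, e2, h.left, h'.left, Matrix.mul_one, Matrix.mul_one, Matrix.mul_assoc U', key2]
  simp only [Matrix.mul_assoc]

theorem IsDecomp.mfun_eq [DecidableEq ι] {H U : Matrix ι ι ℂ} {l : ι → ℝ}
    (h : IsDecomp H U l) (f : ℝ → ℝ) :
    mfun H f = U * diagonal (fun i => (f (l i) : ℂ)) * Uᴴ := by
  rename_i inst
  have e : inst = fun a b => Classical.propDecidable (a = b) := Subsingleton.elim _ _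
  subst e
  classical
  rw [mfun, dif_pos h.isHermitian]
  have := intertwine_diagonal (IsDecomp.of_eigen h.isHermitian) h (a := 1) (by simp) f
  simpa using this

theorem mul_mfun_of_intertwine {H : Matrix ι ι ℂ} {H' : Matrix κ κ ℂ} (h : H.IsHermitian)
    (h' : H'.IsHermitian) {a : Matrix κ ι ℂ} (ha : a * H = H' * a) (f : ℝ → ℝ) :
    a * mfun H f = mfun H' f * a := by
  classical
  rw [(IsDecomp.of_eigen h).mfun_eq, (IsDecomp.of_eigen h').mfun_eq]
  exact intertwine_diagonal (IsDecomp.of_eigen h) (IsDecomp.of_eigen h') ha f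

theorem IsDecomp.mfun [DecidableEq ι] {H U : Matrix ι ι ℂ} {l : ι → ℝ}
    (h : IsDecomp H U l) (f : ℝ → ℝ) : IsDecomp (mfun H f) U (fun i => f (l i)) :=
  ⟨h.left, h.right, h.mfun_eq f⟩

theorem mfun_isHermitian (H : Matrix ι ι ℂ) (f : ℝ → ℝ) : (mfun H f).IsHermitian := by
  classical
  by_cases h : H.IsHermitian
  · exact ((IsDecomp.of_eigen h).mfun f).isHermitian
  · rw [mfun, dif_neg h]; exact isHermitian_zero

theorem IsDecomp.mul_diag [DecidableEq ι] {H U : Matrix ι ι ℂ} {l : ι → ℝ}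
    (h : IsDecomp H U l) (d e : ι → ℂ) :
    (U * diagonal d * Uᴴ) * (U * diagonal e * Uᴴ) = U * diagonal (fun i => d i * e i) * Uᴴ := by
  have : (U * diagonal d * Uᴴ) * (U * diagonal e * Uᴴ) =
      U * (diagonal d * (Uᴴ * U) * diagonal e) * Uᴴ := by simp only [Matrix.mul_assoc]
  rw [this, h.left, Matrix.mul_one, diagonal_mul_diagonal]

theorem mfun_mul (H : Matrix ι ι ℂ) (f g : ℝ → ℝ) :
    mfun H f * mfun H g = mfun H (fun x => f x * g x) := by
  classical
  by_cases h : H.IsHermitian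
  · have hd := IsDecomp.of_eigen h
    rw [hd.mfun_eq, hd.mfun_eq, hd.mfun_eq, hd.mul_diag]
    simp
  · simp [mfun, dif_neg h]

theorem mfun_mfun {H : Matrix ι ι ℂ} (h : H.IsHermitian) (f g : ℝ → ℝ) :
    mfun (mfun H g) f = mfun H (fun x => f (g x)) := by
  classical
  have hd := IsDecomp.of_eigen h
  rw [(hd.mfun g).mfun_eq, hd.mfun_eq]

theorem mfun_id {H : Matrix ι ι ℂ} (h : H.IsHermitian) : mfun H (fun x => x) = H := by
  classical
  have hd := IsDecomp.of_eigen h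
  rw [hd.mfun_eq, ← hd.eq]

theorem mfun_one {H : Matrix ι ι ℂ} [DecidableEq ι] (h : H.IsHermitian) :
    mfun H (fun _ => 1) = 1 := by
  have hd := IsDecomp.of_eigen h
  rw [hd.mfun_eq]; simp [hd.right]

theorem IsDecomp.nonneg [DecidableEq ι] {H U : Matrix ι ι ℂ} {l : ι → ℝ}
    (h : IsDecomp H U l) (hH : H.PosSemidef) (i : ι) : 0 ≤ l i := by
  have h1 := (hH.conjTranspose_mul_mul_same U).diag_nonneg (i := i)
  have : Uᴴ * H * U = diagonal (fun i => (l i : ℂ)) := by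
    have e : Uᴴ * H * U = (Uᴴ * U) * diagonal (fun i => (l i : ℂ)) * (Uᴴ * U) := by
      rw [h.eq]; simp only [Matrix.mul_assoc]
    rw [e, h.left]; simp
  rw [this, diagonal_apply_eq] at h1
  exact_mod_cast h1

theorem IsDecomp.posSemidef [DecidableEq ι] {H U : Matrix ι ι ℂ} {l : ι → ℝ}
    (h : IsDecomp H U l) (hl : ∀ i, 0 ≤ l i) : H.PosSemidef := by
  rw [h.eq]
  apply PosSemidef.mul_mul_conjTranspose_same
  apply PosSemidef.diagonal
  intro i; simpa using hl i

theorem IsDecomp.pos [DecidableEq ι] {H U : Matrix ι ι ℂ} {l : ι → ℝ}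
    (h : IsDecomp H U l) (hH : H.PosDef) (i : ι) : 0 < l i := by
  have hinj : Function.Injective U.mulVec := by
    intro x y hxy
    have := congrArg (Uᴴ.mulVec) hxy
    simpa [mulVec_mulVec, h.left] using this
  have h1 := (hH.conjTranspose_mul_mul_same (B := U) hinj).diag_pos (i := i)
  have : Uᴴ * H * U = diagonal (fun i => (l i : ℂ)) := by
    have e : Uᴴ * H * U = (Uᴴ * U) * diagonal (fun i => (l i : ℂ)) * (Uᴴ * U) := by
      rw [h.eq]; simp only [Matrix.mul_assoc]
    rw [e, h.left]; simp
  rw [this, diagonal_apply_eq] at h1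
  exact_mod_cast h1

theorem mfun_congr {H : Matrix ι ι ℂ} (hH : H.PosSemidef) {f g : ℝ → ℝ}
    (hfg : ∀ x, 0 ≤ x → f x = g x) : mfun H f = mfun H g := by
  classical
  have hd := IsDecomp.of_eigen hH.isHermitian
  rw [hd.mfun_eq, hd.mfun_eq]
  simp only [hfg _ (hd.nonneg hH _)]

theorem mfun_congr_pos {H : Matrix ι ι ℂ} (hH : H.PosDef) {f g : ℝ → ℝ}
    (hfg : ∀ x, 0 < x → f x = g x) : mfun H f = mfun H g := by
  classical
  have hd := IsDecomp.of_eigen hH.isHermitian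
  rw [hd.mfun_eq, hd.mfun_eq]
  simp only [hfg _ (hd.pos hH _)]

theorem mfun_posSemidef {H : Matrix ι ι ℂ} (hH : H.PosSemidef) {f : ℝ → ℝ}
    (hf : ∀ x, 0 ≤ x → 0 ≤ f x) : (mfun H f).PosSemidef := by
  classical
  have hd := IsDecomp.of_eigen hH.isHermitian
  exact (hd.mfun f).posSemidef fun i => hf _ (hd.nonneg hH _)

theorem IsDecomp.trace_mfun [DecidableEq ι] {H U : Matrix ι ι ℂ} {l : ι → ℝ}
    (h : IsDecomp H U l) (f : ℝ → ℝ) : (QuantizedSystem.mfun H f).trace = ((∑ i, f (l i) : ℝ) : ℂ) := by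
  rw [h.mfun_eq, trace_mul_comm, ← Matrix.mul_assoc, h.left, Matrix.one_mul, trace_diagonal]
  simp

theorem IsDecomp.smul [DecidableEq ι] {H U : Matrix ι ι ℂ} {l : ι → ℝ}
    (h : IsDecomp H U l) (c : ℝ) : IsDecomp ((c : ℂ) • H) U (fun i => c * l i) where
  left := h.left
  right := h.right
  eq := by
    conv_lhs => rw [h.eq]
    have : diagonal (fun i => ((c * l i : ℝ) : ℂ)) = (c : ℂ) • diagonal (fun i => (l i : ℂ)) := by
      rw [← diagonal_smul]; congr 1; ext i; simp
    rw [this]; simp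

theorem mfun_smul {H : Matrix ι ι ℂ} (h : H.IsHermitian) (c : ℝ) (f : ℝ → ℝ) :
    mfun ((c : ℂ) • H) f = mfun H (fun x => f (c * x)) := by
  classical
  have hd := IsDecomp.of_eigen h
  rw [(hd.smul c).mfun_eq, hd.mfun_eq]

theorem IsDecomp.kronecker_one [DecidableEq ι] [DecidableEq κ] {H U : Matrix ι ι ℂ} {l : ι → ℝ}
    (h : IsDecomp H U l) :
    IsDecomp (kroneckerMap (· * ·) H (1 : Matrix κ κ ℂ))
      (kroneckerMap (· * ·) U (1 : Matrix κ κ ℂ)) (fun x => l x.1) where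
  left := by
    rw [conjTranspose_kronecker, ← mul_kronecker_mul, h.left]; simp
  right := by
    rw [conjTranspose_kronecker, ← mul_kronecker_mul, h.right]; simp
  eq := by
    have : diagonal (fun x : ι × κ => (l x.1 : ℂ)) =
        kroneckerMap (· * ·) (diagonal fun i => (l i : ℂ)) (1 : Matrix κ κ ℂ) := by
      rw [← diagonal_one, diagonal_kronecker_diagonal]; simp
    rw [this, conjTranspose_kronecker, ← mul_kronecker_mul, ← mul_kronecker_mul, ← h.eq]; simp

theorem mfun_kronecker_one [DecidableEq κ] {H : Matrix ι ι ℂ} (h : H.IsHermitian) (f : ℝ → ℝ) :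
    mfun (kroneckerMap (· * ·) H (1 : Matrix κ κ ℂ)) f =
      kroneckerMap (· * ·) (mfun H f) (1 : Matrix κ κ ℂ) := by
  classical
  have hd := IsDecomp.of_eigen h
  have h2 := hd.kronecker_one (κ := κ)
  rw [h2.mfun_eq, ((hd.mfun f).kronecker_one (κ := κ)).eq]

theorem IsDecomp.fromBlocks [DecidableEq ι] [DecidableEq κ] {H U : Matrix ι ι ℂ} {l : ι → ℝ}
    {H' U' : Matrix κ κ ℂ} {l' : κ → ℝ} (h : IsDecomp H U l) (h' : IsDecomp H' U' l') :
    IsDecomp (fromBlocks H 0 0 H') (fromBlocks U 0 0 U') (Sum.elim l l') where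
  left := by
    rw [fromBlocks_conjTranspose, fromBlocks_multiply]; simp [h.left, h'.left]
  right := by
    rw [fromBlocks_conjTranspose, fromBlocks_multiply]; simp [h.right, h'.right]
  eq := by
    have : diagonal (fun x : ι ⊕ κ => ((Sum.elim l l' x : ℝ) : ℂ)) =
        Matrix.fromBlocks (diagonal fun i => (l i : ℂ)) 0 0 (diagonal fun i => (l' i : ℂ)) := by
      rw [fromBlocks_diagonal]; congr 1; ext x; cases x <;> simp
    rw [this, fromBlocks_conjTranspose, fromBlocks_multiply, fromBlocks_multiply]
    simp [← h.eq, ← h'.eq]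

theorem mfun_fromBlocks {H : Matrix ι ι ℂ} {H' : Matrix κ κ ℂ} (h : H.IsHermitian)
    (h' : H'.IsHermitian) (f : ℝ → ℝ) :
    mfun (fromBlocks H 0 0 H') f = fromBlocks (mfun H f) 0 0 (mfun H' f) := by
  classical
  have hd := IsDecomp.of_eigen h
  have hd' := IsDecomp.of_eigen h'
  rw [(hd.fromBlocks hd').mfun_eq, ((hd.mfun f).fromBlocks (hd'.mfun f)).eq]
  congr 2
  congr 1; ext x; cases x <;> simp

/-- A matrix dominated by `Z` is supported on the support of `Z`. -/
theorem mfun_mul_support {Y Z : Matrix ι ι ℂ} (hY : Y.PosSemidef) (hZ : Z.PosSemidef)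
    (hYZ : (Z - Y).PosSemidef) {f g h : ℝ → ℝ} (hf : f 0 = 0)
    (hgh : ∀ x, 0 < x → g x * h x = 1) : mfun Y f * (mfun Z g * mfun Z h) = mfun Y f := by
  classical
  have dY := IsDecomp.of_eigen hY.isHermitian
  have dZ := IsDecomp.of_eigen hZ.isHermitian
  set U := (hY.isHermitian.eigenvectorUnitary : Matrix ι ι ℂ)
  set V := (hZ.isHermitian.eigenvectorUnitary : Matrix ι ι ℂ)
  set y := hY.isHermitian.eigenvalues
  set z := hZ.isHermitian.eigenvalues
  -- For an eigenvector v of Z with eigenvalue 0, positivity of ⟨(Z − Y)v, v⟩ forces ∑ y_i |⟨u_i,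
  -- v⟩|² ≤ 0, so v is orthogonal to every eigenvector of Y with nonzero eigenvalue.
  have hker : ∀ j, z j = 0 → ∀ i, y i ≠ 0 → (Uᴴ * V) i j = 0 := by
    intro j hj i hi
    have h1 : (Vᴴ * Z * V) = diagonal (fun i => (z i : ℂ)) := by
      have e : Vᴴ * Z * V = (Vᴴ * V) * diagonal (fun i => (z i : ℂ)) * (Vᴴ * V) := by
        conv_lhs => rw [dZ.eq]
        simp only [Matrix.mul_assoc]
      rw [e, dZ.left]; simp
    have h2 := (hYZ.conjTranspose_mul_mul_same V).diag_nonneg (i := j)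
    have h4 : Vᴴ * (Z - Y) * V = Vᴴ * Z * V - Vᴴ * Y * V := by
      rw [Matrix.mul_sub, Matrix.sub_mul]
    rw [h4, h1, Matrix.sub_apply, diagonal_apply_eq, hj] at h2
    have h3 : (Vᴴ * Y * V) j j = ((∑ i, y i * ‖(Uᴴ * V) i j‖ ^ 2 : ℝ) : ℂ) := by
      have e : Vᴴ * Y * V = (Uᴴ * V)ᴴ * (diagonal (fun i => (y i : ℂ)) * (Uᴴ * V)) := by
        rw [conjTranspose_mul, conjTranspose_conjTranspose]
        conv_lhs => rw [dY.eq]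
        simp only [Matrix.mul_assoc]
      rw [e, mul_apply]
      push_cast
      refine Finset.sum_congr rfl fun i _ => ?_
      rw [diagonal_mul, conjTranspose_apply, mul_left_comm, RCLike.star_def, RCLike.conj_mul]
      simp
    rw [h3] at h2
    have h5 : (∑ i, y i * ‖(Uᴴ * V) i j‖ ^ 2 : ℝ) ≤ 0 := by
      have h6 : (0:ℂ) ≤ ((-(∑ i, y i * ‖(Uᴴ * V) i j‖ ^ 2) : ℝ) : ℂ) := by
        rw [Complex.ofReal_neg]; simpa using h2
      have := Complex.zero_le_real.1 h6
      linarith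
    have hnn : ∀ i ∈ Finset.univ, 0 ≤ y i * ‖(Uᴴ * V) i j‖ ^ 2 := fun i _ =>
      mul_nonneg (dY.nonneg hY i) (by positivity)
    have h7 := (Finset.sum_eq_zero_iff_of_nonneg hnn).1 (le_antisymm h5 (Finset.sum_nonneg hnn)) i
      (Finset.mem_univ i)
    rcases mul_eq_zero.1 h7 with h8 | h8
    · exact absurd h8 hi
    · simpa using h8
  rw [mfun_mul, dY.mfun_eq, dZ.mfun_eq]
  have e1 : U * diagonal (fun i => (f (y i) : ℂ)) * Uᴴ *
      (V * diagonal (fun i => ((g (z i) * h (z i) : ℝ) : ℂ)) * Vᴴ) =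
      U * (diagonal (fun i => (f (y i) : ℂ)) * (Uᴴ * V) *
        diagonal (fun i => ((g (z i) * h (z i) : ℝ) : ℂ))) * Vᴴ := by
    simp only [Matrix.mul_assoc]
  have e2 : diagonal (fun i => (f (y i) : ℂ)) * (Uᴴ * V) *
        diagonal (fun i => ((g (z i) * h (z i) : ℝ) : ℂ)) =
        diagonal (fun i => (f (y i) : ℂ)) * (Uᴴ * V) := by
    ext i j
    rw [mul_diagonal, diagonal_mul]
    by_cases hi : y i = 0
    · simp [hi, hf]
    · by_cases hj : z j = 0
      · simp [hker j hj i hi]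
      · rw [hgh _ (lt_of_le_of_ne (dZ.nonneg hZ j) (Ne.symm hj))]; simp
  rw [e1, e2]
  have e3 : U * (diagonal (fun i => (f (y i) : ℂ)) * (Uᴴ * V)) * Vᴴ =
     U * diagonal (fun i => (f (y i) : ℂ)) * Uᴴ * (V * Vᴴ) := by simp only [Matrix.mul_assoc]
  rw [e3, dZ.right, Matrix.mul_one]

end

/-! ### Lieb's concavity theorem by way of parallel sums -/

section

variable {ι κ : Type*} [Fintype ι] [Fintype κ]

/-- The trace is a sum over pairs of eigenvalues with nonnegative weights that do not depend on `f`
and `g`. Trace inequalities in Y and X thereby reduce to scalar ones. -/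
theorem IsDecomp.re_trace_mfun [DecidableEq ι] [DecidableEq κ] {Y U : Matrix ι ι ℂ} {y : ι → ℝ}
    {X V : Matrix κ κ ℂ} {x : κ → ℝ} (hY : IsDecomp Y U y) (hX : IsDecomp X V x)
    (K : Matrix ι κ ℂ) (f g : ℝ → ℝ) :
    (Kᴴ * QuantizedSystem.mfun Y f * K * QuantizedSystem.mfun X g).trace.re =
      ∑ i, ∑ j, f (y i) * g (x j) * ‖(Uᴴ * K * V) i j‖ ^ 2 := by
  set W := Uᴴ * K * V with hW
  have e : (Kᴴ * QuantizedSystem.mfun Y f * K * QuantizedSystem.mfun X g).trace =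
      (Wᴴ * (diagonal (fun i => (f (y i) : ℂ)) * W * diagonal (fun j => (g (x j) : ℂ)))).trace := by
    rw [hY.mfun_eq, hX.mfun_eq]
    have : Kᴴ * (U * diagonal (fun i => (f (y i) : ℂ)) * Uᴴ) * K *
        (V * diagonal (fun j => (g (x j) : ℂ)) * Vᴴ) =
        (Kᴴ * U * diagonal (fun i => (f (y i) : ℂ)) * Uᴴ * K * V * diagonal
          (fun j => (g (x j) : ℂ))) * Vᴴ := by simp only [Matrix.mul_assoc]
    rw [this, trace_mul_comm, hW]
    simp only [conjTranspose_mul, conjTranspose_conjTranspose, Matrix.mul_assoc]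
  have hD : ∀ i j, (diagonal (fun i => (f (y i) : ℂ)) * W * diagonal (fun j => (g (x j) : ℂ))) i j =
      f (y i) * W i j * g (x j) := fun i j => by rw [mul_diagonal, diagonal_mul]
  rw [e]
  generalize diagonal (fun i => (f (y i) : ℂ)) * W * diagonal (fun j => (g (x j) : ℂ)) = D at hD
  simp only [trace, diag_apply, mul_apply, conjTranspose_apply, Complex.re_sum, hD]
  rw [Finset.sum_comm]
  refine Finset.sum_congr rfl fun i _ => Finset.sum_congr rfl fun j _ => ?_
  have h2 : star (W i j) * ((f (y i) : ℂ) * W i j * (g (x j) : ℂ)) =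
      ((f (y i) * g (x j) * ‖W i j‖ ^ 2 : ℝ) : ℂ) := by
    have := RCLike.conj_mul (W i j)
    rw [RCLike.star_def]
    calc _ = (f (y i) : ℂ) * g (x j) * ((starRingEnd ℂ) (W i j) * W i j) := by ring
      _ = _ := by rw [this]; simp
  rw [h2, Complex.ofReal_re]

theorem IsDecomp.re_trace_conj_mul [DecidableEq ι] {Y U : Matrix ι ι ℂ} {y : ι → ℝ}
    (hY : IsDecomp Y U y) [DecidableEq κ] {V : Matrix κ κ ℂ} (hV : V * Vᴴ = 1)
    (K : Matrix ι κ ℂ) :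
    (Kᴴ * Y * K).trace.re = ∑ i, ∑ j, y i * ‖(Uᴴ * K * V) i j‖ ^ 2 := by
  have h1 : IsDecomp (1 : Matrix κ κ ℂ) V (fun _ => 1) :=
    ⟨by rw [mul_eq_one_comm]; exact hV, hV, by simp [hV]⟩
  have := hY.re_trace_mfun h1 K (fun t => t) (fun t => t)
  rw [mfun_id hY.isHermitian, mfun_id isHermitian_one, Matrix.mul_one] at this
  simpa using this

theorem IsDecomp.re_trace_mul_conj [DecidableEq ι] [DecidableEq κ] {X V : Matrix κ κ ℂ} {x : κ → ℝ}
    (hX : IsDecomp X V x) {U : Matrix ι ι ℂ} (hU : U * Uᴴ = 1) (K : Matrix ι κ ℂ) :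
    (K * X * Kᴴ).trace.re = ∑ i, ∑ j, x j * ‖(Uᴴ * K * V) i j‖ ^ 2 := by
  have h1 : IsDecomp (1 : Matrix ι ι ℂ) U (fun _ => 1) :=
    ⟨by rw [mul_eq_one_comm]; exact hU, hU, by simp [hU]⟩
  have := h1.re_trace_mfun hX K (fun t => t) (fun t => t)
  rw [mfun_id hX.isHermitian, mfun_id isHermitian_one, Matrix.mul_one, Matrix.mul_assoc,
    trace_mul_comm] at this
  simpa using this

/-- The quadratic form of the parallel sum of two eigenvalue families. -/
def parForm (t : ℝ) (y : ι → ℝ) (x : κ → ℝ) (W : Matrix ι κ ℂ) : ℝ :=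
  ∑ i, ∑ j, y i * (t * x j) / (y i + t * x j) * ‖W i j‖ ^ 2

/-- After multiplication by `y + x`, the difference of the two sides (with ‖a‖ + ‖b‖ for ‖a + b‖) is
(y‖a‖ − x‖b‖)². For `y + x = 0` the convention `0 / 0 = 0` gives the right value. -/
theorem parallel_scalar_le {y x : ℝ} (hy : 0 ≤ y) (hx : 0 ≤ x) (a b : ℂ) :
    y * x / (y + x) * ‖a + b‖ ^ 2 ≤ y * ‖a‖ ^ 2 + x * ‖b‖ ^ 2 := by
  rcases eq_or_lt_of_le (add_nonneg hy hx) with h | h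
  · rw [← h]; simp; positivity
  · have h1 : ‖a + b‖ ^ 2 ≤ (‖a‖ + ‖b‖) ^ 2 := by gcongr; exact norm_add_le a b
    have h2 : y * x / (y + x) * ‖a + b‖ ^ 2 ≤ y * x / (y + x) * (‖a‖ + ‖b‖) ^ 2 := by gcongr
    refine h2.trans ?_
    rw [div_mul_eq_mul_div, div_le_iff₀ h]
    nlinarith [sq_nonneg (y * ‖a‖ - x * ‖b‖)]

theorem IsDecomp.parForm_le [DecidableEq ι] [DecidableEq κ] {Y U : Matrix ι ι ℂ} {y : ι → ℝ}
    {X V : Matrix κ κ ℂ} {x : κ → ℝ} (hY : IsDecomp Y U y) (hX : IsDecomp X V x)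
    (y0 : ∀ i, 0 ≤ y i) (x0 : ∀ j, 0 ≤ x j) {t : ℝ} (ht : 0 ≤ t) (K K' : Matrix ι κ ℂ) :
    parForm t y x (Uᴴ * (K + K') * V) ≤
      (Kᴴ * Y * K).trace.re + t * (K' * X * K'ᴴ).trace.re := by
  rw [hY.re_trace_conj_mul hX.right, hX.re_trace_mul_conj hY.right, parForm, Finset.mul_sum,
    ← Finset.sum_add_distrib]
  refine Finset.sum_le_sum fun i _ => ?_
  rw [Finset.mul_sum, ← Finset.sum_add_distrib]
  refine Finset.sum_le_sum fun j _ => ?_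
  rw [Matrix.mul_add, Matrix.add_mul, Matrix.add_apply, ← mul_assoc t]
  exact parallel_scalar_le (y0 i) (mul_nonneg ht (x0 j)) _ _

/-- The bound of `IsDecomp.parForm_le` is attained by splitting the coordinate W_ij in the
proportion t x_j : y_i, the equality case of the scalar inequality. Hence the parallel sum is the
minimum over K = K₁ + K₂ of expressions that are linear in (Y, X). -/
theorem IsDecomp.exists_parForm_eq [DecidableEq ι] [DecidableEq κ] {Y U : Matrix ι ι ℂ} {y : ι → ℝ}
    {X V : Matrix κ κ ℂ} {x : κ → ℝ} (hY : IsDecomp Y U y) (hX : IsDecomp X V x)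
    (y0 : ∀ i, 0 ≤ y i) (x0 : ∀ j, 0 ≤ x j) {t : ℝ} (ht : 0 ≤ t) (K : Matrix ι κ ℂ) :
    ∃ K₁ K₂ : Matrix ι κ ℂ, K = K₁ + K₂ ∧
      (K₁ᴴ * Y * K₁).trace.re + t * (K₂ * X * K₂ᴴ).trace.re = parForm t y x (Uᴴ * K * V) := by
  set W := Uᴴ * K * V with hW
  let W₁ : Matrix ι κ ℂ := of fun i j => ((t * x j / (y i + t * x j) : ℝ) : ℂ) * W i j
  have hcoord : ∀ A : Matrix ι κ ℂ, Uᴴ * (U * A * Vᴴ) * V = A := by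
    intro A
    have : Uᴴ * (U * A * Vᴴ) * V = (Uᴴ * U) * A * (Vᴴ * V) := by simp only [Matrix.mul_assoc]
    rw [this, hY.left, hX.left]; simp
  refine ⟨U * W₁ * Vᴴ, K - U * W₁ * Vᴴ, by simp, ?_⟩
  rw [hY.re_trace_conj_mul hX.right, hX.re_trace_mul_conj hY.right, parForm, Finset.mul_sum,
    ← Finset.sum_add_distrib]
  refine Finset.sum_congr rfl fun i _ => ?_
  rw [Finset.mul_sum, ← Finset.sum_add_distrib]
  refine Finset.sum_congr rfl fun j _ => ?_
  rw [Matrix.mul_sub, Matrix.sub_mul, hcoord, Matrix.sub_apply, ← hW]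
  have e1 : W₁ i j = ((t * x j / (y i + t * x j) : ℝ) : ℂ) * W i j := rfl
  have e2 : W i j - W₁ i j = ((1 - t * x j / (y i + t * x j) : ℝ) : ℂ) * W i j := by
    rw [e1]; push_cast; ring
  rw [e2, e1, norm_mul, norm_mul, Complex.norm_real, Complex.norm_real, mul_pow, mul_pow,
    Real.norm_eq_abs, Real.norm_eq_abs, sq_abs, sq_abs]
  have htx : 0 ≤ t * x j := mul_nonneg ht (x0 j)
  rcases eq_or_lt_of_le (add_nonneg (y0 i) htx) with h | h
  · have h1 : y i = 0 := by linarith [y0 i]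
    have h2 : t * x j = 0 := by linarith [y0 i]
    rw [h1, h2, ← mul_assoc t, h2]; simp
  · have := h.ne'
    field_simp
    ring

/-- A minimum of linear expressions is superadditive: the splitting of K that is optimal for the
sums is admissible for each summand. -/
theorem IsDecomp.sum_parForm_le [DecidableEq ι] [DecidableEq κ] {α : Type*} [Fintype α]
    {Y U : α → Matrix ι ι ℂ} {y : α → ι → ℝ} {X V : α → Matrix κ κ ℂ} {x : α → κ → ℝ}
    (hY : ∀ a, IsDecomp (Y a) (U a) (y a)) (hX : ∀ a, IsDecomp (X a) (V a) (x a))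
    (y0 : ∀ a i, 0 ≤ y a i) (x0 : ∀ a j, 0 ≤ x a j)
    {U' : Matrix ι ι ℂ} {y' : ι → ℝ} {V' : Matrix κ κ ℂ} {x' : κ → ℝ}
    (hY' : IsDecomp (∑ a, Y a) U' y') (hX' : IsDecomp (∑ a, X a) V' x')
    (y0' : ∀ i, 0 ≤ y' i) (x0' : ∀ j, 0 ≤ x' j) {t : ℝ} (ht : 0 ≤ t) (K : Matrix ι κ ℂ) :
    ∑ a, parForm t (y a) (x a) ((U a)ᴴ * K * V a) ≤ parForm t y' x' (U'ᴴ * K * V') := by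
  obtain ⟨K₁, K₂, rfl, h⟩ := hY'.exists_parForm_eq hX' y0' x0' ht K
  rw [← h]
  have e1 : (K₁ᴴ * (∑ a, Y a) * K₁).trace.re = ∑ a, (K₁ᴴ * Y a * K₁).trace.re := by
    rw [Matrix.mul_sum, Matrix.sum_mul, trace_sum, Complex.re_sum]
  have e2 : (K₂ * (∑ a, X a) * K₂ᴴ).trace.re = ∑ a, (K₂ * X a * K₂ᴴ).trace.re := by
    rw [Matrix.mul_sum, Matrix.sum_mul, trace_sum, Complex.re_sum]
  rw [e1, e2, Finset.mul_sum, ← Finset.sum_add_distrib]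
  exact Finset.sum_le_sum fun a _ => (hY a).parForm_le (hX a) (y0 a) (x0 a) ht K₁ K₂

-- Löwner's integral formula for (y/x)^s, multiplied by x: the geometric mean y^s x^{1−s} is a
-- positive average of the parallel sums of y and tx.
open Real Set in
theorem rpow_mul_rpow_eq_integral {s : ℝ} (hs : s ∈ Ioo (0:ℝ) 1) {y x : ℝ} (hy : 0 ≤ y)
    (hx : 0 ≤ x) :
    IntegrableOn (fun t => t ^ (s - 2) * (y * (t * x) / (y + t * x))) (Ioi 0) ∧
    y ^ s * x ^ (1 - s) = (∫ t in Ioi 0, rpowIntegrand₀₁ s t 1)⁻¹ *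
      ∫ t in Ioi 0, t ^ (s - 2) * (y * (t * x) / (y + t * x)) := by
  rcases eq_or_lt_of_le hx with rfl | hx
  · have : (1 - s) ≠ 0 := by have := hs.2; linarith
    simp [Real.zero_rpow this]
  · have hyx : 0 ≤ y / x := by positivity
    have hcongr : EqOn (fun t => t ^ (s - 2) * (y * (t * x) / (y + t * x)))
        (fun t => x * rpowIntegrand₀₁ s t (y / x)) (Ioi 0) := by
      intro t ht
      have ht' : (0:ℝ) < t := ht
      simp only
      rw [rpowIntegrand₀₁_eq_pow_div hs ht'.le hyx]
      have : t ^ (s - 1) = t ^ (s - 2) * t := by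
        rw [← Real.rpow_add_one ht'.ne']; congr 1; ring
      rw [this]
      have h2 : y + t * x ≠ 0 := by positivity
      have h3 : t + y / x ≠ 0 := by positivity
      field_simp
      ring
    refine ⟨?_, ?_⟩
    · rw [integrableOn_congr_fun hcongr measurableSet_Ioi]
      exact (integrableOn_rpowIntegrand₀₁_Ioi hs hyx).const_mul x
    · rw [setIntegral_congr_fun measurableSet_Ioi hcongr, integral_const_mul, mul_left_comm,
        ← rpow_eq_const_mul_integral hs hyx, Real.div_rpow hy hx.le, Real.rpow_sub hx,
        Real.rpow_one]
      field_simp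

open Real Set in
theorem re_trace_mfun_rpow_eq_integral [DecidableEq ι] [DecidableEq κ] {s : ℝ}
    (hs : s ∈ Ioo (0:ℝ) 1) {Y U : Matrix ι ι ℂ} {y : ι → ℝ}
    {X V : Matrix κ κ ℂ} {x : κ → ℝ} (hY : IsDecomp Y U y) (hX : IsDecomp X V x)
    (y0 : ∀ i, 0 ≤ y i) (x0 : ∀ j, 0 ≤ x j) (K : Matrix ι κ ℂ) :
    IntegrableOn (fun t => t ^ (s - 2) * parForm t y x (Uᴴ * K * V)) (Ioi 0) ∧
    (Kᴴ * mfun Y (fun t => t ^ s) * K * mfun X (fun t => t ^ (1 - s))).trace.re =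
      (∫ t in Ioi 0, rpowIntegrand₀₁ s t 1)⁻¹ *
        ∫ t in Ioi 0, t ^ (s - 2) * parForm t y x (Uᴴ * K * V) := by
  have e : (fun t => t ^ (s - 2) * parForm t y x (Uᴴ * K * V)) = fun t => ∑ i, ∑ j,
      t ^ (s - 2) * (y i * (t * x j) / (y i + t * x j)) * ‖(Uᴴ * K * V) i j‖ ^ 2 := by
    ext t
    simp only [parForm, Finset.mul_sum, mul_assoc]
  have hint : ∀ i j, IntegrableOn (fun t => t ^ (s - 2) * (y i * (t * x j) / (y i + t * x j)) *
      ‖(Uᴴ * K * V) i j‖ ^ 2) (Ioi 0) := fun i j =>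
    (rpow_mul_rpow_eq_integral hs (y0 i) (x0 j)).1.mul_const _
  refine ⟨?_, ?_⟩
  · rw [e]
    exact integrable_finsetSum _ fun i _ => integrable_finsetSum _ fun j _ => hint i j
  · rw [e, integral_finsetSum _ fun i _ => integrable_finsetSum _ fun j _ => hint i j,
      hY.re_trace_mfun hX, Finset.mul_sum]
    refine Finset.sum_congr rfl fun i _ => ?_
    rw [integral_finsetSum _ fun j _ => hint i j, Finset.mul_sum]
    refine Finset.sum_congr rfl fun j _ => ?_
    rw [integral_mul_const, ← mul_assoc, ← (rpow_mul_rpow_eq_integral hs (y0 i) (x0 j)).2]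

open Real Set in
/-- Superadditivity form of **Lieb's concavity theorem**. -/
theorem lieb_superadditive {α : Type*} [Fintype α] {s : ℝ} (hs0 : 0 < s) (hs1 : s ≤ 1)
    {Y : α → Matrix ι ι ℂ} {X : α → Matrix κ κ ℂ} (hY : ∀ a, (Y a).PosSemidef)
    (hX : ∀ a, (X a).PosSemidef) (K : Matrix ι κ ℂ) :
    ∑ a, (Kᴴ * mfun (Y a) (fun t => t ^ s) * K * mfun (X a) (fun t => t ^ (1 - s))).trace.re ≤
      (Kᴴ * mfun (∑ a, Y a) (fun t => t ^ s) * K *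
        mfun (∑ a, X a) (fun t => t ^ (1 - s))).trace.re := by
  classical
  have hYs : (∑ a, Y a).PosSemidef := posSemidef_sum _ fun a _ => hY a
  have hXs : (∑ a, X a).PosSemidef := posSemidef_sum _ fun a _ => hX a
  -- The integral formula requires s < 1. At s = 1 the factor `X ^ 0` is the identity even on the
  -- kernel of X, and the functional is linear in Y.
  rcases eq_or_lt_of_le hs1 with rfl | hs1
  · simp only [sub_self, Real.rpow_zero, Real.rpow_one]
    simp only [mfun_one (hX _).isHermitian, mfun_one hXs.isHermitian, mfun_id (hY _).isHermitian,
      mfun_id hYs.isHermitian, Matrix.mul_one]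
    rw [Matrix.mul_sum, Matrix.sum_mul, trace_sum, Complex.re_sum]
  · have dY := fun a => IsDecomp.of_eigen (hY a).isHermitian
    have dX := fun a => IsDecomp.of_eigen (hX a).isHermitian
    have dYs := IsDecomp.of_eigen hYs.isHermitian
    have dXs := IsDecomp.of_eigen hXs.isHermitian
    have h := fun a => re_trace_mfun_rpow_eq_integral ⟨hs0, hs1⟩ (dY a) (dX a) ((dY a).nonneg (hY a))
      ((dX a).nonneg (hX a)) K
    have h' := re_trace_mfun_rpow_eq_integral ⟨hs0, hs1⟩ dYs dXs (dYs.nonneg hYs)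
      (dXs.nonneg hXs) K
    rw [h'.2, Finset.sum_congr rfl fun a _ => (h a).2, ← Finset.mul_sum,
      ← integral_finsetSum _ fun a _ => (h a).1]
    refine mul_le_mul_of_nonneg_left ?_
      (inv_nonneg.2 (integral_rpowIntegrand₀₁_one_pos ⟨hs0, hs1⟩).le)
    refine setIntegral_mono_on (integrable_finsetSum _ fun a _ => (h a).1) h'.1 measurableSet_Ioi ?_
    intro t ht
    rw [← Finset.mul_sum]
    refine mul_le_mul_of_nonneg_left ?_ (Real.rpow_nonneg (le_of_lt ht) _)
    exact IsDecomp.sum_parForm_le dY dX (fun a => (dY a).nonneg (hY a))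
      (fun a => (dX a).nonneg (hX a)) dYs dXs (dYs.nonneg hYs) (dXs.nonneg hXs) (le_of_lt ht) K

end

section

variable {ι κ ν : Type*} [Fintype ι] [Fintype κ] [Fintype ν]

/-! ### The operator norm and positivity -/

section opNorm

open scoped Matrix.Norms.L2Operator

theorem opNorm_eq [DecidableEq κ] (a : Matrix ι κ ℂ) : opNorm a = ‖a‖ := by
  rename_i inst
  have e : inst = fun a b => Classical.propDecidable (a = b) := Subsingleton.elim _ _
  subst e
  rfl

theorem opNorm_nonneg (a : Matrix ι κ ℂ) : 0 ≤ opNorm a := by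
  classical
  rw [opNorm_eq]; exact norm_nonneg a

theorem opNorm_conjTranspose (a : Matrix ι κ ℂ) : opNorm aᴴ = opNorm a := by
  classical
  rw [opNorm_eq, opNorm_eq]; exact l2_opNorm_conjTranspose a

theorem opNorm_mul_le (a : Matrix ι κ ℂ) (b : Matrix κ ν ℂ) :
    opNorm (a * b) ≤ opNorm a * opNorm b := by
  classical
  rw [opNorm_eq, opNorm_eq, opNorm_eq]; exact l2_opNorm_mul a b

theorem opNorm_smul (c : ℂ) (a : Matrix ι κ ℂ) : opNorm (c • a) = ‖c‖ * opNorm a := by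
  classical
  rw [opNorm_eq, opNorm_eq]; exact norm_smul c a

theorem star_dotProduct_self (x : ι → ℂ) : star x ⬝ᵥ x = ((‖WithLp.toLp 2 x‖ ^ 2 : ℝ) : ℂ) := by
  rw [EuclideanSpace.norm_sq_eq, dotProduct]
  push_cast
  refine Finset.sum_congr rfl fun i _ => ?_
  rw [Pi.star_apply, RCLike.star_def, RCLike.conj_mul]; simp

theorem quadForm_sub [DecidableEq κ] (c : ℝ) (a : Matrix ι κ ℂ) (x : κ → ℂ) :
    star x ⬝ᵥ (((c ^ 2 : ℝ) : ℂ) • (1 : Matrix κ κ ℂ) - aᴴ * a) *ᵥ x =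
      ((c ^ 2 * ‖WithLp.toLp 2 x‖ ^ 2 - ‖WithLp.toLp 2 (a *ᵥ x)‖ ^ 2 : ℝ) : ℂ) := by
  rw [sub_mulVec, smul_mulVec, one_mulVec, dotProduct_sub, dotProduct_smul, star_dotProduct_self,
    ← mulVec_mulVec, dotProduct_mulVec, vecMul_conjTranspose, star_star, star_dotProduct_self]
  simp

theorem posSemidef_opNorm_sq_sub [DecidableEq κ] (a : Matrix ι κ ℂ) {c : ℝ} (hc : opNorm a ≤ c) :
    (((c ^ 2 : ℝ) : ℂ) • (1 : Matrix κ κ ℂ) - aᴴ * a).PosSemidef := by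
  refine PosSemidef.of_dotProduct_mulVec_nonneg ?_ fun x => ?_
  · refine IsHermitian.sub ?_ (isHermitian_conjTranspose_mul_self a)
    rw [IsHermitian, conjTranspose_smul, conjTranspose_one]; simp
  · rw [quadForm_sub]
    rw [Complex.zero_le_real, sub_nonneg, ← mul_pow]
    have h := l2_opNorm_mulVec a (WithLp.toLp 2 x)
    rw [← opNorm_eq] at h
    have h2 : ‖WithLp.toLp 2 (a *ᵥ x)‖ ≤ opNorm a * ‖WithLp.toLp 2 x‖ := h
    gcongr
    exact h2.trans (by gcongr)

theorem opNorm_le_of_posSemidef [DecidableEq κ] {a : Matrix ι κ ℂ} {c : ℝ} (hc : 0 ≤ c)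
    (h : (((c ^ 2 : ℝ) : ℂ) • (1 : Matrix κ κ ℂ) - aᴴ * a).PosSemidef) : opNorm a ≤ c := by
  rw [opNorm_eq, l2_opNorm_def]
  refine ContinuousLinearMap.opNorm_le_bound _ hc fun x => ?_
  have h1 := h.dotProduct_mulVec_nonneg (WithLp.ofLp x)
  rw [quadForm_sub, Complex.zero_le_real, sub_nonneg, ← mul_pow] at h1
  exact (sq_le_sq₀ (norm_nonneg _) (by positivity)).1 h1

theorem posSemidef_one_sub_of_opNorm_le_one [DecidableEq κ] {a : Matrix ι κ ℂ} (h : opNorm a ≤ 1) :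
    (1 - aᴴ * a).PosSemidef := by
  have := posSemidef_opNorm_sq_sub a h
  simpa using this

theorem opNorm_le_one_of_posSemidef [DecidableEq κ] {a : Matrix ι κ ℂ}
    (h : (1 - aᴴ * a).PosSemidef) : opNorm a ≤ 1 :=
  opNorm_le_of_posSemidef zero_le_one (by simpa using h)

theorem opNorm_le_one_of_isometry [DecidableEq κ] {a : Matrix ι κ ℂ}
    (h : aᴴ * a = 1) : opNorm a ≤ 1 :=
  opNorm_le_one_of_posSemidef (by rw [h, sub_self]; exact PosSemidef.zero)

theorem opNorm_one_le [DecidableEq ι] : opNorm (1 : Matrix ι ι ℂ) ≤ 1 :=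
  opNorm_le_one_of_isometry (by simp)

end opNorm

/-! ### Finite ℓ^q-norms and substochastic matrices -/

section lqn

/-- The `ℓ^q`-norm of a finite family of reals. -/
def lqn (q : ℝ≥0∞) (x : ι → ℝ) : ℝ := ‖(WithLp.toLp q x : PiLp q fun _ : ι => ℝ)‖

theorem lqn_top (x : ι → ℝ) : lqn ∞ x = ⨆ i, |x i| := by
  rw [lqn, PiLp.norm_eq_ciSup]; rfl

theorem lqn_of_ne_top {q : ℝ≥0∞} (h1 : 1 ≤ q) (ht : q ≠ ∞) (x : ι → ℝ) :
    lqn q x = (∑ i, |x i| ^ q.toReal) ^ (1 / q.toReal) := by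
  have : 0 < q.toReal := ENNReal.toReal_pos (zero_lt_one.trans_le h1).ne' ht
  rw [lqn, PiLp.norm_eq_sum this]; rfl

theorem one_le_toReal {q : ℝ≥0∞} (h1 : 1 ≤ q) (ht : q ≠ ∞) : 1 ≤ q.toReal := by
  have := ENNReal.toReal_mono ht h1
  simpa using this

theorem lqn_nonneg {q : ℝ≥0∞} (h1 : 1 ≤ q) (x : ι → ℝ) : 0 ≤ lqn q x := by
  have : Fact (1 ≤ q) := ⟨h1⟩
  exact norm_nonneg _

theorem lqn_add_le {q : ℝ≥0∞} (h1 : 1 ≤ q) (x y : ι → ℝ) : lqn q (x + y) ≤ lqn q x + lqn q y := by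
  have : Fact (1 ≤ q) := ⟨h1⟩
  exact norm_add_le (WithLp.toLp q x) (WithLp.toLp q y)

theorem lqn_smul {q : ℝ≥0∞} (h1 : 1 ≤ q) (c : ℝ) (x : ι → ℝ) :
    lqn q (fun i => c * x i) = |c| * lqn q x := by
  have : Fact (1 ≤ q) := ⟨h1⟩
  exact norm_smul c (WithLp.toLp q x)

theorem rpow_sum_le_of_sub_one {w x : ι → ℝ} (hw : ∀ i, 0 ≤ w i) (hw1 : ∑ i, w i ≤ 1)
    (hx : ∀ i, 0 ≤ x i) {r : ℝ} (hr : 1 ≤ r) : (∑ i, w i * x i) ^ r ≤ ∑ i, w i * x i ^ r := by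
  have hr0 : r ≠ 0 := by positivity
  -- The missing mass 1 − ∑ w is placed at the value 0 under the extra index `none`, where it
  -- contributes nothing to either side.
  have h := Real.rpow_arith_mean_le_arith_mean_rpow (Finset.univ : Finset (Option ι))
    (fun o => o.elim (1 - ∑ i, w i) w) (fun o => o.elim 0 x) (by
      rintro (_ | i) _ <;> simp [hw1, hw]) (by simp [Fintype.sum_option]) (by
      rintro (_ | i) _ <;> simp [hx]) hr
  simpa [Fintype.sum_option, hr0] using h

/-- Jensen along each row gives z_i^q ≤ ∑_j B_ij x_j^q, and the column sums finish. The squared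
moduli of the entries of a contraction form such a matrix B, which makes this the source of the
eigenvalue comparisons for `rs`. -/
theorem lqn_substochastic_le {q : ℝ≥0∞} (h1 : 1 ≤ q) {B : Matrix κ ι ℝ} (hB : ∀ i j, 0 ≤ B i j)
    (hrow : ∀ i, ∑ j, B i j ≤ 1) (hcol : ∀ j, ∑ i, B i j ≤ 1) {x : ι → ℝ} (hx : ∀ i, 0 ≤ x i)
    {z : κ → ℝ} (hz0 : ∀ i, 0 ≤ z i) (hz : ∀ i, z i ≤ ∑ j, B i j * x j) : lqn q z ≤ lqn q x := by
  by_cases ht : q = ∞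
  · subst ht
    rw [lqn_top, lqn_top]
    have hbdd : BddAbove (Set.range fun i => |x i|) := Set.finite_range _ |>.bddAbove
    have hs : 0 ≤ ⨆ i, |x i| := Real.iSup_nonneg fun i => abs_nonneg _
    refine Real.iSup_le (fun i => ?_) hs
    rw [abs_of_nonneg (hz0 i)]
    refine (hz i).trans ?_
    calc ∑ j, B i j * x j ≤ ∑ j, B i j * ⨆ i, |x i| := Finset.sum_le_sum fun j _ =>
          mul_le_mul_of_nonneg_left ((le_abs_self _).trans (le_ciSup hbdd j)) (hB i j)
      _ = (∑ j, B i j) * ⨆ i, |x i| := by rw [Finset.sum_mul]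
      _ ≤ 1 * ⨆ i, |x i| := mul_le_mul_of_nonneg_right (hrow i) hs
      _ = _ := one_mul _
  · rw [lqn_of_ne_top h1 ht, lqn_of_ne_top h1 ht]
    have hr := one_le_toReal h1 ht
    refine Real.rpow_le_rpow (Finset.sum_nonneg fun i _ => by positivity) ?_ (by positivity)
    calc ∑ i, |z i| ^ q.toReal ≤ ∑ i, ∑ j, B i j * x j ^ q.toReal := by
          refine Finset.sum_le_sum fun i _ => ?_
          rw [abs_of_nonneg (hz0 i)]
          refine (Real.rpow_le_rpow (hz0 i) (hz i) (by positivity)).trans ?_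
          exact rpow_sum_le_of_sub_one (hB i) (hrow i) hx hr
      _ = ∑ j, (∑ i, B i j) * x j ^ q.toReal := by
          rw [Finset.sum_comm]; simp only [Finset.sum_mul]
      _ ≤ ∑ j, |x j| ^ q.toReal := by
          refine Finset.sum_le_sum fun j _ => ?_
          rw [abs_of_nonneg (hx j)]
          exact mul_le_of_le_one_left (Real.rpow_nonneg (hx j) _) (hcol j)

theorem lqn_two_mul_sqrt {q : ℝ≥0∞} (h1 : 1 ≤ q) {x : ι → ℝ} (hx : ∀ i, 0 ≤ x i) :
    lqn (2 * q) (fun i => √(x i)) = √(lqn q x) := by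
  by_cases ht : q = ∞
  · subst ht
    have : (2 : ℝ≥0∞) * ∞ = ∞ := by simp
    rw [this, lqn_top, lqn_top]
    rcases isEmpty_or_nonempty ι with h | h
    · simp
    · have hbdd : BddAbove (Set.range fun i => |x i|) := Set.finite_range _ |>.bddAbove
      have hbdd' : BddAbove (Set.range fun i => |√(x i)|) := Set.finite_range _ |>.bddAbove
      refine le_antisymm (ciSup_le fun i => ?_) ?_
      · rw [abs_of_nonneg (Real.sqrt_nonneg _)]
        exact Real.sqrt_le_sqrt ((le_abs_self _).trans (le_ciSup hbdd i))
      · rw [Real.sqrt_le_left (Real.iSup_nonneg fun i => abs_nonneg _)]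
        refine ciSup_le fun i => ?_
        rw [abs_of_nonneg (hx i)]
        calc x i = √(x i) ^ 2 := (Real.sq_sqrt (hx i)).symm
          _ ≤ _ := by
            gcongr
            exact (le_abs_self _).trans (le_ciSup hbdd' i)
  · have h2 : 1 ≤ 2 * q := by
      calc (1:ℝ≥0∞) ≤ 1 * q := by simpa
        _ ≤ 2 * q := by gcongr; norm_num
    have ht2 : 2 * q ≠ ∞ := ENNReal.mul_ne_top (by norm_num) ht
    have hr := one_le_toReal h1 ht
    rw [lqn_of_ne_top h2 ht2, lqn_of_ne_top h1 ht, Real.sqrt_eq_rpow, ← Real.rpow_mul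
      (Finset.sum_nonneg fun i _ => by positivity), ENNReal.toReal_mul]
    congr 1
    · refine Finset.sum_congr rfl fun i _ => ?_
      rw [abs_of_nonneg (Real.sqrt_nonneg _), abs_of_nonneg (hx i), Real.sqrt_eq_rpow,
        ← Real.rpow_mul (hx i)]
      congr 1
      simp
    · simp

end lqn

/-! ### Schatten norms of positive matrices -/

section rs

/-- The Schatten `q`-norm of a positive matrix: the `ℓ^q`-norm of the eigenvalues. -/
def rs (q : ℝ≥0∞) (H : Matrix ι ι ℂ) : ℝ :=
  open scoped Classical in if h : H.IsHermitian then lqn q h.eigenvalues else 0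

theorem rs_nonneg {q : ℝ≥0∞} (h1 : 1 ≤ q) (H : Matrix ι ι ℂ) : 0 ≤ rs q H := by
  rw [rs]; split_ifs
  · exact lqn_nonneg h1 _
  · exact le_rfl

theorem sum_normSq_row_le_one [DecidableEq κ] {M : Matrix κ ι ℂ} (h : opNorm M ≤ 1) (i : κ) :
    ∑ j, ‖M i j‖ ^ 2 ≤ 1 := by
  have h1 := posSemidef_one_sub_of_opNorm_le_one (a := Mᴴ) (by rwa [opNorm_conjTranspose])
  have h2 := h1.diag_nonneg (i := i)
  rw [conjTranspose_conjTranspose, Matrix.sub_apply, one_apply_eq, mul_apply] at h2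
  have e : ∑ j, M i j * Mᴴ j i = ((∑ j, ‖M i j‖ ^ 2 : ℝ) : ℂ) := by
    push_cast
    refine Finset.sum_congr rfl fun j _ => ?_
    rw [conjTranspose_apply, RCLike.star_def, RCLike.mul_conj]; simp
  rw [e, ← Complex.ofReal_one, ← Complex.ofReal_sub, Complex.zero_le_real] at h2
  linarith

theorem sum_normSq_col_le_one [DecidableEq ι] {M : Matrix κ ι ℂ} (h : opNorm M ≤ 1) (j : ι) :
    ∑ i, ‖M i j‖ ^ 2 ≤ 1 := by
  have := sum_normSq_row_le_one (M := Mᴴ) (by rwa [opNorm_conjTranspose]) j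
  simpa using this

theorem IsDecomp.conj_diag [DecidableEq ι] {H U : Matrix ι ι ℂ} {l : ι → ℝ} (h : IsDecomp H U l)
    (C : Matrix κ ι ℂ) (i : κ) : ((C * H * Cᴴ) i i).re = ∑ j, ‖(C * U) i j‖ ^ 2 * l j := by
  have e : C * H * Cᴴ = (C * U) * (diagonal (fun i => (l i : ℂ)) * (C * U)ᴴ) := by
    rw [conjTranspose_mul]
    conv_lhs => rw [h.eq]
    simp only [Matrix.mul_assoc]
  rw [e, mul_apply, Complex.re_sum]
  refine Finset.sum_congr rfl fun j _ => ?_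
  rw [diagonal_mul, conjTranspose_apply, mul_left_comm, RCLike.star_def, RCLike.mul_conj, mul_comm]
  have : (((‖(C * U) i j‖ ^ 2 * l j : ℝ) : ℂ)).re = ‖(C * U) i j‖ ^ 2 * l j := Complex.ofReal_re _
  rw [← this]
  congr 1
  push_cast
  rfl

/-- Compressing a positive matrix by a contraction and taking the diagonal decreases `ℓ^q`. -/
theorem IsDecomp.lqn_diag_le [DecidableEq ι] [DecidableEq κ] {q : ℝ≥0∞} (h1 : 1 ≤ q)
    {H U : Matrix ι ι ℂ} {l : ι → ℝ} (h : IsDecomp H U l) (hl : ∀ i, 0 ≤ l i)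
    {C : Matrix κ ι ℂ} (hC : opNorm C ≤ 1) {z : κ → ℝ} (hz0 : ∀ i, 0 ≤ z i)
    (hz : ∀ i, z i ≤ ((C * H * Cᴴ) i i).re) : lqn q z ≤ lqn q l := by
  have hCU : opNorm (C * U) ≤ 1 := (opNorm_mul_le _ _).trans
    (mul_le_one₀ hC (opNorm_nonneg _) (opNorm_le_one_of_isometry h.left))
  refine lqn_substochastic_le h1 (B := of fun i j => ‖(C * U) i j‖ ^ 2) (fun i j => ?_)
    (fun i => ?_) (fun j => ?_) hl hz0 (fun i => ?_)
  · simp only [of_apply]; positivity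
  · exact sum_normSq_row_le_one hCU i
  · exact sum_normSq_col_le_one hCU j
  · exact (hz i).trans_eq (h.conj_diag C i)

theorem IsDecomp.conj_eq [DecidableEq ι] {H U : Matrix ι ι ℂ} {l : ι → ℝ} (h : IsDecomp H U l) :
    Uᴴ * H * U = diagonal (fun i => (l i : ℂ)) := by
  have e : Uᴴ * H * U = (Uᴴ * U) * diagonal (fun i => (l i : ℂ)) * (Uᴴ * U) := by
    conv_lhs => rw [h.eq]
    simp only [Matrix.mul_assoc]
  rw [e, h.left]; simp

theorem IsDecomp.conj_diag_self [DecidableEq ι] {H U : Matrix ι ι ℂ} {l : ι → ℝ}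
    (h : IsDecomp H U l) (i : ι) : l i = ((Uᴴ * H * (Uᴴ)ᴴ) i i).re := by
  rw [conjTranspose_conjTranspose, h.conj_eq]; simp

/-- Each of the two eigenvalue families is the diagonal of H in its own eigenbasis, so
`IsDecomp.lqn_diag_le` applies in both directions. -/
theorem IsDecomp.rs_eq [DecidableEq ι] {q : ℝ≥0∞} (h1 : 1 ≤ q) {H U : Matrix ι ι ℂ} {l : ι → ℝ}
    (h : IsDecomp H U l) (hl : ∀ i, 0 ≤ l i) : rs q H = lqn q l := by
  rename_i inst
  have e : inst = fun a b => Classical.propDecidable (a = b) := Subsingleton.elim _ _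
  subst e
  classical
  rw [rs, dif_pos h.isHermitian]
  have hd := IsDecomp.of_eigen h.isHermitian
  have hl' := hd.nonneg (h.posSemidef hl)
  refine le_antisymm ?_ ?_
  · refine h.lqn_diag_le h1 hl (C := (h.isHermitian.eigenvectorUnitary : Matrix ι ι ℂ)ᴴ)
      ?_ hl' fun i => (hd.conj_diag_self i).le
    rw [opNorm_conjTranspose]; exact opNorm_le_one_of_isometry hd.left
  · refine hd.lqn_diag_le h1 hl' (C := Uᴴ) ?_ hl fun i => (h.conj_diag_self i).le
    rw [opNorm_conjTranspose]; exact opNorm_le_one_of_isometry h.left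

/-- `rs` decreases under compressions by contractions and under the positive order. -/
theorem rs_le_of_le_conj {q : ℝ≥0∞} (h1 : 1 ≤ q) {H : Matrix ι ι ℂ} (hH : H.PosSemidef)
    {H' : Matrix κ κ ℂ} (hH' : H'.PosSemidef) {C : Matrix κ ι ℂ} (hC : opNorm C ≤ 1)
    (h : (C * H * Cᴴ - H').PosSemidef) : rs q H' ≤ rs q H := by
  classical
  have d := IsDecomp.of_eigen hH.isHermitian
  have d' := IsDecomp.of_eigen hH'.isHermitian
  rw [d.rs_eq h1 (d.nonneg hH), d'.rs_eq h1 (d'.nonneg hH')]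
  set V := (hH'.isHermitian.eigenvectorUnitary : Matrix κ κ ℂ)
  refine d.lqn_diag_le h1 (d.nonneg hH) (C := Vᴴ * C) ?_ (d'.nonneg hH') fun i => ?_
  · refine (opNorm_mul_le _ _).trans (mul_le_one₀ ?_ (opNorm_nonneg _) hC)
    rw [opNorm_conjTranspose]; exact opNorm_le_one_of_isometry d'.left
  · rw [d'.conj_diag_self i]
    have h2 := (h.conjTranspose_mul_mul_same V).diag_nonneg (i := i)
    have e : Vᴴ * (C * H * Cᴴ - H') * V = (Vᴴ * C) * H * (Vᴴ * C)ᴴ - Vᴴ * H' * (Vᴴ)ᴴ := by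
      rw [conjTranspose_mul, conjTranspose_conjTranspose, Matrix.mul_sub, Matrix.sub_mul]
      simp only [Matrix.mul_assoc]
    rw [e, Matrix.sub_apply] at h2
    have := (Complex.le_def.1 h2).1
    simp only [Complex.zero_re, Complex.sub_re] at this
    linarith

theorem rs_mono {q : ℝ≥0∞} (h1 : 1 ≤ q) {H H' : Matrix ι ι ℂ} (hH' : H'.PosSemidef)
    (h : (H - H').PosSemidef) : rs q H' ≤ rs q H := by
  classical
  have hH : H.PosSemidef := by simpa using h.add hH'
  exact rs_le_of_le_conj h1 hH hH' (C := 1) opNorm_one_le (by simpa using h)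

theorem rs_conj_le {q : ℝ≥0∞} (h1 : 1 ≤ q) {H : Matrix ι ι ℂ} (hH : H.PosSemidef)
    {C : Matrix κ ι ℂ} (hC : opNorm C ≤ 1) : rs q (C * H * Cᴴ) ≤ rs q H :=
  rs_le_of_le_conj h1 hH (hH.mul_mul_conjTranspose_same C) hC
    (by rw [sub_self]; exact PosSemidef.zero)

theorem rs_smul {q : ℝ≥0∞} (h1 : 1 ≤ q) {H : Matrix ι ι ℂ} (hH : H.PosSemidef) {c : ℝ}
    (hc : 0 ≤ c) : rs q ((c : ℂ) • H) = c * rs q H := by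
  classical
  have d := IsDecomp.of_eigen hH.isHermitian
  rw [(d.smul c).rs_eq h1 (fun i => mul_nonneg hc (d.nonneg hH i)), d.rs_eq h1 (d.nonneg hH),
    lqn_smul h1, abs_of_nonneg hc]

/-- In an eigenbasis of H + H' the eigenvalues are the sums of the diagonals of H and H'.
Minkowski's inequality separates them, and passing to a diagonal decreases the ℓ^q-norm. -/
theorem rs_add_le {q : ℝ≥0∞} (h1 : 1 ≤ q) {H H' : Matrix ι ι ℂ} (hH : H.PosSemidef)
    (hH' : H'.PosSemidef) : rs q (H + H') ≤ rs q H + rs q H' := by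
  classical
  have d := IsDecomp.of_eigen hH.isHermitian
  have d' := IsDecomp.of_eigen hH'.isHermitian
  have hs := hH.add hH'
  have ds := IsDecomp.of_eigen hs.isHermitian
  set V := (hs.isHermitian.eigenvectorUnitary : Matrix ι ι ℂ)
  have hV : opNorm Vᴴ ≤ 1 := by
    rw [opNorm_conjTranspose]; exact opNorm_le_one_of_isometry ds.left
  rw [d.rs_eq h1 (d.nonneg hH), d'.rs_eq h1 (d'.nonneg hH'), ds.rs_eq h1 (ds.nonneg hs)]
  have e : hs.isHermitian.eigenvalues = (fun i => ((Vᴴ * H * (Vᴴ)ᴴ) i i).re) +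
      fun i => ((Vᴴ * H' * (Vᴴ)ᴴ) i i).re := by
    ext i
    rw [ds.conj_diag_self i, Matrix.mul_add, Matrix.add_mul]; rfl
  rw [e]
  refine (lqn_add_le h1 _ _).trans (add_le_add ?_ ?_)
  · refine d.lqn_diag_le h1 (d.nonneg hH) hV (fun i => ?_) fun i => le_rfl
    exact (Complex.le_def.1 (hH.mul_mul_conjTranspose_same Vᴴ).diag_nonneg).1
  · refine d'.lqn_diag_le h1 (d'.nonneg hH') hV (fun i => ?_) fun i => le_rfl
    exact (Complex.le_def.1 (hH'.mul_mul_conjTranspose_same Vᴴ).diag_nonneg).1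

theorem rs_zero {q : ℝ≥0∞} (h1 : 1 ≤ q) : rs q (0 : Matrix ι ι ℂ) = 0 := by
  have := rs_smul h1 (PosSemidef.zero (n := ι) (R := ℂ)) (c := 0) le_rfl
  simpa using this

/-- For finite `q`, `rs` is a trace. -/
theorem rs_rpow {q : ℝ≥0∞} (h1 : 1 ≤ q) (ht : q ≠ ∞) {H : Matrix ι ι ℂ} (hH : H.PosSemidef) :
    rs q H ^ q.toReal = (mfun H (fun t => t ^ q.toReal)).trace.re := by
  classical
  have d := IsDecomp.of_eigen hH.isHermitian
  have hr := one_le_toReal h1 ht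
  rw [d.rs_eq h1 (d.nonneg hH), d.trace_mfun, lqn_of_ne_top h1 ht, ← Real.rpow_mul
    (Finset.sum_nonneg fun i _ => by positivity), one_div, inv_mul_cancel₀ (by positivity),
    Real.rpow_one, Complex.ofReal_re]
  simp only [abs_of_nonneg (d.nonneg hH _)]

theorem rs_conjTranspose_mul_self {q : ℝ≥0∞} (a : Matrix ι ι ℂ) : rs q (aᴴ * a) = rs q (a * aᴴ) := by
  classical
  rw [rs, rs, dif_pos (isHermitian_conjTranspose_mul_self a),
    dif_pos (isHermitian_mul_conjTranspose_self a)]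
  congr 1
  exact (IsHermitian.eigenvalues_eq_eigenvalues_iff _ _).2 (charpoly_mul_comm _ _)

/-- Weights in S^{2q} are always measured through a* a or a a*, since the q-norm of positive
matrices is monotone and additive over block rows up to the triangle inequality. -/
theorem schattenNorm_two_mul {q : ℝ≥0∞} (h1 : 1 ≤ q) (a : Matrix ι ι ℂ) :
    schattenNorm (2 * q) a = √(rs q (aᴴ * a)) := by
  classical
  rw [rs, dif_pos (isHermitian_conjTranspose_mul_self a), ← lqn_two_mul_sqrt h1]
  · rfl
  · exact (IsDecomp.of_eigen _).nonneg (posSemidef_conjTranspose_mul_self a)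

theorem schattenNorm_two_mul' {q : ℝ≥0∞} (h1 : 1 ≤ q) (a : Matrix ι ι ℂ) :
    schattenNorm (2 * q) a = √(rs q (a * aᴴ)) := by
  rw [schattenNorm_two_mul h1, rs_conjTranspose_mul_self]

/-- The trace of a function of `a* a` equals that of `a a*` when the function vanishes at `0`. -/
theorem trace_mfun_conjTranspose_mul (a : Matrix ι κ ℂ) {r : ℝ} (hr : 1 ≤ r) :
    (mfun (aᴴ * a) (fun t => t ^ r)).trace = (mfun (a * aᴴ) (fun t => t ^ r)).trace := by
  have hL := posSemidef_conjTranspose_mul_self a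
  have hR := posSemidef_self_mul_conjTranspose a
  have key : ∀ t : ℝ, 0 ≤ t → t ^ r = t ^ (r - 1) * t := by
    intro t ht
    rcases eq_or_lt_of_le ht with rfl | ht
    · rw [Real.zero_rpow (by linarith), mul_zero]
    · rw [← Real.rpow_add_one ht.ne']; simp
  have e1 : mfun (aᴴ * a) (fun t => t ^ r) = mfun (aᴴ * a) (fun t => t ^ (r - 1)) * (aᴴ * a) := by
    conv_rhs => rw [← mfun_id hL.isHermitian, mfun_mfun hL.isHermitian, mfun_mul]
    exact mfun_congr hL key
  have e2 : mfun (a * aᴴ) (fun t => t ^ r) = mfun (a * aᴴ) (fun t => t ^ (r - 1)) * (a * aᴴ) := by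
    conv_rhs => rw [← mfun_id hR.isHermitian, mfun_mfun hR.isHermitian, mfun_mul]
    exact mfun_congr hR key
  have e3 := mul_mfun_of_intertwine hL.isHermitian hR.isHermitian (a := a)
    (by simp only [Matrix.mul_assoc]) (fun t => t ^ (r - 1))
  rw [e1, e2, ← Matrix.mul_assoc (mfun (a * aᴴ) _), ← e3, ← Matrix.mul_assoc, trace_mul_comm,
    Matrix.mul_assoc a]

end rs

/-! ### Epstein's concavity theorem -/

section epstein

/-- In a pair of eigenbases all three traces carry the same nonnegative weights, and the inequality
is the weighted arithmetic-geometric mean inequality for each pair of eigenvalues. -/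
theorem re_trace_young {s : ℝ} (hs0 : 0 < s) (hs1 : s ≤ 1) {A B : Matrix ι ι ℂ}
    (hA : A.PosSemidef) (hB : B.PosSemidef) :
    (mfun A (fun t => t ^ s) * mfun B (fun t => t ^ (1 - s))).trace.re ≤
      s * A.trace.re + (1 - s) * B.trace.re := by
  classical
  have dA := IsDecomp.of_eigen hA.isHermitian
  have dB := IsDecomp.of_eigen hB.isHermitian
  have e := dA.re_trace_mfun dB 1 (fun t => t ^ s) (fun t => t ^ (1 - s))
  have eA := dA.re_trace_conj_mul dB.right 1
  have eB := dB.re_trace_mul_conj dA.right 1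
  simp only [conjTranspose_one, Matrix.one_mul, Matrix.mul_one] at e eA eB
  rw [e, eA, eB, Finset.mul_sum, Finset.mul_sum, ← Finset.sum_add_distrib]
  refine Finset.sum_le_sum fun i _ => ?_
  rw [Finset.mul_sum, Finset.mul_sum, ← Finset.sum_add_distrib]
  refine Finset.sum_le_sum fun j _ => ?_
  rw [← mul_assoc, ← mul_assoc, ← add_mul]
  refine mul_le_mul_of_nonneg_right ?_ (by positivity)
  exact Real.geom_mean_le_arith_mean2_weighted hs0.le (by linarith) (dA.nonneg hA i)
    (dB.nonneg hB j) (by ring)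

/-- Superadditivity form of **Epstein's concavity theorem**. -/
theorem epstein_superadditive {α : Type*} [Fintype α] {r : ℝ} (hr : 1 ≤ r)
    {Y : α → Matrix ι ι ℂ} (hY : ∀ a, (Y a).PosSemidef) (m : Matrix ι κ ℂ) :
    ∑ a, (mfun (mᴴ * mfun (Y a) (fun t => t ^ (1 / r)) * m) (fun t => t ^ r)).trace.re ≤
      (mfun (mᴴ * mfun (∑ a, Y a) (fun t => t ^ (1 / r)) * m) (fun t => t ^ r)).trace.re := by
  have hr0 : 0 < r := by positivity
  have hs0 : 0 < 1 / r := by positivity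
  have hs1 : 1 / r ≤ 1 := by rw [div_le_one hr0]; exact hr
  have hYs : (∑ a, Y a).PosSemidef := posSemidef_sum _ fun a _ => hY a
  have hps : ∀ {A : Matrix ι ι ℂ}, A.PosSemidef →
      (mᴴ * mfun A (fun t => t ^ (1 / r)) * m).PosSemidef := fun hA =>
    (mfun_posSemidef hA fun x hx => Real.rpow_nonneg hx _).conjTranspose_mul_mul_same m
  set H := fun a => mᴴ * mfun (Y a) (fun t => t ^ (1 / r)) * m with hH
  set H' := mᴴ * mfun (∑ a, Y a) (fun t => t ^ (1 / r)) * m with hH'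
  have hHp : ∀ a, (H a).PosSemidef := fun a => hps (hY a)
  have hXp : ∀ a, (mfun (H a) (fun t => t ^ r)).PosSemidef := fun a =>
    mfun_posSemidef (hHp a) fun x hx => Real.rpow_nonneg hx _
  -- Lieb's theorem with X_a = H_a^r and exponent 1/r: each term on the left collapses to tr H_a^r,
  -- and the right side is tr H'(∑ H_a^r)^{1−1/r}. Young's inequality bounds it by (1/r) tr H'^r +
  -- (1 − 1/r) ∑ tr H_a^r, whose last sum is absorbed on the left.
  have hl := lieb_superadditive hs0 hs1 hY hXp m
  have e1 : ∀ a, (mᴴ * mfun (Y a) (fun t => t ^ (1 / r)) * m *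
      mfun (mfun (H a) (fun t => t ^ r)) (fun t => t ^ (1 - 1 / r))).trace.re =
      (mfun (H a) (fun t => t ^ r)).trace.re := by
    intro a
    change (H a * _).trace.re = _
    have : H a * mfun (mfun (H a) (fun t => t ^ r)) (fun t => t ^ (1 - 1 / r)) =
        mfun (H a) (fun t => t ^ r) := by
      conv_lhs => rw [mfun_mfun (hHp a).isHermitian]
      conv_lhs => enter [1]; rw [← mfun_id (hHp a).isHermitian]
      rw [mfun_mul]
      refine mfun_congr (hHp a) fun x hx => ?_
      rcases eq_or_lt_of_le hx with rfl | hx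
      · rw [Real.zero_rpow (by linarith), zero_mul]
      · rw [← Real.rpow_mul hx.le, mul_comm, ← Real.rpow_add_one hx.ne']
        congr 1; field_simp; ring
    rw [this]
  rw [Finset.sum_congr rfl fun a _ => e1 a] at hl
  have hX's : (∑ a, mfun (H a) (fun t => t ^ r)).PosSemidef := posSemidef_sum _ fun a _ => hXp a
  have hH'p : H'.PosSemidef := hps hYs
  have e2 : mfun (mfun H' (fun t => t ^ r)) (fun t => t ^ (1 / r)) = H' := by
    rw [mfun_mfun hH'p.isHermitian]
    conv_rhs => rw [← mfun_id hH'p.isHermitian]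
    refine mfun_congr hH'p fun x hx => ?_
    rw [← Real.rpow_mul hx, mul_one_div_cancel hr0.ne', Real.rpow_one]
  have hy := re_trace_young hs0 hs1
    (mfun_posSemidef hH'p (f := fun t => t ^ r) fun x hx => Real.rpow_nonneg hx _) hX's
  rw [e2] at hy
  have e3 : (∑ a, mfun (H a) (fun t => t ^ r)).trace.re =
      ∑ a, (mfun (H a) (fun t => t ^ r)).trace.re := by
    rw [trace_sum, Complex.re_sum]
  rw [e3] at hy
  have := hl.trans hy
  have h3 : 1 / r * ∑ a, (mfun (H a) (fun t => t ^ r)).trace.re ≤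
      1 / r * (mfun H' fun t => t ^ r).trace.re := by linarith
  exact le_of_mul_le_mul_left h3 hs0

end epstein

end

section

variable {ι κ ν : Type*} [Fintype ι] [Fintype κ] [Fintype ν]

/-! ### Algebra of the two-sided scalar action -/

section sandwichAlgebra

variable {V : Type*} [AddCommGroup V] [Module ℂ V] {m n k l : Type*}

theorem sandwich_apply [Fintype k] [Fintype l] (a : Matrix m k ℂ) (x : Matrix k l V)
    (b : Matrix l n ℂ) (i : m) (j : n) :
    sandwich a x b i j = ∑ r, ∑ s, (a i r * b s j) • x r s := rfl

theorem sandwich_sandwich {m' n' : Type*} [Fintype k] [Fintype l] [Fintype m] [Fintype n]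
    (a : Matrix m' m ℂ) (b : Matrix n n' ℂ)
    (a' : Matrix m k ℂ) (x : Matrix k l V) (b' : Matrix l n ℂ) :
    sandwich a (sandwich a' x b') b = sandwich (a * a') x (b' * b) := by
  ext i j
  simp only [sandwich_apply, mul_apply, Finset.smul_sum, Finset.sum_mul, Finset.mul_sum,
    Finset.sum_smul, smul_smul]
  have e1 : ∀ r : m, ∑ s : n, ∑ r' : k, ∑ s' : l, (a i r * b s j * (a' r r' * b' s' s)) • x r' s' =
      ∑ r' : k, ∑ s' : l, ∑ s : n, (a i r * b s j * (a' r r' * b' s' s)) • x r' s' := by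
    intro r
    rw [Finset.sum_comm]
    exact Finset.sum_congr rfl fun r' _ => Finset.sum_comm
  simp only [e1]
  rw [Finset.sum_comm]
  refine Finset.sum_congr rfl fun r' _ => ?_
  rw [Finset.sum_comm]
  refine Finset.sum_congr rfl fun s' _ => ?_
  rw [Finset.sum_comm]
  refine Finset.sum_congr rfl fun s _ => Finset.sum_congr rfl fun r _ => ?_
  congr 1; ring

theorem sandwich_add [Fintype k] [Fintype l] (a : Matrix m k ℂ) (x y : Matrix k l V)
    (b : Matrix l n ℂ) : sandwich a (x + y) b = sandwich a x b + sandwich a y b := by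
  ext i j
  simp [sandwich_apply, smul_add, Finset.sum_add_distrib]

theorem sandwich_smul [Fintype k] [Fintype l] (c : ℂ) (a : Matrix m k ℂ) (x : Matrix k l V)
    (b : Matrix l n ℂ) : sandwich a (c • x) b = c • sandwich a x b := by
  ext i j
  simp only [sandwich_apply, Matrix.smul_apply, Finset.smul_sum]
  exact Finset.sum_congr rfl fun r _ => Finset.sum_congr rfl fun s _ => smul_comm _ _ _

theorem sandwich_smul_left [Fintype k] [Fintype l] (c : ℂ) (a : Matrix m k ℂ) (x : Matrix k l V)
    (b : Matrix l n ℂ) : sandwich (c • a) x b = c • sandwich a x b := by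
  ext i j
  simp only [sandwich_apply, Matrix.smul_apply, Finset.smul_sum, smul_smul, smul_eq_mul, mul_assoc]

theorem sandwich_smul_right [Fintype k] [Fintype l] (c : ℂ) (a : Matrix m k ℂ) (x : Matrix k l V)
    (b : Matrix l n ℂ) : sandwich a x (c • b) = c • sandwich a x b := by
  ext i j
  simp only [sandwich_apply, Matrix.smul_apply, Finset.smul_sum, smul_smul, smul_eq_mul,
    mul_left_comm c]

theorem sandwich_one [Fintype k] [Fintype l] [DecidableEq k] [DecidableEq l] (x : Matrix k l V) :
    sandwich (1 : Matrix k k ℂ) x (1 : Matrix l l ℂ) = x := by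
  ext i j
  rw [sandwich_apply, Finset.sum_eq_single i, Finset.sum_eq_single j]
  · simp
  · intro s _ hs; simp [one_apply_ne hs]
  · simp
  · intro r _ hr; simp [one_apply_ne hr.symm]
  · simp

theorem sandwich_zero_mid [Fintype k] [Fintype l] (a : Matrix m k ℂ) (b : Matrix l n ℂ) :
    sandwich a (0 : Matrix k l V) b = 0 := by
  ext i j; simp [sandwich_apply]

theorem sandwich_fromBlocks [Fintype k] [Fintype l] (a₁ : Matrix m k ℂ) (a₂ : Matrix m l ℂ)
    (x : Matrix k k V) (y : Matrix l l V) (b₁ : Matrix k n ℂ) (b₂ : Matrix l n ℂ) :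
    sandwich (fromCols a₁ a₂) (fromBlocks x 0 0 y) (fromRows b₁ b₂) =
      sandwich a₁ x b₁ + sandwich a₂ y b₂ := by
  ext i j
  simp [sandwich_apply]

theorem sandwich_blocks [Fintype k] [Fintype l] (a : Matrix k k ℂ) (a' : Matrix l l ℂ)
    (x : Matrix k k V) (y : Matrix l l V) (b : Matrix k k ℂ) (b' : Matrix l l ℂ) :
    sandwich (fromBlocks a 0 0 a') (fromBlocks x 0 0 y) (fromBlocks b 0 0 b') =
      fromBlocks (sandwich a x b) 0 0 (sandwich a' y b') := by
  ext i j
  rcases i with i | i <;> rcases j with j | j <;> simp [sandwich_apply]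

theorem sandwich_submatrix {m' n' k' l' : Type*} [Fintype k] [Fintype l] [Fintype k'] [Fintype l']
    (a : Matrix m k ℂ) (x : Matrix k l V) (b : Matrix l n ℂ) (f : m' → m) (g : n' → n)
    (e : k' ≃ k) (e' : l' ≃ l) :
    (sandwich a x b).submatrix f g =
      sandwich (a.submatrix f e) (x.submatrix e e') (b.submatrix e' g) := by
  ext i j
  simp only [sandwich_apply, submatrix_apply]
  rw [← e.sum_comp]
  refine Finset.sum_congr rfl fun r _ => ?_
  rw [← e'.sum_comp]

end sandwichAlgebra

/-! ### Rectangular polar decomposition -/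

section polar

theorem mfun_sqrt_mul_self {H : Matrix ι ι ℂ} (hH : H.PosSemidef) :
    mfun H Real.sqrt * mfun H Real.sqrt = H := by
  rw [mfun_mul]
  conv_rhs => rw [← mfun_id hH.isHermitian]
  exact mfun_congr hH fun x hx => Real.mul_self_sqrt hx

/-- The (rectangular) polar decomposition. -/
theorem exists_polar (a : Matrix ι κ ℂ) :
    ∃ v : Matrix ι κ ℂ, a = mfun (a * aᴴ) Real.sqrt * v ∧ opNorm v ≤ 1 := by
  classical
  have hR := posSemidef_self_mul_conjTranspose a
  set H := a * aᴴ with hH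
  -- Since `0⁻¹ = 0`, `f` is a pseudo-inverse of the square root, and `p` is the indicator function
  -- of the positive spectrum.
  let f : ℝ → ℝ := fun x => (√x)⁻¹
  let p : ℝ → ℝ := fun x => √x * (√x)⁻¹
  have hp : mfun H Real.sqrt * mfun H f = mfun H p := mfun_mul _ _ _
  have hpp : mfun H p * H = H := by
    conv_lhs => enter [2]; rw [← mfun_id hR.isHermitian]
    conv_rhs => rw [← mfun_id hR.isHermitian]
    rw [mfun_mul]
    refine mfun_congr hR fun x hx => ?_
    rcases eq_or_lt_of_le hx with rfl | hx
    · simp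
    · have : √x ≠ 0 := (Real.sqrt_pos.2 hx).ne'
      simp [p, this]
  have hpsa : (mfun H p)ᴴ = mfun H p := mfun_isHermitian H p
  refine ⟨mfun H f * a, ?_, ?_⟩
  · rw [← Matrix.mul_assoc, hp]
    -- The support projection `mfun H p` of a a* fixes a: the difference is zero because its product
    -- with its adjoint is.
    have h0 : (a - mfun H p * a) * (a - mfun H p * a)ᴴ = 0 := by
      rw [conjTranspose_sub, conjTranspose_mul, hpsa, Matrix.sub_mul, Matrix.mul_sub,
        Matrix.mul_sub, ← hH, ← Matrix.mul_assoc a, ← hH, Matrix.mul_assoc (mfun H p) a aᴴ, ← hH,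
        Matrix.mul_assoc (mfun H p) a, ← Matrix.mul_assoc a aᴴ, ← hH, hpp,
        ← Matrix.mul_assoc, hpp]
      simp
    have := self_mul_conjTranspose_eq_zero.1 h0
    exact sub_eq_zero.1 this
  · rw [← opNorm_conjTranspose]
    refine opNorm_le_one_of_posSemidef ?_
    have hfsa : (mfun H f)ᴴ = mfun H f := mfun_isHermitian H f
    have e : (mfun H f * a)ᴴᴴ * (mfun H f * a)ᴴ = mfun H (fun x => f x * (x * f x)) := by
      rw [conjTranspose_conjTranspose, conjTranspose_mul, hfsa, Matrix.mul_assoc,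
        ← Matrix.mul_assoc a, ← hH]
      conv_lhs => enter [2, 1]; rw [← mfun_id hR.isHermitian]
      rw [mfun_mul, mfun_mul]
    rw [e, ← mfun_one hR.isHermitian]
    have e2 : mfun H (fun _ => 1) - mfun H (fun x => f x * (x * f x)) =
        mfun H (fun x => 1 - f x * (x * f x)) := by
      rw [(IsDecomp.of_eigen hR.isHermitian).mfun_eq, (IsDecomp.of_eigen hR.isHermitian).mfun_eq,
        (IsDecomp.of_eigen hR.isHermitian).mfun_eq, ← Matrix.sub_mul, ← Matrix.mul_sub,
        diagonal_sub]
      simp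
    rw [e2]
    refine mfun_posSemidef hR fun x hx => ?_
    rcases eq_or_lt_of_le hx with rfl | hx
    · simp
    · have : √x ≠ 0 := (Real.sqrt_pos.2 hx).ne'
      have : f x * (x * f x) = 1 := by
        simp only [f]
        field_simp
        rw [Real.sq_sqrt hx.le]
      rw [this]; simp

end polar

theorem opNorm_submatrix_le {ι' κ' : Type*} [Fintype ι'] [Fintype κ'] (a : Matrix ι κ ℂ)
    (e : ι' ≃ ι) (f : κ' ≃ κ) : opNorm (a.submatrix e f) ≤ opNorm a := by
  classical
  refine opNorm_le_of_posSemidef (opNorm_nonneg a) ?_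
  have := (posSemidef_opNorm_sq_sub a le_rfl).submatrix f
  have e2 : (a.submatrix e f)ᴴ * a.submatrix e f = (aᴴ * a).submatrix f f := by
    rw [conjTranspose_submatrix, submatrix_mul_equiv]
  rw [e2]
  convert this using 1
  ext i j
  simp [one_apply]

/-! ### Matrix norms of an operator space over arbitrary finite index sets -/

section matNorm

variable {E : Type*} [NormedAddCommGroup E] [NormedSpace ℂ E] [OperatorSpace E]

/-- Reindexing is a sandwich by permutation matrices, which are contractions, so Ruan's axiom
compares any two enumerations. -/
theorem matNorm_submatrix_le {m n : ℕ} (e : Fin n ≃ ι) (f : Fin m ≃ ι) (x : Matrix ι ι E) :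
    OperatorSpace.matNorm n (x.submatrix e e) ≤ OperatorSpace.matNorm m (x.submatrix f f) := by
  classical
  have h := OperatorSpace.matNorm_sandwich m n ((1 : Matrix ι ι ℂ).submatrix e f)
    (x.submatrix f f) ((1 : Matrix ι ι ℂ).submatrix f e)
  rw [← sandwich_submatrix, sandwich_one] at h
  refine h.trans ?_
  have h1 : opNorm ((1 : Matrix ι ι ℂ).submatrix e f) ≤ 1 :=
    (opNorm_submatrix_le _ _ _).trans opNorm_one_le
  have h2 : opNorm ((1 : Matrix ι ι ℂ).submatrix f e) ≤ 1 :=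
    (opNorm_submatrix_le _ _ _).trans opNorm_one_le
  calc _ ≤ 1 * OperatorSpace.matNorm m (x.submatrix f f) * 1 := by
        have hn : 0 ≤ OperatorSpace.matNorm m (x.submatrix f f) := apply_nonneg _ _
        have ho := opNorm_nonneg ((1 : Matrix ι ι ℂ).submatrix f e)
        gcongr
    _ = _ := by simp

theorem matNormOn_eq {n : ℕ} (e : Fin n ≃ ι) (x : Matrix ι ι E) :
    matNormOn x = OperatorSpace.matNorm n (x.submatrix e e) :=
  le_antisymm (matNorm_submatrix_le _ _ _) (matNorm_submatrix_le _ _ _)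

theorem matNormOn_nonneg (x : Matrix ι ι E) : 0 ≤ matNormOn x := apply_nonneg _ _

theorem matNormOn_smul (c : ℂ) (x : Matrix ι ι E) : matNormOn (c • x) = ‖c‖ * matNormOn x := by
  rw [matNormOn, matNormOn, ← map_smul_eq_mul]
  rfl

theorem eq_zero_of_matNormOn (x : Matrix ι ι E) (h : matNormOn x = 0) : x = 0 := by
  have := OperatorSpace.matNorm_eq_zero _ _ h
  rw [reindex_apply] at this
  ext i j
  have := congrFun (congrFun this (Fintype.equivFin ι i)) (Fintype.equivFin ι j)
  simpa using this

theorem matNormOn_sandwich_le (a : Matrix ι κ ℂ) (x : Matrix κ κ E) (b : Matrix κ ι ℂ) :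
    matNormOn (sandwich a x b) ≤ opNorm a * matNormOn x * opNorm b := by
  have h := OperatorSpace.matNorm_sandwich _ _
    (a.submatrix (Fintype.equivFin ι).symm (Fintype.equivFin κ).symm)
    (x.submatrix (Fintype.equivFin κ).symm (Fintype.equivFin κ).symm)
    (b.submatrix (Fintype.equivFin κ).symm (Fintype.equivFin ι).symm)
  rw [← sandwich_submatrix] at h
  refine h.trans ?_
  have h1 := opNorm_submatrix_le a (Fintype.equivFin ι).symm (Fintype.equivFin κ).symm
  have h2 := opNorm_submatrix_le b (Fintype.equivFin κ).symm (Fintype.equivFin ι).symm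
  have h3 : matNormOn x = OperatorSpace.matNorm (Fintype.card κ)
    (x.submatrix (Fintype.equivFin κ).symm (Fintype.equivFin κ).symm) := rfl
  rw [h3]
  have := opNorm_nonneg a
  have := opNorm_nonneg (b.submatrix (Fintype.equivFin κ).symm (Fintype.equivFin ι).symm)
  gcongr

theorem matNormOn_fromBlocks (x : Matrix ι ι E) (y : Matrix κ κ E) :
    matNormOn (fromBlocks x 0 0 y) = max (matNormOn x) (matNormOn y) := by
  have h := OperatorSpace.matNorm_directSum _ _
    (x.submatrix (Fintype.equivFin ι).symm (Fintype.equivFin ι).symm)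
    (y.submatrix (Fintype.equivFin κ).symm (Fintype.equivFin κ).symm)
  have e := matNormOn_eq (finSumFinEquiv.symm.trans
    (Equiv.sumCongr (Fintype.equivFin ι).symm (Fintype.equivFin κ).symm)) (fromBlocks x 0 0 y)
  rw [e]
  refine Eq.trans ?_ h
  congr 1
  ext i j
  simp only [directSum, reindex_apply, submatrix_apply, Equiv.trans_apply]
  rcases finSumFinEquiv.symm i with i | i <;> rcases finSumFinEquiv.symm j with j | j <;> simp

end matNorm

/-! ### The E-valued Schatten norm -/

section vsn

variable {E : Type*} [NormedAddCommGroup E] [NormedSpace ℂ E] [OperatorSpace E]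

theorem vsn_bddBelow {q : ℝ≥0∞} (h1 : 1 ≤ q) (x : Matrix ι ι E) :
    0 ∈ lowerBounds {t : ℝ | ∃ (a : Matrix ι ι ℂ) (y : Matrix ι ι E) (b : Matrix ι ι ℂ),
      x = sandwich a y b ∧ t = schattenNorm (2 * q) a * matNormOn y * schattenNorm (2 * q) b} := by
  rintro t ⟨a, y, b, -, rfl⟩
  rw [schattenNorm_two_mul h1, schattenNorm_two_mul h1]
  have := matNormOn_nonneg y
  positivity

theorem vsn_nonneg {q : ℝ≥0∞} (h1 : 1 ≤ q) (x : Matrix ι ι E) : 0 ≤ vectorSchattenNorm q x :=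
  Real.sInf_nonneg fun _ ht => vsn_bddBelow h1 x ht

/-- Every rectangular factorization bounds the vector-valued Schatten norm. -/
theorem vsn_sandwich_le {q : ℝ≥0∞} (h1 : 1 ≤ q) (a : Matrix ι κ ℂ) (y : Matrix κ κ E)
    (b : Matrix κ ι ℂ) : vectorSchattenNorm q (sandwich a y b) ≤
      √(rs q (a * aᴴ)) * matNormOn y * √(rs q (bᴴ * b)) := by
  obtain ⟨v, hv, hv1⟩ := exists_polar a
  obtain ⟨w, hw, hw1⟩ := exists_polar bᴴ
  rw [conjTranspose_conjTranspose] at hw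
  have hA := posSemidef_self_mul_conjTranspose a
  have hB := posSemidef_conjTranspose_mul_self b
  have hw' : b = wᴴ * mfun (bᴴ * b) Real.sqrt := by
    have := congrArg conjTranspose hw
    rwa [conjTranspose_conjTranspose, conjTranspose_mul, mfun_isHermitian] at this
  -- The contractions in the polar decompositions of a and b* are moved onto y. The outer factors
  -- that remain are square, as the definition requires.
  have e : sandwich a y b = sandwich (mfun (a * aᴴ) Real.sqrt) (sandwich v y wᴴ)
      (mfun (bᴴ * b) Real.sqrt) := by
    rw [sandwich_sandwich, ← hv, ← hw']
  refine (csInf_le ⟨0, vsn_bddBelow h1 _⟩ ⟨_, _, _, e, rfl⟩).trans ?_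
  rw [schattenNorm_two_mul' h1, schattenNorm_two_mul h1, mfun_isHermitian, mfun_isHermitian,
    mfun_sqrt_mul_self hA, mfun_sqrt_mul_self hB]
  have h2 := matNormOn_sandwich_le v y wᴴ
  rw [opNorm_conjTranspose] at h2
  have h3 : matNormOn (sandwich v y wᴴ) ≤ matNormOn y := by
    refine h2.trans ?_
    have := matNormOn_nonneg y
    have := opNorm_nonneg w
    calc opNorm v * matNormOn y * opNorm w ≤ 1 * matNormOn y * 1 := by gcongr
      _ = _ := by simp
  gcongr

/-- Scalars can be moved between the three factors, so a nearly optimal product is balanced: norm at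
most 1 in the middle and the same bound t for both weights. In this form the conditions on a and b
are separate and survive block constructions. -/
theorem exists_factorization {q : ℝ≥0∞} (h1 : 1 ≤ q) {x : Matrix ι ι E} {t : ℝ}
    (ht : vectorSchattenNorm q x < t) :
    ∃ (a : Matrix ι ι ℂ) (y : Matrix ι ι E) (b : Matrix ι ι ℂ), x = sandwich a y b ∧
      matNormOn y ≤ 1 ∧ rs q (a * aᴴ) ≤ t ∧ rs q (bᴴ * b) ≤ t := by
  classical
  have ht0 : 0 < t := (vsn_nonneg h1 x).trans_lt ht
  rw [vectorSchattenNorm] at ht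
  obtain ⟨_, ⟨a, y, b, hx, rfl⟩, hlt⟩ := exists_lt_of_csInf_lt
    (by exact ⟨_, 1, x, 1, (sandwich_one x).symm, rfl⟩) ht
  rw [schattenNorm_two_mul' h1, schattenNorm_two_mul h1] at hlt
  have hα0 := rs_nonneg h1 (a * aᴴ)
  have hβ0 := rs_nonneg h1 (bᴴ * b)
  have hA := posSemidef_self_mul_conjTranspose a
  have hB := posSemidef_conjTranspose_mul_self b
  set α := rs q (a * aᴴ)
  set β := rs q (bᴴ * b)
  rcases eq_or_lt_of_le (matNormOn_nonneg y) with hm | hm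
  · refine ⟨0, 0, 0, ?_, ?_, ?_, ?_⟩
    · rw [hx, eq_zero_of_matNormOn y hm.symm, sandwich_zero_mid, sandwich_zero_mid]
    · have := matNormOn_smul (0 : ℂ) (0 : Matrix ι ι E)
      rw [smul_zero] at this; rw [this]; simp
    · simp [rs_zero h1, ht0.le]
    · simp [rs_zero h1, ht0.le]
  · set m := matNormOn y
    -- The factor a will be multiplied by √C and b by m/√C. With C = t/α the first weight becomes
    -- exactly t and the product bound gives the second; if α = 0 any C meets the first condition,
    -- and it is taken large enough for the second.
    obtain ⟨C, hC, hC1, hC2⟩ : ∃ C : ℝ, 0 < C ∧ C * α ≤ t ∧ m ^ 2 * β ≤ t * C := by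
      rcases eq_or_lt_of_le hα0 with h | h
      · refine ⟨(m ^ 2 * β + 1) / t, by positivity, by rw [← h]; simp [ht0.le], ?_⟩
        rw [mul_div_cancel₀ _ ht0.ne']; linarith
      · refine ⟨t / α, by positivity, by rw [div_mul_cancel₀ _ h.ne'], ?_⟩
        rw [mul_div_assoc', le_div_iff₀ h]
        have h2 : (√α * m * √β) ^ 2 ≤ t ^ 2 := by gcongr
        rw [mul_pow, mul_pow, Real.sq_sqrt hα0, Real.sq_sqrt hβ0] at h2
        linarith
    have hc : 0 < √C := Real.sqrt_pos.2 hC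
    refine ⟨((√C : ℝ) : ℂ) • a, ((m⁻¹ : ℝ) : ℂ) • y, ((m / √C : ℝ) : ℂ) • b, ?_, ?_, ?_, ?_⟩
    · rw [sandwich_smul_left, sandwich_smul_right, sandwich_smul, smul_smul, smul_smul, hx,
        mul_assoc]
      have : ((√C : ℝ) : ℂ) * (((m / √C : ℝ) : ℂ) * ((m⁻¹ : ℝ) : ℂ)) = 1 := by
        rw [← Complex.ofReal_mul, ← Complex.ofReal_mul, ← Complex.ofReal_one]
        congr 1; field_simp
      rw [this, one_smul]
    · rw [matNormOn_smul, Complex.norm_real, Real.norm_of_nonneg (by positivity)]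
      exact (inv_mul_cancel₀ hm.ne').le
    · have : (((√C : ℝ) : ℂ) • a) * (((√C : ℝ) : ℂ) • a)ᴴ = (C : ℂ) • (a * aᴴ) := by
        rw [conjTranspose_smul, Matrix.smul_mul, Matrix.mul_smul, smul_smul]
        congr 1
        rw [RCLike.star_def, Complex.conj_ofReal, ← Complex.ofReal_mul, Real.mul_self_sqrt hC.le]
      rw [this, rs_smul h1 hA hC.le]; exact hC1
    · have : (((m / √C : ℝ) : ℂ) • b)ᴴ * (((m / √C : ℝ) : ℂ) • b) =
          ((m ^ 2 / C : ℝ) : ℂ) • (bᴴ * b) := by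
        rw [conjTranspose_smul, Matrix.smul_mul, Matrix.mul_smul, smul_smul]
        congr 1
        rw [RCLike.star_def, Complex.conj_ofReal, ← Complex.ofReal_mul, div_mul_div_comm,
          Real.mul_self_sqrt hC.le, sq]
      rw [this, rs_smul h1 hB (by positivity), div_mul_eq_mul_div, div_le_iff₀ hC]; exact hC2

theorem vsn_le_of_factorization {q : ℝ≥0∞} (h1 : 1 ≤ q) {t : ℝ} (ht : 0 ≤ t) {a : Matrix ι κ ℂ}
    {y : Matrix κ κ E} {b : Matrix κ ι ℂ} (hy : matNormOn y ≤ 1) (ha : rs q (a * aᴴ) ≤ t)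
    (hb : rs q (bᴴ * b) ≤ t) : vectorSchattenNorm q (sandwich a y b) ≤ t := by
  refine (vsn_sandwich_le h1 a y b).trans ?_
  calc _ ≤ √t * 1 * √t := by
        have := matNormOn_nonneg y
        gcongr
    _ = t := by rw [mul_one, Real.mul_self_sqrt ht]

theorem fromCols_mul_conjTranspose (a : Matrix ν ι ℂ) (b : Matrix ν κ ℂ) :
    fromCols a b * (fromCols a b)ᴴ = a * aᴴ + b * bᴴ := by
  rw [conjTranspose_fromCols_eq_fromRows_conjTranspose, fromCols_mul_fromRows]

theorem conjTranspose_mul_fromRows (a : Matrix ι ν ℂ) (b : Matrix κ ν ℂ) :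
    (fromRows a b)ᴴ * fromRows a b = aᴴ * a + bᴴ * b := by
  rw [conjTranspose_fromRows_eq_fromCols_conjTranspose, fromCols_mul_fromRows]

/-- Balanced factorizations of x and y combine into row · block diagonal · column. By Ruan's axiom
the middle keeps norm at most 1, while a a* and b* b are added, where `rs_add_le` applies. -/
theorem vsn_add_le {q : ℝ≥0∞} (h1 : 1 ≤ q) (x y : Matrix ι ι E) :
    vectorSchattenNorm q (x + y) ≤ vectorSchattenNorm q x + vectorSchattenNorm q y := by
  refine le_of_forall_pos_lt_add fun ε hε => ?_
  obtain ⟨a, z, b, hx, hz, ha, hb⟩ := exists_factorization h1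
    (show vectorSchattenNorm q x < vectorSchattenNorm q x + ε / 3 by linarith)
  obtain ⟨a', z', b', hx', hz', ha', hb'⟩ := exists_factorization h1
    (show vectorSchattenNorm q y < vectorSchattenNorm q y + ε / 3 by linarith)
  have e : x + y = sandwich (fromCols a a') (fromBlocks z 0 0 z') (fromRows b b') := by
    rw [sandwich_fromBlocks, ← hx, ← hx']
  have hx0 := vsn_nonneg h1 x
  have hy0 := vsn_nonneg h1 y
  have := vsn_le_of_factorization h1
    (t := (vectorSchattenNorm q x + ε / 3) + (vectorSchattenNorm q y + ε / 3)) (by positivity)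
    (a := fromCols a a') (y := fromBlocks z 0 0 z') (b := fromRows b b')
    (by rw [matNormOn_fromBlocks]; exact max_le hz hz')
    (by
      rw [fromCols_mul_conjTranspose]
      exact (rs_add_le h1 (posSemidef_self_mul_conjTranspose _)
        (posSemidef_self_mul_conjTranspose _)).trans (add_le_add ha ha'))
    (by
      rw [conjTranspose_mul_fromRows]
      exact (rs_add_le h1 (posSemidef_conjTranspose_mul_self _)
        (posSemidef_conjTranspose_mul_self _)).trans (add_le_add hb hb'))
  rw [e]
  linarith

theorem vsn_zero {q : ℝ≥0∞} (h1 : 1 ≤ q) : vectorSchattenNorm q (0 : Matrix ι ι E) = 0 := by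
  refine le_antisymm ?_ (vsn_nonneg h1 _)
  have := vsn_sandwich_le h1 (0 : Matrix ι ι ℂ) (0 : Matrix ι ι E) (0 : Matrix ι ι ℂ)
  rw [sandwich_zero_mid] at this
  simpa [rs_zero h1] using this

theorem vsn_contraction_le {q : ℝ≥0∞} (h1 : 1 ≤ q) {c : Matrix κ ι ℂ} {d : Matrix ι κ ℂ}
    (hc : opNorm c ≤ 1) (hd : opNorm d ≤ 1) (x : Matrix ι ι E) :
    vectorSchattenNorm q (sandwich c x d) ≤ vectorSchattenNorm q x := by
  refine le_of_forall_pos_le_add fun ε hε => ?_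
  obtain ⟨a, z, b, hx, hz, ha, hb⟩ := exists_factorization h1
    (show vectorSchattenNorm q x < vectorSchattenNorm q x + ε by linarith)
  have hx0 := vsn_nonneg h1 x
  have := vsn_le_of_factorization h1 (t := vectorSchattenNorm q x + ε) (by positivity)
    (a := c * a) (y := z) (b := b * d) hz
    (by
      have := rs_conj_le h1 (posSemidef_self_mul_conjTranspose a) hc
      rw [conjTranspose_mul]
      simp only [Matrix.mul_assoc] at this ⊢
      exact this.trans ha)
    (by
      have := rs_conj_le h1 (posSemidef_conjTranspose_mul_self b) (C := dᴴ)
        (by rwa [opNorm_conjTranspose])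
      rw [conjTranspose_mul]
      simp only [Matrix.mul_assoc, conjTranspose_conjTranspose] at this ⊢
      exact this.trans hb)
  rw [← sandwich_sandwich, ← hx] at this
  exact this

theorem vsn_smul_le {q : ℝ≥0∞} (h1 : 1 ≤ q) (c : ℂ) (x : Matrix ι ι E) :
    vectorSchattenNorm q (c • x) ≤ ‖c‖ * vectorSchattenNorm q x := by
  refine le_of_forall_pos_le_add fun ε hε => ?_
  have hpos : 0 < ‖c‖ + 1 := by positivity
  obtain ⟨a, z, b, hx, hz, ha, hb⟩ := exists_factorization h1
    (show vectorSchattenNorm q x < vectorSchattenNorm q x + ε / (‖c‖ + 1) by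
      have : 0 < ε / (‖c‖ + 1) := by positivity
      linarith)
  have h2 := vsn_sandwich_le h1 a (c • z) b
  rw [sandwich_smul, ← hx, matNormOn_smul] at h2
  refine h2.trans ?_
  set t := vectorSchattenNorm q x + ε / (‖c‖ + 1) with ht
  have hx0 := vsn_nonneg h1 x
  have ht0 : 0 ≤ t := by positivity
  calc _ ≤ √t * (‖c‖ * 1) * √t := by
        have := matNormOn_nonneg z
        gcongr
    _ = ‖c‖ * t := by rw [mul_right_comm, Real.mul_self_sqrt ht0]; ring
    _ ≤ _ := by
      rw [ht, mul_add]
      gcongr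
      rw [mul_div_assoc', div_le_iff₀ hpos]
      nlinarith [norm_nonneg c]

/-- The norm of `S_ι^q(E)` as a seminorm. -/
def vsnSeminorm (q : ℝ≥0∞) (h1 : 1 ≤ q) : Seminorm ℂ (Matrix ι ι E) :=
  Seminorm.ofSMulLE (vectorSchattenNorm q) (vsn_zero h1) (vsn_add_le h1) (vsn_smul_le h1)

theorem vsn_smul {q : ℝ≥0∞} (h1 : 1 ≤ q) (c : ℂ) (x : Matrix ι ι E) :
    vectorSchattenNorm q (c • x) = ‖c‖ * vectorSchattenNorm q x :=
  map_smul_eq_mul (vsnSeminorm q h1) c x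

theorem vsn_unitary {q : ℝ≥0∞} (h1 : 1 ≤ q) [DecidableEq ι] {u v : Matrix ι ι ℂ} (hu : uᴴ * u = 1)
    (hv : v * vᴴ = 1) (x : Matrix ι ι E) :
    vectorSchattenNorm q (sandwich u x v) = vectorSchattenNorm q x := by
  have hu' : opNorm u ≤ 1 := opNorm_le_one_of_isometry hu
  have hv' : opNorm v ≤ 1 := opNorm_le_one_of_isometry (mul_eq_one_comm.1 hv)
  refine le_antisymm (vsn_contraction_le h1 hu' hv' x) ?_
  have := vsn_contraction_le h1 (c := uᴴ) (d := vᴴ) (by rwa [opNorm_conjTranspose])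
    (by rwa [opNorm_conjTranspose]) (sandwich u x v)
  rwa [sandwich_sandwich, hu, hv, sandwich_one] at this

theorem posSemidef_rs_sub {q : ℝ≥0∞} (h1 : 1 ≤ q) [DecidableEq ι] {H : Matrix ι ι ℂ}
    (hH : H.PosSemidef) : ((rs q H : ℂ) • (1 : Matrix ι ι ℂ) - H).PosSemidef := by
  have d := IsDecomp.of_eigen hH.isHermitian
  have hl := d.nonneg hH
  have e : (rs q H : ℂ) • (1 : Matrix ι ι ℂ) - H = mfun H (fun x => rs q H - x) := by
    rw [d.mfun_eq]
    have h2 : diagonal (fun i => ((rs q H - hH.isHermitian.eigenvalues i : ℝ) : ℂ)) =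
        (rs q H : ℂ) • (1 : Matrix ι ι ℂ) - diagonal fun i =>
          (hH.isHermitian.eigenvalues i : ℂ) := by
      ext i j
      by_cases hij : i = j
      · subst hij; simp
      · simp [hij]
    rw [h2, Matrix.mul_sub, Matrix.sub_mul, ← d.eq, Matrix.mul_smul, Matrix.smul_mul,
      Matrix.mul_one, d.right]
  rw [e]
  refine (d.mfun _).posSemidef fun i => ?_
  rw [d.rs_eq h1 hl, sub_nonneg]
  by_cases ht : q = ∞
  · subst ht
    rw [lqn_top]
    exact (le_abs_self _).trans (le_ciSup (f := fun i => |hH.isHermitian.eigenvalues i|)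
      (Set.finite_range _).bddAbove i)
  · rw [lqn_of_ne_top h1 ht]
    have hr := one_le_toReal h1 ht
    calc _ = (|hH.isHermitian.eigenvalues i| ^ q.toReal) ^ (1 / q.toReal) := by
          rw [← Real.rpow_mul (abs_nonneg _), mul_one_div_cancel (by positivity), Real.rpow_one,
            abs_of_nonneg (hl i)]
      _ ≤ _ := by
        refine Real.rpow_le_rpow (by positivity) ?_ (by positivity)
        exact Finset.single_le_sum (f := fun i => |hH.isHermitian.eigenvalues i| ^ q.toReal)
          (fun i _ => by positivity) (Finset.mem_univ i)

theorem opNorm_le_sqrt_rs {q : ℝ≥0∞} (h1 : 1 ≤ q) (a : Matrix κ ι ℂ) :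
    opNorm a ≤ √(rs q (aᴴ * a)) := by
  classical
  refine opNorm_le_of_posSemidef (Real.sqrt_nonneg _) ?_
  rw [Real.sq_sqrt (rs_nonneg h1 _)]
  exact posSemidef_rs_sub h1 (posSemidef_conjTranspose_mul_self a)

theorem opNorm_le_sqrt_rs' {q : ℝ≥0∞} (h1 : 1 ≤ q) (a : Matrix κ ι ℂ) :
    opNorm a ≤ √(rs q (a * aᴴ)) := by
  have := opNorm_le_sqrt_rs h1 aᴴ
  rwa [opNorm_conjTranspose, conjTranspose_conjTranspose] at this

theorem opNorm_le_schattenNorm {q : ℝ≥0∞} (h1 : 1 ≤ q) (a : Matrix ι ι ℂ) :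
    opNorm a ≤ schattenNorm (2 * q) a := by
  rw [schattenNorm_two_mul h1]; exact opNorm_le_sqrt_rs h1 a

theorem rs_top_le_of_opNorm {H : Matrix ι ι ℂ} (hH : H.PosSemidef) {c : ℝ} (hc : 0 ≤ c)
    [DecidableEq ι] (h : ((c : ℂ) • (1 : Matrix ι ι ℂ) - H).PosSemidef) : rs ∞ H ≤ c := by
  have d : IsDecomp (1 : Matrix ι ι ℂ) 1 (fun _ => 1) := ⟨by simp, by simp, by simp⟩
  refine (rs_mono le_top hH h).trans ?_
  rw [(d.smul c).rs_eq le_top (fun i => by simpa using hc), lqn_top]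
  refine Real.iSup_le (fun i => ?_) hc
  simp [abs_of_nonneg hc]

theorem vsn_top (x : Matrix ι ι E) : vectorSchattenNorm ∞ x = matNormOn x := by
  classical
  refine le_antisymm ?_ ?_
  · have h := vsn_sandwich_le le_top (1 : Matrix ι ι ℂ) x (1 : Matrix ι ι ℂ)
    have h1 : rs ∞ (1 : Matrix ι ι ℂ) ≤ 1 :=
      rs_top_le_of_opNorm PosSemidef.one zero_le_one (by simpa using PosSemidef.zero)
    rw [sandwich_one, conjTranspose_one, Matrix.mul_one] at h
    refine h.trans ?_
    have h2 : √(rs ∞ (1 : Matrix ι ι ℂ)) ≤ 1 := Real.sqrt_le_one.2 h1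
    have := matNormOn_nonneg x
    calc _ ≤ 1 * matNormOn x * 1 := by gcongr
      _ = _ := by simp
  · refine le_of_forall_pos_le_add fun ε hε => ?_
    obtain ⟨a, z, b, hx, hz, ha, hb⟩ := exists_factorization le_top
      (show vectorSchattenNorm ∞ x < vectorSchattenNorm ∞ x + ε by linarith)
    have h0 : 0 ≤ vectorSchattenNorm ∞ x + ε := (vsn_nonneg le_top x).trans (by linarith)
    rw [hx]
    have ha' : opNorm a ≤ √(vectorSchattenNorm ∞ x + ε) :=
      (opNorm_le_sqrt_rs' le_top a).trans (Real.sqrt_le_sqrt ha)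
    have hb' : opNorm b ≤ √(vectorSchattenNorm ∞ x + ε) :=
      (opNorm_le_sqrt_rs le_top b).trans (Real.sqrt_le_sqrt hb)
    refine (matNormOn_sandwich_le a z b).trans ?_
    rw [← hx]
    calc _ ≤ √(vectorSchattenNorm ∞ x + ε) * 1 * √(vectorSchattenNorm ∞ x + ε) := by
          have := matNormOn_nonneg z
          have := opNorm_nonneg b
          gcongr
      _ = _ := by rw [mul_one, Real.mul_self_sqrt h0]

/-- Block-diagonal factorizations: for the weights, q-th powers of q-norms are traces and therefore
add over the blocks. -/
theorem vsn_fromBlocks_rpow_le {q : ℝ≥0∞} (h1 : 1 ≤ q) (ht : q ≠ ∞) (x : Matrix ι ι E)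
    (y : Matrix κ κ E) : vectorSchattenNorm q (fromBlocks x 0 0 y) ^ q.toReal ≤
      vectorSchattenNorm q x ^ q.toReal + vectorSchattenNorm q y ^ q.toReal := by
  have hr := one_le_toReal h1 ht
  have hr0 : 0 < q.toReal := by positivity
  have hx0 := vsn_nonneg h1 x
  have hy0 := vsn_nonneg h1 y
  have key : ∀ ε > 0, vectorSchattenNorm q (fromBlocks x 0 0 y) ^ q.toReal ≤
      (vectorSchattenNorm q x + ε) ^ q.toReal + (vectorSchattenNorm q y + ε) ^ q.toReal := by
    intro ε hε
    obtain ⟨a, z, b, hx, hz, ha, hb⟩ := exists_factorization h1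
      (show vectorSchattenNorm q x < vectorSchattenNorm q x + ε by linarith)
    obtain ⟨a', z', b', hx', hz', ha', hb'⟩ := exists_factorization h1
      (show vectorSchattenNorm q y < vectorSchattenNorm q y + ε by linarith)
    set t := vectorSchattenNorm q x + ε
    set t' := vectorSchattenNorm q y + ε
    have hT : 0 ≤ t ^ q.toReal + t' ^ q.toReal := by positivity
    have hrs : ∀ {H : Matrix ι ι ℂ} {H' : Matrix κ κ ℂ}, H.PosSemidef → H'.PosSemidef →
        rs q H ≤ t → rs q H' ≤ t' →
        rs q (fromBlocks H 0 0 H') ≤ (t ^ q.toReal + t' ^ q.toReal) ^ (1 / q.toReal) := by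
      intro H H' hH hH' h h'
      classical
      have d := IsDecomp.of_eigen hH.isHermitian
      have d' := IsDecomp.of_eigen hH'.isHermitian
      have hps : (fromBlocks H 0 0 H').PosSemidef := (d.fromBlocks d').posSemidef (by
        rintro (i | i)
        · exact d.nonneg hH i
        · exact d'.nonneg hH' i)
      have htr : ∀ (A : Matrix ι ι ℂ) (D : Matrix κ κ ℂ),
          (fromBlocks A 0 0 D).trace = A.trace + D.trace := fun A D => by
        simp [trace, Fintype.sum_sum_type]
      have e : rs q (fromBlocks H 0 0 H') ^ q.toReal = rs q H ^ q.toReal + rs q H' ^ q.toReal := by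
        rw [rs_rpow h1 ht hps, rs_rpow h1 ht hH, rs_rpow h1 ht hH', mfun_fromBlocks hH.isHermitian
          hH'.isHermitian, htr, Complex.add_re]
      rw [one_div, Real.le_rpow_inv_iff_of_pos (rs_nonneg h1 _) hT hr0, e]
      have := rs_nonneg h1 H
      have := rs_nonneg h1 H'
      gcongr
    rw [hx, hx', ← sandwich_blocks]
    have h2 := vsn_le_of_factorization h1 (t := (t ^ q.toReal + t' ^ q.toReal) ^ (1 / q.toReal))
      (by positivity) (a := fromBlocks a 0 0 a') (y := fromBlocks z 0 0 z')
      (b := fromBlocks b 0 0 b') (by rw [matNormOn_fromBlocks]; exact max_le hz hz')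
      (by
        rw [fromBlocks_conjTranspose, fromBlocks_multiply]
        simpa using hrs (posSemidef_self_mul_conjTranspose a)
          (posSemidef_self_mul_conjTranspose a') ha ha')
      (by
        rw [fromBlocks_conjTranspose, fromBlocks_multiply]
        simpa using hrs (posSemidef_conjTranspose_mul_self b)
          (posSemidef_conjTranspose_mul_self b') hb hb')
    calc _ ≤ ((t ^ q.toReal + t' ^ q.toReal) ^ (1 / q.toReal)) ^ q.toReal :=
          Real.rpow_le_rpow (vsn_nonneg h1 _) h2 hr0.le
      _ = _ := by rw [← Real.rpow_mul hT, one_div_mul_cancel hr0.ne', Real.rpow_one]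
  have hlim : Filter.Tendsto (fun ε : ℝ => (vectorSchattenNorm q x + ε) ^ q.toReal +
      (vectorSchattenNorm q y + ε) ^ q.toReal) (nhdsWithin 0 (Set.Ioi 0))
      (nhds ((vectorSchattenNorm q x + 0) ^ q.toReal + (vectorSchattenNorm q y + 0) ^ q.toReal)) := by
    refine Filter.Tendsto.mono_left ?_ nhdsWithin_le_nhds
    have : Continuous fun ε : ℝ => (vectorSchattenNorm q x + ε) ^ q.toReal +
      (vectorSchattenNorm q y + ε) ^ q.toReal := by
      have h3 : Continuous fun t : ℝ => t ^ q.toReal := Real.continuous_rpow_const hr0.le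
      exact (h3.comp (continuous_const.add continuous_id)).add
        (h3.comp (continuous_const.add continuous_id))
    exact this.tendsto 0
  rw [add_zero, add_zero] at hlim
  exact ge_of_tendsto hlim (Filter.eventually_of_mem self_mem_nhdsWithin key)

end vsn

end

section

variable {ι κ ν : Type*} [Fintype ι] [Fintype κ] [Fintype ν]

/-! ### Amplifications by an identity -/

section amp

variable [DecidableEq κ]

/-- The amplification `a ⊗ 1`. -/
def amp (κ : Type*) [DecidableEq κ] {m n : Type*} (a : Matrix m n ℂ) : Matrix (m × κ) (n × κ) ℂ :=
  kroneckerMap (· * ·) a (1 : Matrix κ κ ℂ)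

theorem amp_mul {m n : Type*} (a : Matrix m ι ℂ) (b : Matrix ι n ℂ) :
    amp κ (a * b) = amp κ a * amp κ b := by
  rw [amp, amp, amp, ← mul_kronecker_mul, Matrix.one_mul]

theorem amp_add {m n : Type*} (a b : Matrix m n ℂ) : amp κ (a + b) = amp κ a + amp κ b :=
  add_kronecker _ _ _

theorem amp_sub {m n : Type*} (a b : Matrix m n ℂ) : amp κ (a - b) = amp κ a - amp κ b := by
  rw [eq_sub_iff_add_eq, ← amp_add, sub_add_cancel]

theorem amp_one [DecidableEq ν] : amp κ (1 : Matrix ν ν ℂ) = 1 := one_kronecker_one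

theorem amp_conjTranspose {m n : Type*} (a : Matrix m n ℂ) : (amp κ a)ᴴ = amp κ aᴴ := by
  rw [amp, amp, conjTranspose_kronecker, conjTranspose_one]

theorem amp_posSemidef {a : Matrix ι ι ℂ} (h : a.PosSemidef) : (amp κ a).PosSemidef :=
  h.kronecker PosSemidef.one

theorem amp_mfun {H : Matrix ι ι ℂ} (h : H.IsHermitian) (f : ℝ → ℝ) :
    mfun (amp κ H) f = amp κ (mfun H f) :=
  mfun_kronecker_one h f

theorem amp_opNorm_le_one {a : Matrix ν ι ℂ} (h : opNorm a ≤ 1) : opNorm (amp κ a) ≤ 1 := by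
  classical
  refine opNorm_le_one_of_posSemidef ?_
  have := amp_posSemidef (κ := κ) (posSemidef_one_sub_of_opNorm_le_one h)
  rwa [amp_sub, amp_mul, amp_one, ← amp_conjTranspose] at this

end amp

/-! ### Superadditivity of E-valued Schatten norms under weights -/

section superadditive

theorem mfun_sub {H : Matrix ι ι ℂ} (f g : ℝ → ℝ) :
    mfun H f - mfun H g = mfun H (fun x => f x - g x) := by
  classical
  by_cases hH : H.IsHermitian
  · have d := IsDecomp.of_eigen hH
    rw [d.mfun_eq, d.mfun_eq, d.mfun_eq, ← Matrix.sub_mul, ← Matrix.mul_sub, diagonal_sub]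
    simp
  · simp [mfun, dif_neg hH]

theorem rs_rpow_self_mul {q : ℝ≥0∞} (h1 : 1 ≤ q) (ht : q ≠ ∞) (a : Matrix ι κ ℂ) :
    rs q (a * aᴴ) ^ q.toReal = (mfun (aᴴ * a) (fun t => t ^ q.toReal)).trace.re := by
  rw [rs_rpow h1 ht (posSemidef_self_mul_conjTranspose a),
    trace_mfun_conjTranspose_mul _ (one_le_toReal h1 ht)]

theorem mfun_rpow_half_sq {Y : Matrix ι ι ℂ} (hY : Y.PosSemidef) (s : ℝ) (hs : s ≠ 0) :
    mfun Y (fun t => t ^ (s / 2)) * mfun Y (fun t => t ^ (s / 2)) = mfun Y (fun t => t ^ s) := by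
  rw [mfun_mul]
  refine mfun_congr hY fun x hx => ?_
  rcases eq_or_lt_of_le hx with rfl | hx
  · rw [Real.zero_rpow hs, Real.zero_rpow (by positivity), mul_zero]
  · rw [← Real.rpow_add hx]; congr 1; ring

/-- The column form of superadditivity: normalizing by the total weight does not increase
the sum of the `q`-th powers of the norms in `S^{2 q}`. -/
theorem sum_rs_normalized_le {α : Type*} [Fintype α] {q : ℝ≥0∞} (h1 : 1 ≤ q) (ht : q ≠ ∞)
    {Y : α → Matrix ι ι ℂ} (hY : ∀ k, (Y k).PosSemidef) (c : Matrix ι κ ℂ) :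
    ∑ k, rs q ((mfun (Y k) (fun t => t ^ (1 / q.toReal / 2)) *
        mfun (∑ k, Y k) (fun t => t ^ (-(1 / q.toReal / 2))) * c) *
      (mfun (Y k) (fun t => t ^ (1 / q.toReal / 2)) *
        mfun (∑ k, Y k) (fun t => t ^ (-(1 / q.toReal / 2))) * c)ᴴ) ^ q.toReal ≤
      rs q (c * cᴴ) ^ q.toReal := by
  classical
  set r := q.toReal
  have hr : 1 ≤ r := one_le_toReal h1 ht
  have hs : 1 / r ≠ 0 := by positivity
  set Z := ∑ k, Y k
  have hZ : Z.PosSemidef := posSemidef_sum _ fun k _ => hY k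
  -- Because `0 ^ s = 0` for `s ≠ 0`, this negative power is inverse to the positive one on the
  -- support of Z and vanishes on its kernel.
  set N := mfun Z (fun t => t ^ (-(1 / r / 2))) with hN
  have hNh : Nᴴ = N := mfun_isHermitian _ _
  have e1 : ∀ k, (mfun (Y k) (fun t => t ^ (1 / r / 2)) * N * c)ᴴ *
      (mfun (Y k) (fun t => t ^ (1 / r / 2)) * N * c) =
      (N * c)ᴴ * mfun (Y k) (fun t => t ^ (1 / r)) * (N * c) := by
    intro k
    rw [← mfun_rpow_half_sq (hY k) _ hs, conjTranspose_mul, conjTranspose_mul, conjTranspose_mul,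
      mfun_isHermitian (Y k)]
    simp only [Matrix.mul_assoc]
  -- Passing from a a* to a* a puts each term in Epstein's form with m = N c, so the sum is at most
  -- the same expression for Z. There N Z^{1/r} N is at most 1, which leaves a matrix below c* c.
  refine (Finset.sum_le_sum fun k _ => ?_).trans ((epstein_superadditive hr hY (N * c)).trans ?_)
  · exact (rs_rpow_self_mul h1 ht _).le.trans (by rw [e1 k])
  have hp : ((N * c)ᴴ * mfun Z (fun t => t ^ (1 / r)) * (N * c)).PosSemidef :=
    (mfun_posSemidef hZ fun x hx => Real.rpow_nonneg hx _).conjTranspose_mul_mul_same _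
  have hc := posSemidef_conjTranspose_mul_self c
  rw [← rs_rpow h1 ht hp, rs_rpow_self_mul h1 ht c, ← rs_rpow h1 ht hc]
  refine Real.rpow_le_rpow (rs_nonneg h1 _) (rs_mono h1 hp ?_) (by positivity)
  have e2 : cᴴ * c - (N * c)ᴴ * mfun Z (fun t => t ^ (1 / r)) * (N * c) =
      cᴴ * mfun Z (fun x => 1 - x ^ (-(1 / r / 2)) * x ^ (1 / r) * x ^ (-(1 / r / 2))) * c := by
    rw [← mfun_sub, mfun_one hZ.isHermitian, ← mfun_mul, ← mfun_mul, ← hN, conjTranspose_mul, hNh,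
      Matrix.mul_sub, Matrix.sub_mul, Matrix.mul_one]
    simp only [Matrix.mul_assoc]
  rw [e2]
  refine (mfun_posSemidef hZ fun x hx => ?_).conjTranspose_mul_mul_same _
  rcases eq_or_lt_of_le hx with rfl | hx
  · rw [Real.zero_rpow hs]; simp
  · rw [← Real.rpow_add hx, ← Real.rpow_add hx]
    have : -(1 / r / 2) + 1 / r + -(1 / r / 2) = 0 := by ring
    rw [this]; simp

variable {E : Type*} [NormedAddCommGroup E] [NormedSpace ℂ E] [OperatorSpace E]

theorem sum_sub_posSemidef {α : Type*} [Fintype α] {Y : α → Matrix ι ι ℂ}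
    (hY : ∀ k, (Y k).PosSemidef) (k : α) : ((∑ k, Y k) - Y k).PosSemidef := by
  classical
  rw [← Finset.add_sum_erase _ _ (Finset.mem_univ k), add_sub_cancel_left]
  exact posSemidef_sum _ fun k _ => hY k

theorem mfun_rpow_mul_support {Y Z : Matrix ι ι ℂ} (hY : Y.PosSemidef) (hZ : Z.PosSemidef)
    (hYZ : (Z - Y).PosSemidef) {s : ℝ} (hs : s ≠ 0) :
    mfun Y (fun t => t ^ s) * (mfun Z (fun t => t ^ (-s)) * mfun Z (fun t => t ^ s)) =
      mfun Y (fun t => t ^ s) :=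
  mfun_mul_support hY hZ hYZ (Real.zero_rpow hs) fun x hx => by
    rw [← Real.rpow_add hx]; simp

/-- The Cauchy–Schwarz inequality; it recombines the separate estimates for left and right weights.
-/
theorem sum_rpow_le_of_le_sqrt_mul_sqrt {α : Type*} [Fintype α] {r T : ℝ} (hr : 0 ≤ r)
    {v a b : α → ℝ} (hv : ∀ k, 0 ≤ v k) (ha : ∀ k, 0 ≤ a k) (hb : ∀ k, 0 ≤ b k)
    (h : ∀ k, v k ≤ √(a k) * √(b k)) (hA : ∑ k, a k ^ r ≤ T) (hB : ∑ k, b k ^ r ≤ T) :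
    ∑ k, v k ^ r ≤ T := by
  have hT : 0 ≤ T := (Finset.sum_nonneg fun k _ => Real.rpow_nonneg (ha k) _).trans hA
  calc ∑ k, v k ^ r ≤ ∑ k, √(a k ^ r) * √(b k ^ r) := by
        refine Finset.sum_le_sum fun k _ => ?_
        refine (Real.rpow_le_rpow (hv k) (h k) hr).trans_eq ?_
        rw [Real.mul_rpow (by positivity) (by positivity), Real.sqrt_eq_rpow, Real.sqrt_eq_rpow,
          Real.sqrt_eq_rpow, Real.sqrt_eq_rpow, ← Real.rpow_mul (ha k), ← Real.rpow_mul (hb k),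
          ← Real.rpow_mul (ha k), ← Real.rpow_mul (hb k), mul_comm r]
    _ ≤ √(∑ k, a k ^ r) * √(∑ k, b k ^ r) :=
        Real.sum_sqrt_mul_sqrt_le _ (fun k => Real.rpow_nonneg (ha k) _)
          (fun k => Real.rpow_nonneg (hb k) _)
    _ ≤ √T * √T := by gcongr
    _ = T := Real.mul_self_sqrt hT

theorem vsn_sandwich_le_of_matNormOn_le_one {q : ℝ≥0∞} (h1 : 1 ≤ q) (A : Matrix ι κ ℂ)
    {y : Matrix κ κ E} (hy : matNormOn y ≤ 1) (B : Matrix ι κ ℂ) :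
    vectorSchattenNorm q (sandwich A y Bᴴ) ≤ √(rs q (A * Aᴴ)) * √(rs q (B * Bᴴ)) := by
  have h2 := vsn_sandwich_le h1 A y Bᴴ
  rw [conjTranspose_conjTranspose] at h2
  refine h2.trans ?_
  gcongr
  exact mul_le_of_le_one_right (Real.sqrt_nonneg _) hy

/-- The norm of `S^q(E)` is superadditive under simultaneous two-sided weighting. -/
theorem sum_vsn_weighted_le {α : Type*} [Fintype α] {q : ℝ≥0∞} (h1 : 1 ≤ q) (ht : q ≠ ∞)
    {Y X : α → Matrix ι ι ℂ} (hY : ∀ k, (Y k).PosSemidef) (hX : ∀ k, (X k).PosSemidef)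
    (g : Matrix ι ι E) :
    ∑ k, vectorSchattenNorm q (sandwich (mfun (Y k) (fun t => t ^ (1 / q.toReal / 2))) g
      (mfun (X k) (fun t => t ^ (1 / q.toReal / 2)))) ^ q.toReal ≤
    vectorSchattenNorm q (sandwich (mfun (∑ k, Y k) (fun t => t ^ (1 / q.toReal / 2))) g
      (mfun (∑ k, X k) (fun t => t ^ (1 / q.toReal / 2)))) ^ q.toReal := by
  have hr : 1 ≤ q.toReal := one_le_toReal h1 ht
  have hr0 : 0 < q.toReal := by positivity
  have hs : 1 / q.toReal / 2 ≠ 0 := by positivity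
  have hZ : (∑ k, Y k).PosSemidef := posSemidef_sum _ fun k _ => hY k
  have hW : (∑ k, X k).PosSemidef := posSemidef_sum _ fun k _ => hX k
  have hA' := fun a : Matrix ι ι ℂ => sum_rs_normalized_le h1 ht hY a
  have hB' := fun a : Matrix ι ι ℂ => sum_rs_normalized_le h1 ht hX a
  have e1 := fun k => mfun_rpow_mul_support (hY k) hZ (sum_sub_posSemidef hY k) hs
  have e2 := fun k => mfun_rpow_mul_support (hX k) hW (sum_sub_posSemidef hX k) hs
  generalize ∑ k, Y k = Z at *
  generalize ∑ k, X k = W at *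
  have hNh := mfun_isHermitian W (fun t => t ^ (-(1 / q.toReal / 2)))
  have hWh := mfun_isHermitian W (fun t => t ^ (1 / q.toReal / 2))
  have hXh := fun k => mfun_isHermitian (X k) (fun t => t ^ (1 / q.toReal / 2))
  generalize mfun Z (fun t => t ^ (-(1 / q.toReal / 2))) = ZN at *
  generalize mfun W (fun t => t ^ (-(1 / q.toReal / 2))) = WN at *
  generalize mfun Z (fun t => t ^ (1 / q.toReal / 2)) = ZP at *
  generalize mfun W (fun t => t ^ (1 / q.toReal / 2)) = WP at *
  generalize hYP : (fun k => mfun (Y k) (fun t => t ^ (1 / q.toReal / 2))) = YP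
  generalize hXP : (fun k => mfun (X k) (fun t => t ^ (1 / q.toReal / 2))) = XP
  have hYP' := fun k => congrFun hYP k
  have hXP' := fun k => congrFun hXP k
  simp only [hYP', hXP'] at *
  have hz0 := vsn_nonneg h1 (sandwich ZP g WP)
  have key : ∀ t, vectorSchattenNorm q (sandwich ZP g WP) < t →
      ∑ k, vectorSchattenNorm q (sandwich (YP k) g (XP k)) ^ q.toReal ≤ t ^ q.toReal := by
    intro t htz
    obtain ⟨a, y, b, hx, hy, ha, hb⟩ := exists_factorization h1 htz
    -- Each Y_k is supported under Z = ∑ Y_k, so Z^{-1/2q} Z^{1/2q} may be inserted on the left, and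
    -- likewise on the right. The inner block Z^{1/2q} g W^{1/2q} is then replaced by its
    -- factorization a y b*, with the same y for all k (here b* is the right factor).
    have e : ∀ k, sandwich (YP k) g (XP k) = sandwich (YP k * ZN * a) y (XP k * WN * bᴴ)ᴴ := by
      intro k
      have e3 := congrArg conjTranspose (e2 k)
      rw [conjTranspose_mul, conjTranspose_mul, hNh.eq, hWh.eq, (hXh k).eq] at e3
      rw [conjTranspose_mul, conjTranspose_mul, conjTranspose_conjTranspose, hNh.eq, (hXh k).eq,
        ← sandwich_sandwich, ← hx, sandwich_sandwich, ← Matrix.mul_assoc WP, e3,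
        Matrix.mul_assoc, e1]
    simp only [e]
    exact sum_rpow_le_of_le_sqrt_mul_sqrt hr0.le (fun k => vsn_nonneg h1 _)
      (fun k => rs_nonneg h1 _) (fun k => rs_nonneg h1 _)
      (fun k => vsn_sandwich_le_of_matNormOn_le_one h1 _ hy _)
      ((hA' a).trans (Real.rpow_le_rpow (rs_nonneg h1 _) ha hr0.le))
      ((hB' bᴴ).trans (Real.rpow_le_rpow (rs_nonneg h1 _)
        (by rwa [conjTranspose_conjTranspose]) hr0.le))
  have hlim : Filter.Tendsto (fun t : ℝ => t ^ q.toReal)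
      (nhdsWithin (vectorSchattenNorm q (sandwich ZP g WP))
        (Set.Ioi (vectorSchattenNorm q (sandwich ZP g WP))))
      (nhds (vectorSchattenNorm q (sandwich ZP g WP) ^ q.toReal)) :=
    ((Real.continuous_rpow_const hr0.le).tendsto _).mono_left nhdsWithin_le_nhds
  exact ge_of_tendsto hlim (Filter.eventually_of_mem self_mem_nhdsWithin key)

end superadditive

/-! ### Pinching the weights of a row-column combination -/

section directSum

variable {E : Type*} [NormedAddCommGroup E] [NormedSpace ℂ E] [OperatorSpace E]

/-- The inclusion of the first summand of `ι ⊕ ι`. -/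
def embL (ι : Type*) [DecidableEq ι] : Matrix (ι ⊕ ι) ι ℂ := fromRows 1 0

/-- The inclusion of the second summand of `ι ⊕ ι`. -/
def embR (ι : Type*) [DecidableEq ι] : Matrix (ι ⊕ ι) ι ℂ := fromRows 0 1

/-- The self-adjoint unitary `1 ⊕ (-1)`. -/
def flipSign (ι : Type*) [DecidableEq ι] : Matrix (ι ⊕ ι) (ι ⊕ ι) ℂ := fromBlocks 1 0 0 (-1)

theorem flipSign_conjTranspose [DecidableEq ι] : (flipSign ι)ᴴ = flipSign ι := by
  simp [flipSign, fromBlocks_conjTranspose]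

theorem flipSign_mul_self [DecidableEq ι] : flipSign ι * flipSign ι = 1 := by
  simp [flipSign, fromBlocks_multiply]

theorem flipSign_mul_embL [DecidableEq ι] : flipSign ι * embL ι = embL ι := by
  simp [flipSign, embL, fromBlocks_mul_fromRows]

theorem flipSign_mul_embR [DecidableEq ι] : flipSign ι * embR ι = -embR ι := by
  simp [flipSign, embR, fromBlocks_mul_fromRows]

theorem conjTranspose_embL [DecidableEq ι] : (embL ι)ᴴ = fromCols 1 0 := by
  simp [embL, conjTranspose_fromRows_eq_fromCols_conjTranspose]

theorem conjTranspose_embR [DecidableEq ι] : (embR ι)ᴴ = fromCols 0 1 := by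
  simp [embR, conjTranspose_fromRows_eq_fromCols_conjTranspose]

theorem mul_embL [DecidableEq ι] {m : Type*} (a b : Matrix m ι ℂ) :
    fromCols a b * embL ι = a := by
  simp [embL, fromCols_mul_fromRows]

theorem mul_embR [DecidableEq ι] {m : Type*} (a b : Matrix m ι ℂ) :
    fromCols a b * embR ι = b := by
  simp [embR, fromCols_mul_fromRows]

/-- The second summand acquires the sign −1 from both sides, and the two signs cancel. -/
theorem sandwich_flipSign [DecidableEq ι] [DecidableEq κ] (g₁ g₂ : Matrix (ι × κ) (ι × κ) E) :
    sandwich (amp κ (flipSign ι)) (sandwich (amp κ (embL ι)) g₁ (amp κ (embL ι)ᴴ) +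
      sandwich (amp κ (embR ι)) g₂ (amp κ (embR ι)ᴴ)) (amp κ (flipSign ι)) =
    sandwich (amp κ (embL ι)) g₁ (amp κ (embL ι)ᴴ) +
      sandwich (amp κ (embR ι)) g₂ (amp κ (embR ι)ᴴ) := by
  have hL : (embL ι)ᴴ * flipSign ι = (embL ι)ᴴ := by
    have := congrArg conjTranspose (flipSign_mul_embL (ι := ι))
    rwa [conjTranspose_mul, flipSign_conjTranspose] at this
  have hR : (embR ι)ᴴ * flipSign ι = -(embR ι)ᴴ := by
    have := congrArg conjTranspose (flipSign_mul_embR (ι := ι))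
    rwa [conjTranspose_mul, flipSign_conjTranspose, conjTranspose_neg] at this
  have hn : ∀ {m n : Type _} (a : Matrix m n ℂ), amp κ (-a) = (-1 : ℂ) • amp κ a := by
    intro m n a
    rw [amp, amp, ← smul_kronecker]; simp
  rw [sandwich_add, sandwich_sandwich, sandwich_sandwich, ← amp_mul, ← amp_mul, ← amp_mul,
    ← amp_mul, flipSign_mul_embL, hL, flipSign_mul_embR, hR, hn, hn, sandwich_smul_left,
    sandwich_smul_right, smul_smul]
  simp

/-- The pinching of a matrix with respect to `ι ⊕ ι` is block diagonal. -/
theorem add_flipSign_conj [DecidableEq ι] (R : Matrix (ι ⊕ ι) (ι ⊕ ι) ℂ) :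
    R + flipSign ι * R * flipSign ι =
      fromBlocks ((2 : ℂ) • R.toBlocks₁₁) 0 0 ((2 : ℂ) • R.toBlocks₂₂) := by
  conv_lhs => rw [← fromBlocks_toBlocks R]
  rw [flipSign, fromBlocks_multiply, fromBlocks_multiply, fromBlocks_add]
  simp [two_smul]

theorem fromBlocks_mul_embL [DecidableEq ι] (A D : Matrix ι ι ℂ) :
    fromBlocks A 0 0 D * embL ι = embL ι * A := by
  simp [embL, fromBlocks_mul_fromRows, fromRows_mul]

theorem fromBlocks_mul_embR [DecidableEq ι] (A D : Matrix ι ι ℂ) :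
    fromBlocks A 0 0 D * embR ι = embR ι * D := by
  simp [embR, fromBlocks_mul_fromRows, fromRows_mul]

theorem opNorm_fromCols_emb_le_one [DecidableEq ι] [DecidableEq κ] :
    opNorm (fromCols (amp κ (embL ι)) (amp κ (embR ι))) ≤ 1 := by
  rw [← opNorm_conjTranspose]
  refine opNorm_le_one_of_isometry ?_
  rw [conjTranspose_conjTranspose, fromCols_mul_conjTranspose, amp_conjTranspose,
    amp_conjTranspose, ← amp_mul, ← amp_mul, ← amp_add, conjTranspose_embL, conjTranspose_embR]
  have : embL ι * fromCols (1 : Matrix ι ι ℂ) (0 : Matrix ι ι ℂ) +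
      embR ι * fromCols (0 : Matrix ι ι ℂ) (1 : Matrix ι ι ℂ) = 1 := by
    ext i j
    rcases i with i | i <;> rcases j with j | j <;>
      simp [embL, embR, one_apply]
  rw [this, amp_one]

theorem vsn_emb_rpow_le [DecidableEq ι] [DecidableEq κ] {q : ℝ≥0∞} (h1 : 1 ≤ q) (ht : q ≠ ∞)
    (x y : Matrix (ι × κ) (ι × κ) E) :
    vectorSchattenNorm q (sandwich (amp κ (embL ι)) x (amp κ (embL ι)ᴴ) +
      sandwich (amp κ (embR ι)) y (amp κ (embR ι)ᴴ)) ^ q.toReal ≤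
      vectorSchattenNorm q x ^ q.toReal + vectorSchattenNorm q y ^ q.toReal := by
  refine le_trans ?_ (vsn_fromBlocks_rpow_le h1 ht x y)
  refine Real.rpow_le_rpow (vsn_nonneg h1 _) ?_ (by positivity)
  rw [← sandwich_fromBlocks]
  have e : opNorm (fromCols (amp κ (embL ι)) (amp κ (embR ι))) ≤ 1 := opNorm_fromCols_emb_le_one
  refine vsn_contraction_le h1 e ?_ _
  have e2 : fromRows (amp κ (embL ι)ᴴ) (amp κ (embR ι)ᴴ) =
      (fromCols (amp κ (embL ι)) (amp κ (embR ι)))ᴴ := by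
    rw [conjTranspose_fromCols_eq_fromRows_conjTranspose, amp_conjTranspose, amp_conjTranspose]
  rw [e2, opNorm_conjTranspose]; exact e

theorem mfun_flipSign_conj [DecidableEq ι] {R : Matrix (ι ⊕ ι) (ι ⊕ ι) ℂ} (hR : R.PosSemidef)
    (f : ℝ → ℝ) : mfun (flipSign ι * R * flipSign ι) f = flipSign ι * mfun R f * flipSign ι := by
  have h2 : (flipSign ι * R * flipSign ι).PosSemidef := by
    have := hR.mul_mul_conjTranspose_same (flipSign ι)
    rwa [flipSign_conjTranspose] at this
  have := mul_mfun_of_intertwine hR.isHermitian h2.isHermitian (a := flipSign ι)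
    (by rw [Matrix.mul_assoc (flipSign ι * R), flipSign_mul_self, Matrix.mul_one]) f
  rw [this, Matrix.mul_assoc (mfun (flipSign ι * R * flipSign ι) f), flipSign_mul_self,
    Matrix.mul_one]

/-- The `S^q(E)`-norm of a row-column combination is controlled by pinching its weights. -/
theorem two_mul_vsn_rowcol_rpow_le [DecidableEq ι] [DecidableEq κ] {q : ℝ≥0∞} (h1 : 1 ≤ q)
    (ht : q ≠ ∞) {R T : Matrix (ι ⊕ ι) (ι ⊕ ι) ℂ} (hR : R.PosSemidef) (hT : T.PosSemidef)
    (g₁ g₂ : Matrix (ι × κ) (ι × κ) E) :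
    2 * vectorSchattenNorm q (sandwich (amp κ (mfun R (fun t => t ^ (1 / q.toReal / 2))))
      (sandwich (amp κ (embL ι)) g₁ (amp κ (embL ι)ᴴ) +
        sandwich (amp κ (embR ι)) g₂ (amp κ (embR ι)ᴴ))
      (amp κ (mfun T (fun t => t ^ (1 / q.toReal / 2))))) ^ q.toReal ≤
    vectorSchattenNorm q (sandwich
        (amp κ (mfun ((2 : ℂ) • R.toBlocks₁₁) (fun t => t ^ (1 / q.toReal / 2)))) g₁
        (amp κ (mfun ((2 : ℂ) • T.toBlocks₁₁) (fun t => t ^ (1 / q.toReal / 2))))) ^ q.toReal +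
      vectorSchattenNorm q (sandwich
        (amp κ (mfun ((2 : ℂ) • R.toBlocks₂₂) (fun t => t ^ (1 / q.toReal / 2)))) g₂
        (amp κ (mfun ((2 : ℂ) • T.toBlocks₂₂) (fun t => t ^ (1 / q.toReal / 2))))) ^ q.toReal := by
  set f : ℝ → ℝ := fun t => t ^ (1 / q.toReal / 2)
  set G := sandwich (amp κ (embL ι)) g₁ (amp κ (embL ι)ᴴ) +
        sandwich (amp κ (embR ι)) g₂ (amp κ (embR ι)ᴴ) with hG
  set F := flipSign ι with hF
  have hF1 : (amp κ F)ᴴ * amp κ F = 1 := by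
    rw [amp_conjTranspose, flipSign_conjTranspose, ← amp_mul, flipSign_mul_self, amp_one]
  have hF2 : amp κ F * (amp κ F)ᴴ = 1 := by
    rw [amp_conjTranspose, flipSign_conjTranspose, ← amp_mul, flipSign_mul_self, amp_one]
  have hps : ∀ {S : Matrix (ι ⊕ ι) (ι ⊕ ι) ℂ}, S.PosSemidef → (F * S * F).PosSemidef := by
    intro S hS
    have := hS.mul_mul_conjTranspose_same F
    rwa [flipSign_conjTranspose] at this
  -- The middle matrix G is invariant under conjugation by the sign unitary F. Replacing R, T by
  -- FRF, FTF therefore conjugates the whole product by a unitary, which preserves the norm.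
  have hsym : vectorSchattenNorm q (sandwich (mfun (amp κ (F * R * F)) f) G
      (mfun (amp κ (F * T * F)) f)) = vectorSchattenNorm q (sandwich (amp κ (mfun R f)) G
      (amp κ (mfun T f))) := by
    rw [amp_mfun (hps hR).isHermitian, amp_mfun (hps hT).isHermitian, mfun_flipSign_conj hR,
      mfun_flipSign_conj hT, ← hF, amp_mul, amp_mul, amp_mul, amp_mul]
    have e : sandwich (amp κ F * amp κ (mfun R f) * amp κ F) G
        (amp κ F * amp κ (mfun T f) * amp κ F) = sandwich (amp κ F)
        (sandwich (amp κ (mfun R f)) (sandwich (amp κ F) G (amp κ F)) (amp κ (mfun T f)))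
        (amp κ F) := by
      rw [sandwich_sandwich, sandwich_sandwich]; simp only [Matrix.mul_assoc]
    have hFF : amp κ F * amp κ F = 1 := by rw [← amp_mul, flipSign_mul_self, amp_one]
    rw [e, sandwich_flipSign, vsn_unitary h1 hF1 hF2]
  -- Superadditivity for the pairs (R, FRF) and (T, FTF): the two terms on the left are equal, which
  -- is where the 2 comes from, and on the right R + FRF is twice the block diagonal of R.
  have hsup := sum_vsn_weighted_le h1 ht (α := Fin 2) (Y := ![amp κ R, amp κ (F * R * F)])
    (X := ![amp κ T, amp κ (F * T * F)])
    (fun k => by fin_cases k; exacts [amp_posSemidef hR, amp_posSemidef (hps hR)])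
    (fun k => by fin_cases k; exacts [amp_posSemidef hT, amp_posSemidef (hps hT)]) G
  simp only [Fin.sum_univ_two, cons_val_zero, cons_val_one] at hsup
  change _ + vectorSchattenNorm q (sandwich (mfun (amp κ (F * R * F)) f) G
      (mfun (amp κ (F * T * F)) f)) ^ q.toReal ≤ _ at hsup
  rw [hsym, amp_mfun hR.isHermitian, amp_mfun hT.isHermitian, ← amp_add, ← amp_add,
    amp_mfun (hR.add (hps hR)).isHermitian, amp_mfun (hT.add (hps hT)).isHermitian, hF,
    add_flipSign_conj, add_flipSign_conj] at hsup
  have hblk : ∀ {S : Matrix (ι ⊕ ι) (ι ⊕ ι) ℂ}, S.PosSemidef →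
      ((2 : ℂ) • S.toBlocks₁₁).PosSemidef ∧ ((2 : ℂ) • S.toBlocks₂₂).PosSemidef := by
    intro S hS
    have h2 : (0 : ℂ) ≤ 2 := by norm_num
    exact ⟨(hS.submatrix Sum.inl).smul h2, (hS.submatrix Sum.inr).smul h2⟩
  rw [mfun_fromBlocks (hblk hR).1.isHermitian (hblk hR).2.isHermitian,
    mfun_fromBlocks (hblk hT).1.isHermitian (hblk hT).2.isHermitian] at hsup
  have hc : ∀ A D : Matrix ι ι ℂ, A.IsHermitian → D.IsHermitian →
      (embL ι)ᴴ * fromBlocks A 0 0 D = A * (embL ι)ᴴ ∧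
      (embR ι)ᴴ * fromBlocks A 0 0 D = D * (embR ι)ᴴ := by
    intro A D hA hD
    rw [conjTranspose_embL, conjTranspose_embR]
    constructor <;> simp [fromCols_mul_fromBlocks, mul_fromCols]
  have hmove : ∀ A D A' D' : Matrix ι ι ℂ, A'.IsHermitian → D'.IsHermitian →
      sandwich (amp κ (fromBlocks A 0 0 D)) G (amp κ (fromBlocks A' 0 0 D')) =
      sandwich (amp κ (embL ι)) (sandwich (amp κ A) g₁ (amp κ A')) (amp κ (embL ι)ᴴ) +
      sandwich (amp κ (embR ι)) (sandwich (amp κ D) g₂ (amp κ D')) (amp κ (embR ι)ᴴ) := by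
    intro A D A' D' hA' hD'
    rw [hG, sandwich_add]
    simp only [sandwich_sandwich, ← amp_mul]
    rw [fromBlocks_mul_embL, fromBlocks_mul_embR, (hc A' D' hA' hD').1, (hc A' D' hA' hD').2]
  rw [hmove _ _ _ _ (mfun_isHermitian _ _) (mfun_isHermitian _ _)] at hsup
  refine (le_trans (le_of_eq ?_) hsup).trans (vsn_emb_rpow_le h1 ht _ _)
  rw [two_mul]

end directSum

end

/-! ### Coefficient-independent weights for row-column combinations -/

section

variable {ι κ : Type*} [Fintype ι] [Fintype κ]
variable {E : Type*} [NormedAddCommGroup E] [NormedSpace ℂ E] [OperatorSpace E]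

theorem rs_mfun_rpow {q : ℝ≥0∞} (h1 : 1 ≤ q) (ht : q ≠ ∞) {X : Matrix ι ι ℂ}
    (hX : X.PosSemidef) :
    rs q (mfun X (fun t => t ^ (1 / q.toReal / 2)) *
      (mfun X (fun t => t ^ (1 / q.toReal / 2)))ᴴ) ^ q.toReal = X.trace.re := by
  have hr : 1 ≤ q.toReal := one_le_toReal h1 ht
  have hr0 : q.toReal ≠ 0 := by positivity
  rw [mfun_isHermitian, mfun_rpow_half_sq hX _ (by positivity),
    rs_rpow h1 ht (mfun_posSemidef hX fun x hx => Real.rpow_nonneg hx _),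
    mfun_mfun hX.isHermitian]
  have : mfun X (fun x => (x ^ (1 / q.toReal)) ^ q.toReal) = mfun X (fun x => x) :=
    mfun_congr hX fun x hx => by rw [← Real.rpow_mul hx, one_div_mul_cancel hr0, Real.rpow_one]
  rw [this, mfun_id hX.isHermitian]

theorem mfun_rpow_rpow_half {q : ℝ≥0∞} (h1 : 1 ≤ q) (ht : q ≠ ∞) {H : Matrix ι ι ℂ}
    (hH : H.PosSemidef) :
    mfun (mfun H (fun t => t ^ q.toReal)) (fun t => t ^ (1 / q.toReal / 2)) =
      mfun H Real.sqrt := by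
  have hr : 1 ≤ q.toReal := one_le_toReal h1 ht
  rw [mfun_mfun hH.isHermitian]
  refine mfun_congr hH fun x hx => ?_
  rw [← Real.rpow_mul hx, Real.sqrt_eq_rpow]
  congr 1
  field_simp

theorem two_smul_toBlocks_posSemidef {S : Matrix (ι ⊕ ι) (ι ⊕ ι) ℂ} (hS : S.PosSemidef) :
    ((2 : ℂ) • S.toBlocks₁₁).PosSemidef ∧ ((2 : ℂ) • S.toBlocks₂₂).PosSemidef := by
  have h2 : (0 : ℂ) ≤ 2 := by norm_num
  exact ⟨(hS.submatrix Sum.inl).smul h2, (hS.submatrix Sum.inr).smul h2⟩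

/-- By `rs_mfun_rpow` the two terms are the traces of the doubled diagonal blocks, so their sum is 2
tr R = 2 `rs q H` ^ q. -/
theorem pinching_weights {q : ℝ≥0∞} (h1 : 1 ≤ q) (ht : q ≠ ∞) {H : Matrix (ι ⊕ ι) (ι ⊕ ι) ℂ}
    (hH : H.PosSemidef) {R : Matrix (ι ⊕ ι) (ι ⊕ ι) ℂ}
    (hR : R = mfun H (fun t => t ^ q.toReal)) (h : rs q H ≤ 1) :
    rs q (mfun ((2 : ℂ) • R.toBlocks₁₁) (fun t => t ^ (1 / q.toReal / 2)) *
      (mfun ((2 : ℂ) • R.toBlocks₁₁) (fun t => t ^ (1 / q.toReal / 2)))ᴴ) ^ q.toReal +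
    rs q (mfun ((2 : ℂ) • R.toBlocks₂₂) (fun t => t ^ (1 / q.toReal / 2)) *
      (mfun ((2 : ℂ) • R.toBlocks₂₂) (fun t => t ^ (1 / q.toReal / 2)))ᴴ) ^ q.toReal ≤ 2 := by
  have hRp : R.PosSemidef := hR ▸ mfun_posSemidef hH fun x hx => Real.rpow_nonneg hx _
  obtain ⟨ha, hb⟩ := two_smul_toBlocks_posSemidef hRp
  rw [rs_mfun_rpow h1 ht ha, rs_mfun_rpow h1 ht hb]
  have e : R.trace = R.toBlocks₁₁.trace + R.toBlocks₂₂.trace := by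
    simp [trace, Fintype.sum_sum_type, toBlocks₁₁, toBlocks₂₂]
  have h3 : R.trace.re ≤ 1 := by
    rw [hR, ← rs_rpow h1 ht hH]
    exact Real.rpow_le_one (rs_nonneg h1 _) h (by positivity)
  rw [e] at h3
  rw [trace_smul, trace_smul]
  simp only [smul_eq_mul, Complex.mul_re, Complex.re_ofNat, Complex.im_ofNat, Complex.add_re]
    at h3 ⊢
  linarith

theorem amp_fromCols [DecidableEq ι] [DecidableEq κ] (c₁ c₂ : Matrix ι ι ℂ) :
    amp κ (fromCols c₁ c₂) * amp κ (embL ι) = amp κ c₁ ∧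
      amp κ (fromCols c₁ c₂) * amp κ (embR ι) = amp κ c₂ := by
  rw [← amp_mul, ← amp_mul, mul_embL, mul_embR]; exact ⟨rfl, rfl⟩

/-- For a row `(c₁, c₂)` and a column `(d₁, d₂)` in the unit ball of `S^{2 q}`, the norm of
`c₁ g₁ d₁ + c₂ g₂ d₂` is controlled by two-sided weights which do not depend on the
coefficients. -/
theorem exists_weights_rowcol {q : ℝ≥0∞} (h1 : 1 ≤ q) (ht : q ≠ ∞)
    {c₁ c₂ d₁ d₂ : Matrix ι ι ℂ} (hc : rs q (c₁ * c₁ᴴ + c₂ * c₂ᴴ) ≤ 1)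
    (hd : rs q (d₁ᴴ * d₁ + d₂ᴴ * d₂) ≤ 1) :
    ∃ a₁ a₂ b₁ b₂ : Matrix ι ι ℂ,
      rs q (a₁ * a₁ᴴ) ^ q.toReal + rs q (a₂ * a₂ᴴ) ^ q.toReal ≤ 2 ∧
      rs q (b₁ᴴ * b₁) ^ q.toReal + rs q (b₂ᴴ * b₂) ^ q.toReal ≤ 2 ∧
      ∀ (m : ℕ) (g₁ g₂ : Matrix (ι × Fin m) (ι × Fin m) E),
        2 * vectorSchattenNorm q (sandwich (amp (Fin m) c₁) g₁ (amp (Fin m) d₁) +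
          sandwich (amp (Fin m) c₂) g₂ (amp (Fin m) d₂)) ^ q.toReal ≤
        vectorSchattenNorm q (sandwich (amp (Fin m) a₁) g₁ (amp (Fin m) b₁)) ^ q.toReal +
        vectorSchattenNorm q (sandwich (amp (Fin m) a₂) g₂ (amp (Fin m) b₂)) ^ q.toReal := by
  classical
  set C := fromCols c₁ c₂ with hC
  set D := fromRows d₁ d₂ with hD
  have hH := posSemidef_conjTranspose_mul_self C
  have hK := posSemidef_self_mul_conjTranspose D
  have hHle : rs q (Cᴴ * C) ≤ 1 := by
    have e : rs q (Cᴴ * C) = rs q (C * Cᴴ) := by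
      have hp : 0 < q.toReal := by have := one_le_toReal h1 ht; positivity
      refine (Real.rpow_left_inj (rs_nonneg h1 _) (rs_nonneg h1 _) hp.ne').1 ?_
      rw [rs_rpow_self_mul h1 ht, rs_rpow h1 ht hH]
    rwa [e, hC, fromCols_mul_conjTranspose]
  have hKle : rs q (D * Dᴴ) ≤ 1 := by
    have e : rs q (D * Dᴴ) = rs q (Dᴴ * D) := by
      have hp : 0 < q.toReal := by have := one_le_toReal h1 ht; positivity
      refine (Real.rpow_left_inj (rs_nonneg h1 _) (rs_nonneg h1 _) hp.ne').1 ?_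
      rw [rs_rpow_self_mul h1 ht, rs_rpow h1 ht (posSemidef_conjTranspose_mul_self D)]
    rwa [e, hD, conjTranspose_mul_fromRows]
  -- The exponents are such that R^{1/2q} = |C|. As C is a contraction times |C|, and D is |D*|
  -- times a contraction, it suffices to pinch |C| and |D*|.
  generalize hRdef : mfun (Cᴴ * C) (fun t => t ^ q.toReal) = R
  generalize hTdef : mfun (D * Dᴴ) (fun t => t ^ q.toReal) = T
  have hR : R.PosSemidef := hRdef ▸ mfun_posSemidef hH fun x hx => Real.rpow_nonneg hx _
  have hT : T.PosSemidef := hTdef ▸ mfun_posSemidef hK fun x hx => Real.rpow_nonneg hx _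
  refine ⟨_, _, mfun ((2 : ℂ) • T.toBlocks₁₁) (fun t => t ^ (1 / q.toReal / 2)),
    mfun ((2 : ℂ) • T.toBlocks₂₂) (fun t => t ^ (1 / q.toReal / 2)),
    pinching_weights h1 ht hH hRdef.symm hHle, ?_, fun m g₁ g₂ => ?_⟩
  · have := pinching_weights h1 ht hK hTdef.symm hKle
    simpa only [(mfun_isHermitian _ _).eq] using this
  refine le_trans ?_ (two_mul_vsn_rowcol_rpow_le h1 ht hR hT g₁ g₂)
  refine mul_le_mul_of_nonneg_left (Real.rpow_le_rpow (vsn_nonneg h1 _) ?_ (by positivity))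
    zero_le_two
  obtain ⟨v, hv, hv1⟩ := exists_polar Cᴴ
  obtain ⟨w, hw, hw1⟩ := exists_polar D
  rw [conjTranspose_conjTranspose] at hv
  rw [← hRdef, ← hTdef, mfun_rpow_rpow_half h1 ht hH, mfun_rpow_rpow_half h1 ht hK]
  have hv' : C = vᴴ * mfun (Cᴴ * C) Real.sqrt := by
    have := congrArg conjTranspose hv
    rwa [conjTranspose_conjTranspose, conjTranspose_mul, (mfun_isHermitian _ _).eq] at this
  have e : sandwich (amp (Fin m) c₁) g₁ (amp (Fin m) d₁) +
      sandwich (amp (Fin m) c₂) g₂ (amp (Fin m) d₂) =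
      sandwich (amp (Fin m) C) (sandwich (amp (Fin m) (embL ι)) g₁ (amp (Fin m) (embL ι)ᴴ) +
        sandwich (amp (Fin m) (embR ι)) g₂ (amp (Fin m) (embR ι)ᴴ)) (amp (Fin m) D) := by
    have hL : (embL ι)ᴴ * D = d₁ := by
      rw [conjTranspose_embL, hD, fromCols_mul_fromRows]; simp
    have hR' : (embR ι)ᴴ * D = d₂ := by
      rw [conjTranspose_embR, hD, fromCols_mul_fromRows]; simp
    rw [sandwich_add, sandwich_sandwich, sandwich_sandwich, (amp_fromCols c₁ c₂).1,
      (amp_fromCols c₁ c₂).2, ← amp_mul, ← amp_mul, hL, hR']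
  rw [e]
  generalize sandwich (amp (Fin m) (embL ι)) g₁ (amp (Fin m) (embL ι)ᴴ) +
        sandwich (amp (Fin m) (embR ι)) g₂ (amp (Fin m) (embR ι)ᴴ) = G
  generalize mfun (Cᴴ * C) Real.sqrt = X at *
  generalize mfun (D * Dᴴ) Real.sqrt = Y at *
  rw [hv', hw, amp_mul, amp_mul, ← sandwich_sandwich]
  exact vsn_contraction_le h1 (amp_opNorm_le_one (by rwa [opNorm_conjTranspose]))
    (amp_opNorm_le_one hw1) _

/-! ### Matrix norms of the coefficient spaces -/

section coeff

variable {I : Type*} {d : I → ℕ} {S : Finset I}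

/-- The component of index `σ` of a matrix over `𝓛_E(S)`. -/
def blk (A : Matrix ι ι (CoeffSpace d E S)) (σ : S) :
    Matrix (ι × Fin (d σ)) (ι × Fin (d σ)) E :=
  of fun x y => A x.1 y.1 σ x.2 y.2

theorem blk_add (A B : Matrix ι ι (CoeffSpace d E S)) (σ : S) :
    blk (A + B) σ = blk A σ + blk B σ := rfl

theorem blk_smul (c : ℂ) (A : Matrix ι ι (CoeffSpace d E S)) (σ : S) :
    blk (c • A) σ = c • blk A σ := rfl

theorem blk_sandwich (a b : Matrix ι ι ℂ) (A : Matrix ι ι (CoeffSpace d E S)) (σ : S) :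
    blk (sandwich a A b) σ = sandwich (amp _ a) (blk A σ) (amp _ b) := by
  ext x y
  have : ∀ i j, (∑ r, ∑ s, (a i r * b s j) • A r s) σ x.2 y.2 =
      ∑ r, ∑ s, (a i r * b s j) • A r s σ x.2 y.2 := by
    intro i j
    simp [Finset.sum_apply, Matrix.sum_apply]
  simp only [blk, of_apply, sandwich_apply, this, Fintype.sum_prod_type, amp, kroneckerMap_apply,
    one_apply]
  refine Finset.sum_congr rfl fun r _ => ?_
  rw [Finset.sum_eq_single x.2 (fun k _ hk => by simp [hk.symm]) (by simp)]
  refine Finset.sum_congr rfl fun s _ => ?_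
  rw [Finset.sum_eq_single y.2 (fun k _ hk => by simp [hk]) (by simp)]
  simp

theorem coeffSchattenGauge_top {n : ℕ} (A : Matrix (Fin n) (Fin n) (CoeffSpace d E S)) :
    coeffSchattenGauge d E S ∞ n A = ⨆ σ : S, ENNReal.ofReal (vectorSchattenNorm ∞ (blk A σ)) := by
  simp only [coeffSchattenGauge, if_pos]; rfl

theorem coeffSchattenGauge_of_ne_top {q : ℝ≥0∞} (ht : q ≠ ∞) {n : ℕ}
    (A : Matrix (Fin n) (Fin n) (CoeffSpace d E S)) :
    coeffSchattenGauge d E S q n A = (∑ σ : S, (d σ : ℝ≥0∞) *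
      ENNReal.ofReal (vectorSchattenNorm q (blk A σ)) ^ q.toReal) ^ (1 / q.toReal) := by
  simp only [coeffSchattenGauge, if_neg ht]; rfl

theorem le_matrixGauge {V : Type*} [AddCommGroup V] [Module ℂ V] {q : ℝ≥0∞} (N : MatrixGauge V)
    {n : ℕ} {a b : Matrix (Fin n) (Fin n) ℂ} (ha : schattenNorm (2 * q) a ≤ 1)
    (hb : schattenNorm (2 * q) b ≤ 1) (x : Matrix (Fin n) (Fin n) V) :
    N n (sandwich a x b) ≤ matrixGauge q N n x :=
  le_iSup₂_of_le a b (le_iSup₂_of_le ha hb le_rfl)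

theorem matrixGauge_le {V : Type*} [AddCommGroup V] [Module ℂ V] {q : ℝ≥0∞} {N : MatrixGauge V}
    {n : ℕ} {x : Matrix (Fin n) (Fin n) V} {K : ℝ≥0∞}
    (h : ∀ a b : Matrix (Fin n) (Fin n) ℂ, schattenNorm (2 * q) a ≤ 1 →
      schattenNorm (2 * q) b ≤ 1 → N n (sandwich a x b) ≤ K) : matrixGauge q N n x ≤ K :=
  iSup₂_le fun a b => iSup₂_le fun ha hb => h a b ha hb

theorem coeffSchattenGauge_le_of_forall {q : ℝ≥0∞} (h1 : 1 ≤ q) {n m : ℕ}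
    {A : Matrix (Fin n) (Fin n) (CoeffSpace d E S)} {B : Matrix (Fin m) (Fin m) (CoeffSpace d E S)}
    (h : ∀ σ, vectorSchattenNorm q (blk A σ) ≤ vectorSchattenNorm q (blk B σ)) :
    coeffSchattenGauge d E S q n A ≤ coeffSchattenGauge d E S q m B := by
  by_cases ht : q = ∞
  · subst ht
    rw [coeffSchattenGauge_top, coeffSchattenGauge_top]
    exact iSup_mono fun σ => ENNReal.ofReal_le_ofReal (h σ)
  · rw [coeffSchattenGauge_of_ne_top ht, coeffSchattenGauge_of_ne_top ht]
    gcongr with σ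
    exact h σ

theorem coeffSchattenGauge_rpow {q : ℝ≥0∞} (h1 : 1 ≤ q) (ht : q ≠ ∞) {n : ℕ}
    (A : Matrix (Fin n) (Fin n) (CoeffSpace d E S)) :
    coeffSchattenGauge d E S q n A ^ q.toReal = ∑ σ : S, (d σ : ℝ≥0∞) *
      ENNReal.ofReal (vectorSchattenNorm q (blk A σ)) ^ q.toReal := by
  have hr := one_le_toReal h1 ht
  rw [coeffSchattenGauge_of_ne_top ht, ← ENNReal.rpow_mul, one_div_mul_cancel (by positivity),
    ENNReal.rpow_one]

theorem coeffSchattenGauge_smul {q : ℝ≥0∞} (h1 : 1 ≤ q) {n : ℕ} (c : ℂ)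
    (A : Matrix (Fin n) (Fin n) (CoeffSpace d E S)) :
    coeffSchattenGauge d E S q n (c • A) =
      ENNReal.ofReal ‖c‖ * coeffSchattenGauge d E S q n A := by
  by_cases ht : q = ∞
  · subst ht
    rw [coeffSchattenGauge_top, coeffSchattenGauge_top, ENNReal.mul_iSup]
    refine iSup_congr fun σ => ?_
    rw [blk_smul, vsn_smul h1, ENNReal.ofReal_mul (norm_nonneg _)]
  · have hr := one_le_toReal h1 ht
    have hr0 : q.toReal ≠ 0 := by positivity
    rw [coeffSchattenGauge_of_ne_top ht, coeffSchattenGauge_of_ne_top ht]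
    have : ∀ σ : S, (d σ : ℝ≥0∞) * ENNReal.ofReal (vectorSchattenNorm q (blk (c • A) σ)) ^ q.toReal =
        ENNReal.ofReal ‖c‖ ^ q.toReal *
          ((d σ : ℝ≥0∞) * ENNReal.ofReal (vectorSchattenNorm q (blk A σ)) ^ q.toReal) := by
      intro σ
      rw [blk_smul, vsn_smul h1, ENNReal.ofReal_mul (norm_nonneg _),
        ENNReal.mul_rpow_of_nonneg _ _ (by positivity)]
      ring
    rw [Finset.sum_congr rfl fun σ _ => this σ, ← Finset.mul_sum,
      ENNReal.mul_rpow_of_nonneg _ _ (by positivity), ← ENNReal.rpow_mul,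
      mul_one_div_cancel hr0, ENNReal.rpow_one]

theorem coeffSchattenGauge_zero {q : ℝ≥0∞} (h1 : 1 ≤ q) {n : ℕ} :
    coeffSchattenGauge d E S q n 0 = 0 := by
  have := coeffSchattenGauge_smul (d := d) (E := E) (S := S) h1 (n := n) 0 0
  simpa using this

theorem eq_zero_of_opNorm_le_zero {a : Matrix ι κ ℂ} (h : opNorm a ≤ 0) : a = 0 := by
  classical
  rw [opNorm_eq] at h
  open scoped Matrix.Norms.L2Operator in exact norm_le_zero_iff.1 h

theorem schattenNorm_smul {q : ℝ≥0∞} (h1 : 1 ≤ q) {c : ℝ} (hc : 0 ≤ c) (x : Matrix ι ι ℂ) :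
    schattenNorm (2 * q) ((c : ℂ) • x) = c * schattenNorm (2 * q) x := by
  have e : (((c : ℂ) • x)ᴴ * ((c : ℂ) • x)) = ((c ^ 2 : ℝ) : ℂ) • (xᴴ * x) := by
    rw [conjTranspose_smul, Matrix.smul_mul, Matrix.mul_smul, smul_smul]
    simp [pow_two]
  rw [schattenNorm_two_mul h1, schattenNorm_two_mul h1, e,
    rs_smul h1 (posSemidef_conjTranspose_mul_self x) (by positivity),
    Real.sqrt_mul (by positivity), Real.sqrt_sq hc]

/-- The definition of `coeffGauge` with a and b rescaled to the unit ball. A weight of norm zero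
vanishes and makes the left side zero, which also covers an infinite right-hand gauge. -/
theorem coeffSchattenGauge_sandwich_le {q : ℝ≥0∞} (h1 : 1 ≤ q) {n : ℕ}
    (a b : Matrix (Fin n) (Fin n) ℂ) (g : Matrix (Fin n) (Fin n) (CoeffSpace d E S)) :
    coeffSchattenGauge d E S q n (sandwich a g b) ≤
      ENNReal.ofReal (√(rs q (a * aᴴ)) * √(rs q (bᴴ * b))) * coeffGauge d E S q n g := by
  have hz : ∀ (x y : Matrix (Fin n) (Fin n) ℂ), sandwich (0 : Matrix (Fin n) (Fin n) ℂ) g y = 0 ∧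
      sandwich x g (0 : Matrix (Fin n) (Fin n) ℂ) = 0 := by
    intro x y
    constructor <;> (ext i j; simp [sandwich_apply])
  rw [← schattenNorm_two_mul' h1, ← schattenNorm_two_mul h1]
  have hna := schattenNorm_smul h1 (c := (schattenNorm (2 * q) a)⁻¹) (x := a)
  have hnb := schattenNorm_smul h1 (c := (schattenNorm (2 * q) b)⁻¹) (x := b)
  have ha0 := opNorm_le_schattenNorm h1 a
  have hb0 := opNorm_le_schattenNorm h1 b
  generalize schattenNorm (2 * q) a = s at *
  generalize schattenNorm (2 * q) b = t at *
  have hs0 := (opNorm_nonneg _).trans ha0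
  have ht0 := (opNorm_nonneg _).trans hb0
  rcases hs0.eq_or_lt with ha | ha
  · rw [eq_zero_of_opNorm_le_zero (ha0.trans ha.ge), (hz 0 b).1, coeffSchattenGauge_zero h1]
    exact zero_le
  rcases ht0.eq_or_lt with hb | hb
  · rw [eq_zero_of_opNorm_le_zero (hb0.trans hb.ge), (hz a 0).2, coeffSchattenGauge_zero h1]
    exact zero_le
  have e : sandwich a g b = ((s * t : ℝ) : ℂ) •
      sandwich (((s⁻¹ : ℝ) : ℂ) • a) g (((t⁻¹ : ℝ) : ℂ) • b) := by
    rw [sandwich_smul_left, sandwich_smul_right, smul_smul, smul_smul, ← Complex.ofReal_mul,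
      ← Complex.ofReal_mul]
    rw [show s * t * s⁻¹ * t⁻¹ = 1 by field_simp, Complex.ofReal_one, one_smul]
  rw [e, coeffSchattenGauge_smul h1, Complex.norm_real, Real.norm_of_nonneg (by positivity)]
  gcongr
  refine le_matrixGauge _ ?_ ?_ g
  · rw [hna (by positivity), inv_mul_cancel₀ ha.ne']
  · rw [hnb (by positivity), inv_mul_cancel₀ hb.ne']

theorem sqrt_le_one_iff {x : ℝ} : √x ≤ 1 ↔ x ≤ 1 := by
  rw [Real.sqrt_le_iff]; simp

theorem coeffSchattenGauge_le_coeffGauge_top {n : ℕ}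
    (g : Matrix (Fin n) (Fin n) (CoeffSpace d E S)) :
    coeffSchattenGauge d E S ∞ n g ≤ coeffGauge d E S ∞ n g := by
  have h1 : schattenNorm (2 * ∞) (1 : Matrix (Fin n) (Fin n) ℂ) ≤ 1 := by
    rw [schattenNorm_two_mul le_top, sqrt_le_one_iff]
    refine rs_top_le_of_opNorm (posSemidef_conjTranspose_mul_self _) zero_le_one ?_
    simpa using PosSemidef.zero
  have := le_matrixGauge (coeffSchattenGauge d E S ∞) h1 h1 g
  rwa [sandwich_one] at this

/-- The unit ball of the matrix norms of `𝓛_E^q(S)` is stable under row-column combinations. -/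
theorem coeffSchattenGauge_rowcol_le {q : ℝ≥0∞} (h1 : 1 ≤ q) {n : ℕ} {K : ℝ≥0∞}
    {c₁ c₂ d₁ d₂ : Matrix (Fin n) (Fin n) ℂ} (hc : rs q (c₁ * c₁ᴴ + c₂ * c₂ᴴ) ≤ 1)
    (hd : rs q (d₁ᴴ * d₁ + d₂ᴴ * d₂) ≤ 1)
    {g₁ g₂ : Matrix (Fin n) (Fin n) (CoeffSpace d E S)}
    (hg₁ : coeffGauge d E S q n g₁ ≤ K) (hg₂ : coeffGauge d E S q n g₂ ≤ K) :
    coeffSchattenGauge d E S q n (sandwich c₁ g₁ d₁ + sandwich c₂ g₂ d₂) ≤ K := by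
  by_cases ht : q = ∞
  · subst ht
    have h₁ := (coeffSchattenGauge_le_coeffGauge_top g₁).trans hg₁
    have h₂ := (coeffSchattenGauge_le_coeffGauge_top g₂).trans hg₂
    rw [coeffSchattenGauge_top] at h₁ h₂ ⊢
    refine iSup_le fun σ => ?_
    have h₁' := (le_iSup _ σ).trans h₁
    have h₂' := (le_iSup _ σ).trans h₂
    have hm : ENNReal.ofReal (max (matNormOn (blk g₁ σ)) (matNormOn (blk g₂ σ))) ≤ K := by
      rw [ENNReal.ofReal_max, ← vsn_top, ← vsn_top]; exact max_le h₁' h₂'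
    refine le_trans (ENNReal.ofReal_le_ofReal ?_) hm
    have hC : opNorm (fromCols c₁ c₂) ≤ 1 := by
      refine (opNorm_le_sqrt_rs' (q := ∞) le_top _).trans ?_
      rw [fromCols_mul_conjTranspose]; exact sqrt_le_one_iff.2 hc
    have hD : opNorm (fromRows d₁ d₂) ≤ 1 := by
      refine (opNorm_le_sqrt_rs (q := ∞) le_top _).trans ?_
      rw [conjTranspose_mul_fromRows]; exact sqrt_le_one_iff.2 hd
    have hC' : opNorm (fromCols (amp (Fin (d σ)) c₁) (amp (Fin (d σ)) c₂)) ≤ 1 := by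
      have e : fromCols (amp (Fin (d σ)) c₁) (amp (Fin (d σ)) c₂) =
          amp (Fin (d σ)) (fromCols c₁ c₂) *
            fromCols (amp (Fin (d σ)) (embL (Fin n))) (amp (Fin (d σ)) (embR (Fin n))) := by
        rw [mul_fromCols, (amp_fromCols c₁ c₂).1, (amp_fromCols c₁ c₂).2]
      rw [e]
      exact (opNorm_mul_le _ _).trans (mul_le_one₀ (amp_opNorm_le_one hC) (opNorm_nonneg _)
        opNorm_fromCols_emb_le_one)
    have hD' : opNorm (fromRows (amp (Fin (d σ)) d₁) (amp (Fin (d σ)) d₂)) ≤ 1 := by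
      have e : fromRows (amp (Fin (d σ)) d₁) (amp (Fin (d σ)) d₂) =
          (fromCols (amp (Fin (d σ)) (embL (Fin n))) (amp (Fin (d σ)) (embR (Fin n))))ᴴ *
          amp (Fin (d σ)) (fromRows d₁ d₂) := by
        rw [conjTranspose_fromCols_eq_fromRows_conjTranspose, amp_conjTranspose,
          amp_conjTranspose, fromRows_mul, ← amp_mul, ← amp_mul, conjTranspose_embL,
          conjTranspose_embR, fromCols_mul_fromRows, fromCols_mul_fromRows]
        simp
      rw [e]
      refine (opNorm_mul_le _ _).trans (mul_le_one₀ ?_ (opNorm_nonneg _)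
        (amp_opNorm_le_one hD))
      rw [opNorm_conjTranspose]; exact opNorm_fromCols_emb_le_one
    rw [vsn_top, blk_add, blk_sandwich, blk_sandwich, ← sandwich_fromBlocks,
      ← matNormOn_fromBlocks]
    refine (matNormOn_sandwich_le _ _ _).trans ?_
    have := matNormOn_nonneg (fromBlocks (blk g₁ σ) 0 0 (blk g₂ σ))
    calc _ ≤ 1 * matNormOn (fromBlocks (blk g₁ σ) 0 0 (blk g₂ σ)) * 1 := by
          gcongr
          exact opNorm_nonneg _
      _ = _ := by ring
  · have hr := one_le_toReal h1 ht
    have hr0 : 0 < q.toReal := by positivity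
    obtain ⟨a₁, a₂, b₁, b₂, ha, hb, h⟩ := exists_weights_rowcol (E := E) h1 ht hc hd
    rw [← ENNReal.rpow_le_rpow_iff hr0]
    -- The weights depend neither on the coefficients nor on the size of the blocks, so the same
    -- ones serve every σ and the estimates can be summed with the factors d_σ.
    have key : 2 * coeffSchattenGauge d E S q n (sandwich c₁ g₁ d₁ + sandwich c₂ g₂ d₂) ^ q.toReal ≤
        coeffSchattenGauge d E S q n (sandwich a₁ g₁ b₁) ^ q.toReal +
        coeffSchattenGauge d E S q n (sandwich a₂ g₂ b₂) ^ q.toReal := by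
      rw [coeffSchattenGauge_rpow h1 ht, coeffSchattenGauge_rpow h1 ht,
        coeffSchattenGauge_rpow h1 ht, Finset.mul_sum, ← Finset.sum_add_distrib]
      refine Finset.sum_le_sum fun σ _ => ?_
      have hσ := h (d σ) (blk g₁ σ) (blk g₂ σ)
      rw [← blk_sandwich, ← blk_sandwich, ← blk_sandwich, ← blk_sandwich, ← blk_add] at hσ
      rw [mul_left_comm, ← mul_add]
      gcongr
      rw [ENNReal.ofReal_rpow_of_nonneg (vsn_nonneg h1 _) hr0.le,
        ENNReal.ofReal_rpow_of_nonneg (vsn_nonneg h1 _) hr0.le,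
        ENNReal.ofReal_rpow_of_nonneg (vsn_nonneg h1 _) hr0.le,
        ← ENNReal.ofReal_add (Real.rpow_nonneg (vsn_nonneg h1 _) _)
          (Real.rpow_nonneg (vsn_nonneg h1 _) _), ← ENNReal.ofReal_ofNat 2,
        ← ENNReal.ofReal_mul zero_le_two]
      exact ENNReal.ofReal_le_ofReal hσ
    -- The left and right weights each have total q-mass at most 2. By Cauchy–Schwarz so do their
    -- products, which matches the 2 on the left of `key`.
    have hs := sum_rpow_le_of_le_sqrt_mul_sqrt (α := Fin 2) hr0.le (T := 2)
      (a := ![rs q (a₁ * a₁ᴴ), rs q (a₂ * a₂ᴴ)]) (b := ![rs q (b₁ᴴ * b₁), rs q (b₂ᴴ * b₂)])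
      (v := ![√(rs q (a₁ * a₁ᴴ)) * √(rs q (b₁ᴴ * b₁)), √(rs q (a₂ * a₂ᴴ)) * √(rs q (b₂ᴴ * b₂))])
      (fun k => by fin_cases k <;> simp <;> positivity)
      (fun k => by fin_cases k <;> simp [rs_nonneg h1])
      (fun k => by fin_cases k <;> simp [rs_nonneg h1])
      (fun k => by fin_cases k <;> simp)
      (by simpa [Fin.sum_univ_two] using ha) (by simpa [Fin.sum_univ_two] using hb)
    simp only [Fin.sum_univ_two, cons_val_zero, cons_val_one] at hs
    have hb1 := (coeffSchattenGauge_sandwich_le h1 a₁ b₁ g₁).trans (mul_le_mul_right hg₁ _)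
    have hb2 := (coeffSchattenGauge_sandwich_le h1 a₂ b₂ g₂).trans (mul_le_mul_right hg₂ _)
    have h3 : 2 * coeffSchattenGauge d E S q n (sandwich c₁ g₁ d₁ + sandwich c₂ g₂ d₂) ^ q.toReal ≤
        2 * K ^ q.toReal := by
      refine key.trans ((add_le_add (ENNReal.rpow_le_rpow hb1 hr0.le)
        (ENNReal.rpow_le_rpow hb2 hr0.le)).trans ?_)
      rw [ENNReal.mul_rpow_of_nonneg _ _ hr0.le, ENNReal.mul_rpow_of_nonneg _ _ hr0.le, ← add_mul,
        ENNReal.ofReal_rpow_of_nonneg (by positivity) hr0.le,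
        ENNReal.ofReal_rpow_of_nonneg (by positivity) hr0.le,
        ← ENNReal.ofReal_add (by positivity) (by positivity)]
      gcongr
      rw [← ENNReal.ofReal_ofNat 2]
      exact ENNReal.ofReal_le_ofReal hs
    exact (ENNReal.mul_le_mul_iff_right two_ne_zero (by simp)).1 h3

/-- Matrix convexity of the unit ball. If a is in the unit ball of S^{2q} and v₁v₁* + v₂v₂* ≤ 1,
then the row (a v₁, a v₂) is again in the unit ball, and similarly for columns, so the preceding
lemma applies to every test pair. -/
theorem coeffGauge_rowcol_le {q : ℝ≥0∞} (h1 : 1 ≤ q) {n : ℕ} {K : ℝ≥0∞}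
    {v₁ v₂ w₁ w₂ : Matrix (Fin n) (Fin n) ℂ} (hv : opNorm (fromCols v₁ v₂) ≤ 1)
    (hw : opNorm (fromRows w₁ w₂) ≤ 1)
    {g₁ g₂ : Matrix (Fin n) (Fin n) (CoeffSpace d E S)}
    (hg₁ : coeffGauge d E S q n g₁ ≤ K) (hg₂ : coeffGauge d E S q n g₂ ≤ K) :
    coeffGauge d E S q n (sandwich v₁ g₁ w₁ + sandwich v₂ g₂ w₂) ≤ K := by
  refine matrixGauge_le fun a b ha hb => ?_
  rw [sandwich_add, sandwich_sandwich, sandwich_sandwich]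
  rw [schattenNorm_two_mul' h1, sqrt_le_one_iff] at ha
  rw [schattenNorm_two_mul h1, sqrt_le_one_iff] at hb
  refine coeffSchattenGauge_rowcol_le h1 ?_ ?_ hg₁ hg₂
  · refine le_trans (rs_mono h1 ?_ ?_) ha
    · exact (posSemidef_self_mul_conjTranspose _).add (posSemidef_self_mul_conjTranspose _)
    · have := posSemidef_one_sub_of_opNorm_le_one (a := (fromCols v₁ v₂)ᴴ)
        (by rwa [opNorm_conjTranspose])
      rw [conjTranspose_conjTranspose, fromCols_mul_conjTranspose] at this
      have h2 := this.mul_mul_conjTranspose_same a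
      convert h2 using 1
      simp only [conjTranspose_mul, Matrix.mul_sub, Matrix.sub_mul, Matrix.mul_add, Matrix.add_mul,
        Matrix.mul_one, Matrix.mul_assoc]
  · refine le_trans (rs_mono h1 ?_ ?_) hb
    · exact (posSemidef_conjTranspose_mul_self _).add (posSemidef_conjTranspose_mul_self _)
    · have := posSemidef_one_sub_of_opNorm_le_one hw
      rw [conjTranspose_mul_fromRows] at this
      have h2 := this.conjTranspose_mul_mul_same b
      convert h2 using 1
      simp only [conjTranspose_mul, Matrix.mul_sub, Matrix.sub_mul, Matrix.mul_add, Matrix.add_mul,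
        Matrix.mul_one, Matrix.mul_assoc]

/-- Left multiplication by a family of scalar matrices. -/
def lmul (u : ∀ σ : S, Matrix (Fin (d σ)) (Fin (d σ)) ℂ) (A : CoeffSpace d E S) :
    CoeffSpace d E S := fun σ => sandwich (u σ) (A σ) 1

theorem blk_map_lmul (u : ∀ σ : S, Matrix (Fin (d σ)) (Fin (d σ)) ℂ)
    (A : Matrix ι ι (CoeffSpace d E S)) (σ : S) [DecidableEq ι] :
    blk (A.map (lmul u)) σ =
      sandwich (kroneckerMap (· * ·) (1 : Matrix ι ι ℂ) (u σ)) (blk A σ) 1 := by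
  ext x y
  simp only [blk, of_apply, map_apply, lmul, sandwich_apply, Fintype.sum_prod_type,
    kroneckerMap_apply, one_apply, Prod.ext_iff]
  rw [Finset.sum_eq_single x.1 (fun k _ hk => by simp [hk.symm]) (by simp)]
  refine Finset.sum_congr rfl fun r _ => ?_
  rw [Finset.sum_eq_single y.1 (fun k _ hk => by simp [hk]) (by simp)]
  simp

theorem sandwich_map_lmul (u : ∀ σ : S, Matrix (Fin (d σ)) (Fin (d σ)) ℂ) (a b : Matrix ι ι ℂ)
    (A : Matrix ι ι (CoeffSpace d E S)) :
    sandwich a (A.map (lmul u)) b = (sandwich a A b).map (lmul u) := by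
  classical
  have key : ∀ σ, blk (sandwich a (A.map (lmul u)) b) σ =
      blk ((sandwich a A b).map (lmul u)) σ := by
    intro σ
    rw [blk_sandwich, blk_map_lmul, blk_map_lmul, blk_sandwich, sandwich_sandwich,
      sandwich_sandwich, amp, amp, ← mul_kronecker_mul, ← mul_kronecker_mul]
    simp
  ext i j σ x y
  exact congrFun (congrFun (key σ) (i, x)) (j, y)

theorem coeffGauge_map_lmul_le {q : ℝ≥0∞} (h1 : 1 ≤ q) {n : ℕ}
    {u : ∀ σ : S, Matrix (Fin (d σ)) (Fin (d σ)) ℂ} (hu : ∀ σ, (u σ)ᴴ * u σ = 1)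
    (A : Matrix (Fin n) (Fin n) (CoeffSpace d E S)) :
    coeffGauge d E S q n (A.map (lmul u)) ≤ coeffGauge d E S q n A := by
  refine matrixGauge_le fun a b ha hb => ?_
  rw [sandwich_map_lmul]
  refine le_trans (coeffSchattenGauge_le_of_forall h1 fun σ => ?_)
    (le_matrixGauge (coeffSchattenGauge d E S q) ha hb A)
  rw [blk_map_lmul]
  refine vsn_contraction_le h1 (opNorm_le_one_of_isometry ?_) opNorm_one_le _
  rw [conjTranspose_kronecker, ← mul_kronecker_mul, hu, conjTranspose_one, Matrix.one_mul,
    one_kronecker_one]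

end coeff

end

/-! ### Minimax for factorizations: positivity and states -/

section

variable {ι κ : Type*} [Fintype ι] [Fintype κ]
variable {E : Type*} [NormedAddCommGroup E] [NormedSpace ℂ E] [OperatorSpace E]

theorem posSemidef_smul_one_add_of_opNorm_le [DecidableEq ι] {D : Matrix ι ι ℂ}
    (hD : D.IsHermitian) {δ : ℝ} (hδ : 0 < δ) (h : opNorm D ≤ δ) :
    ((δ : ℂ) • (1 : Matrix ι ι ℂ) + D).PosSemidef := by
  have h1 := posSemidef_opNorm_sq_sub D h
  have h2 := posSemidef_conjTranspose_mul_self ((δ : ℂ) • (1 : Matrix ι ι ℂ) + D)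
  have hc : (0 : ℂ) ≤ (((2 * δ)⁻¹ : ℝ) : ℂ) := by
    rw [Complex.zero_le_real]; positivity
  -- For Hermitian D, (δ² − D²) + (δ + D)² = 2δ(δ + D).
  have h3 := (h1.add h2).smul hc
  convert h3 using 1
  rw [conjTranspose_add, conjTranspose_smul, conjTranspose_one, hD.eq]
  have hne : (δ : ℂ) ≠ 0 := by exact_mod_cast hδ.ne'
  simp only [Complex.star_def, Complex.conj_ofReal, Matrix.add_mul, Matrix.mul_add,
    Matrix.smul_mul, Matrix.mul_smul, Matrix.one_mul, Matrix.mul_one]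
  ext i j
  simp only [Matrix.add_apply, Matrix.smul_apply, Matrix.sub_apply, smul_eq_mul]
  push_cast
  field_simp
  ring

/-- A real-linear functional is determined by its values on the units E_ij and iE_ij; these are
packed into one complex entry as real and minus imaginary part. -/
theorem exists_re_trace_eq {n : ℕ} (f : Matrix (Fin n) (Fin n) ℂ →ₗ[ℝ] ℝ) :
    ∃ P : Matrix (Fin n) (Fin n) ℂ, ∀ X, f X = (P * X).trace.re := by
  refine ⟨of fun j i => (f (single i j 1) : ℂ) - Complex.I * f (single i j Complex.I), fun X => ?_⟩
  have hX : X = ∑ i, ∑ j, ((X i j).re • single i j (1 : ℂ) + (X i j).im • single i j Complex.I) := by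
    conv_lhs => rw [matrix_eq_sum_single X]
    refine Finset.sum_congr rfl fun i _ => Finset.sum_congr rfl fun j _ => ?_
    rw [smul_single, smul_single, ← single_add]
    congr 1
    simp [Complex.re_add_im]
  conv_lhs => rw [hX]
  simp only [map_sum, map_add, map_smul, trace, diag, mul_apply, of_apply, Complex.re_sum]
  rw [Finset.sum_comm]
  refine Finset.sum_congr rfl fun i _ => Finset.sum_congr rfl fun j _ => ?_
  simp [Complex.mul_re, Complex.sub_re, Complex.sub_im]
  ring

/-- The Hermitian part of a matrix. -/
def hermPart (P : Matrix ι ι ℂ) : Matrix ι ι ℂ := (2⁻¹ : ℂ) • (P + Pᴴ)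

theorem hermPart_isHermitian (P : Matrix ι ι ℂ) : (hermPart P).IsHermitian := by
  rw [Matrix.IsHermitian, hermPart, conjTranspose_smul, conjTranspose_add,
    conjTranspose_conjTranspose, add_comm]
  simp

theorem re_trace_hermPart_mul (P : Matrix ι ι ℂ) {X : Matrix ι ι ℂ} (hX : X.IsHermitian) :
    (hermPart P * X).trace.re = (P * X).trace.re := by
  have : (Pᴴ * X).trace = star (P * X).trace := by
    rw [← trace_conjTranspose, conjTranspose_mul, hX.eq, trace_mul_comm]
  rw [hermPart, Matrix.smul_mul, Matrix.add_mul, trace_smul, trace_add, this]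
  simp
  ring

theorem hermPart_posSemidef {P : Matrix ι ι ℂ}
    (h : ∀ X : Matrix ι ι ℂ, X.PosSemidef → 0 ≤ (P * X).trace.re) : (hermPart P).PosSemidef := by
  refine PosSemidef.of_dotProduct_mulVec_nonneg (hermPart_isHermitian P) fun x => ?_
  have hX : (vecMulVec x (star x)).PosSemidef := posSemidef_vecMulVec_self_star x
  have h2 := h _ hX
  rw [← re_trace_hermPart_mul P hX.isHermitian] at h2
  have e : star x ⬝ᵥ hermPart P *ᵥ x = (hermPart P * vecMulVec x (star x)).trace := by
    rw [mul_vecMulVec, trace_vecMulVec, dotProduct_comm]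
  rw [e]
  have him : (hermPart P * vecMulVec x (star x)).trace.im = 0 := by
    rw [← e]
    exact (hermPart_isHermitian P).im_star_dotProduct_mulVec_self x
  exact Complex.le_def.2 ⟨h2, him.symm⟩

theorem nonneg_of_forall_lt_add_mul {a B r : ℝ} (h : ∀ c : ℝ, 0 ≤ c → r < B + c * a) : 0 ≤ a := by
  by_contra! ha
  have h0 := h 0 le_rfl
  have h2 := h ((B - r) / (-a)) (div_nonneg (by linarith) (by linarith))
  have : (B - r) / (-a) * a = -(B - r) := by rw [div_neg, neg_mul, div_mul_cancel₀ _ ha.ne]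
  linarith

theorem eq_zero_of_re_trace_le_zero {P : Matrix ι ι ℂ} (hP : P.PosSemidef)
    (h : P.trace.re ≤ 0) : P = 0 := by
  have h1 := Complex.le_def.1 hP.trace_nonneg
  refine hP.trace_eq_zero_iff.1 (Complex.ext (le_antisymm h h1.1) h1.2.symm)

theorem posDef_inv_smul_one {n : ℕ} (hn : n ≠ 0) :
    ((((n : ℝ)⁻¹ : ℝ) : ℂ) • (1 : Matrix (Fin n) (Fin n) ℂ)).PosDef := by
  refine PosDef.one.smul ?_
  have : (0 : ℝ) < (n : ℝ)⁻¹ := by positivity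
  exact_mod_cast this

theorem trace_inv_smul_one {n : ℕ} (hn : n ≠ 0) :
    ((((n : ℝ)⁻¹ : ℝ) : ℂ) • (1 : Matrix (Fin n) (Fin n) ℂ)).trace.re = 1 := by
  have : (n : ℝ) ≠ 0 := by exact_mod_cast hn
  rw [trace_smul, smul_eq_mul, Complex.re_ofReal_mul, trace_one]
  simp [this]

/-- Regularization of a positive matrix to a faithful state. -/
def regState {n : ℕ} (ε : ℝ) (P : Matrix (Fin n) (Fin n) ℂ) : Matrix (Fin n) (Fin n) ℂ :=
  (((P.trace.re + n * ε)⁻¹ : ℝ) : ℂ) • (P + (ε : ℂ) • 1)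

section regState

variable {n : ℕ} {P : Matrix (Fin n) (Fin n) ℂ} {ε : ℝ}

theorem regState_pos (hP : P.PosSemidef) (hε : 0 < ε) (hn : n ≠ 0) : 0 < P.trace.re + n * ε := by
  have h1 := (Complex.le_def.1 hP.trace_nonneg).1
  have hn0 : (0 : ℝ) < n := by exact_mod_cast Nat.pos_of_ne_zero hn
  rw [Complex.zero_re] at h1
  positivity

theorem posDef_regState (hP : P.PosSemidef) (hε : 0 < ε) (hn : n ≠ 0) :
    (regState ε P).PosDef := by
  have h0 : (0 : ℂ) < ((P.trace.re + n * ε)⁻¹ : ℝ) := by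
    exact_mod_cast inv_pos.2 (regState_pos hP hε hn)
  have h1 : (0 : ℂ) < (ε : ℂ) := by exact_mod_cast hε
  exact (PosDef.posSemidef_add hP (PosDef.one.smul h1)).smul h0

theorem trace_regState (hP : P.PosSemidef) (hε : 0 < ε) (hn : n ≠ 0) :
    (regState ε P).trace.re = 1 := by
  have h0 := (regState_pos hP hε hn).ne'
  rw [regState, trace_smul, smul_eq_mul, Complex.re_ofReal_mul, trace_add, trace_smul, trace_one]
  simp only [Complex.add_re, smul_eq_mul, Complex.re_ofReal_mul, Fintype.card_fin,
    Complex.natCast_re]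
  rw [mul_comm ε]
  exact inv_mul_cancel₀ h0

theorem re_trace_mul_le_of_regState (hP : P.PosSemidef) (hε : 0 < ε) (hn : n ≠ 0)
    {X : Matrix (Fin n) (Fin n) ℂ} (hX : X.PosSemidef) {t : ℝ}
    (h : (regState ε P * X).trace.re ≤ t) : (P * X).trace.re ≤ t * (P.trace.re + n * ε) := by
  have h0 := regState_pos hP hε hn
  have hX0 := (Complex.le_def.1 hX.trace_nonneg).1
  rw [Complex.zero_re] at hX0
  rw [regState, Matrix.smul_mul, trace_smul, smul_eq_mul, Complex.re_ofReal_mul, Matrix.add_mul,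
    trace_add, Complex.add_re, Matrix.smul_mul, trace_smul, smul_eq_mul, Complex.re_ofReal_mul,
    Matrix.one_mul, inv_mul_le_iff₀ h0] at h
  nlinarith [mul_nonneg hε.le hX0]

end regState

/-- From X = (t + δ)1 − D and ‖D‖ ≤ δ it follows that H ≤ X ≤ (t + 2δ)1. The equation itself forces
the perturbation D to be Hermitian. -/
theorem posSemidef_of_near [DecidableEq ι] {t δ : ℝ} (hδ : 0 < δ) {X D H : Matrix ι ι ℂ}
    (hD : opNorm D ≤ δ) (hX : (X - H).PosSemidef) (hXD : X + D = ((t + δ : ℝ) : ℂ) • 1)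
    (hH : H.IsHermitian) : (((t + 2 * δ : ℝ) : ℂ) • (1 : Matrix ι ι ℂ) - H).PosSemidef := by
  have hDe : D = ((t + δ : ℝ) : ℂ) • 1 - ((X - H) + H) := by
    rw [sub_add_cancel, ← hXD, add_sub_cancel_left]
  have h1 : (((t + δ : ℝ) : ℂ) • (1 : Matrix ι ι ℂ)).IsHermitian := by
    rw [Matrix.IsHermitian, conjTranspose_smul, conjTranspose_one, Complex.star_def,
      Complex.conj_ofReal]
  have hDh : D.IsHermitian := hDe ▸ h1.sub (hX.isHermitian.add hH)
  have := hX.add (posSemidef_smul_one_add_of_opNorm_le hDh hδ hD)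
  convert this using 1
  have hXe : X = ((t + δ : ℝ) : ℂ) • 1 - D := by rw [← hXD, add_sub_cancel_right]
  rw [hXe]
  ext i j
  simp
  ring

/-! ### The Hahn–Banach minimax argument -/

section minimax

variable {I : Type*} {d : I → ℕ} {S : Finset I}

/-- The pairs of positive matrices dominating `(α α*, β* β)` for a factorization `A = α g β`
with `g` in the ball of radius `K`. -/
def factorDom (q : ℝ≥0∞) (K : ℝ≥0∞) {n : ℕ} (A : Matrix (Fin n) (Fin n) (CoeffSpace d E S)) :
    Set (Matrix (Fin n) (Fin n) ℂ × Matrix (Fin n) (Fin n) ℂ) :=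
  {Z | ∃ α g β, A = sandwich α g β ∧ coeffGauge d E S q n g ≤ K ∧
    (Z.1 - α * αᴴ).PosSemidef ∧ (Z.2 - βᴴ * β).PosSemidef}

/-- A convex combination of two factorizations of A is row · block diagonal · column. In the polar
decompositions of row and column the positive parts have squares s α₁α₁* + t α₂α₂* and s β₁*β₁ + t
β₂*β₂, and the contractions are absorbed into the middle by matrix convexity. -/
theorem convex_factorDom {q : ℝ≥0∞} (h1 : 1 ≤ q) (K : ℝ≥0∞) {n : ℕ}
    (A : Matrix (Fin n) (Fin n) (CoeffSpace d E S)) : Convex ℝ (factorDom q K A) := by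
  rintro ⟨X₁, Y₁⟩ ⟨α₁, g₁, β₁, hA₁, hg₁, hX₁, hY₁⟩ ⟨X₂, Y₂⟩ ⟨α₂, g₂, β₂, hA₂, hg₂, hX₂, hY₂⟩
    s t hs ht hst
  obtain ⟨v, hv, hv1⟩ := exists_polar (fromCols ((√s : ℂ) • α₁) ((√t : ℂ) • α₂))
  obtain ⟨w, hw, hw1⟩ := exists_polar (fromRows ((√s : ℂ) • β₁) ((√t : ℂ) • β₂))ᴴ
  have hs2 : (√s : ℂ) * √s = s := by rw [← Complex.ofReal_mul, Real.mul_self_sqrt hs]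
  have ht2 : (√t : ℂ) * √t = t := by rw [← Complex.ofReal_mul, Real.mul_self_sqrt ht]
  have hpα := posSemidef_self_mul_conjTranspose (fromCols ((√s : ℂ) • α₁) ((√t : ℂ) • α₂))
  have hpβ := posSemidef_conjTranspose_mul_self (fromRows ((√s : ℂ) • β₁) ((√t : ℂ) • β₂))
  rw [conjTranspose_conjTranspose] at hw
  have eα : fromCols ((√s : ℂ) • α₁) ((√t : ℂ) • α₂) * (fromCols ((√s : ℂ) • α₁) ((√t : ℂ) • α₂))ᴴ
      = (s : ℂ) • (α₁ * α₁ᴴ) + (t : ℂ) • (α₂ * α₂ᴴ) := by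
    rw [fromCols_mul_conjTranspose]
    simp only [conjTranspose_smul, Matrix.smul_mul, Matrix.mul_smul, smul_smul, Complex.star_def,
      Complex.conj_ofReal, hs2, ht2]
  have eβ : (fromRows ((√s : ℂ) • β₁) ((√t : ℂ) • β₂))ᴴ * fromRows ((√s : ℂ) • β₁) ((√t : ℂ) • β₂)
      = (s : ℂ) • (β₁ᴴ * β₁) + (t : ℂ) • (β₂ᴴ * β₂) := by
    rw [conjTranspose_mul_fromRows]
    simp only [conjTranspose_smul, Matrix.smul_mul, Matrix.mul_smul, smul_smul, Complex.star_def,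
      Complex.conj_ofReal, hs2, ht2]
  rw [eα] at hv hpα
  rw [eβ] at hw hpβ
  have hα := mfun_sqrt_mul_self hpα
  have hβ := mfun_sqrt_mul_self hpβ
  have hαh := mfun_isHermitian ((s : ℂ) • (α₁ * α₁ᴴ) + (t : ℂ) • (α₂ * α₂ᴴ)) Real.sqrt
  have hβh := mfun_isHermitian ((s : ℂ) • (β₁ᴴ * β₁) + (t : ℂ) • (β₂ᴴ * β₂)) Real.sqrt
  generalize mfun ((s : ℂ) • (α₁ * α₁ᴴ) + (t : ℂ) • (α₂ * α₂ᴴ)) Real.sqrt = α at *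
  generalize mfun ((s : ℂ) • (β₁ᴴ * β₁) + (t : ℂ) • (β₂ᴴ * β₂)) Real.sqrt = β at *
  have hw' : fromRows ((√s : ℂ) • β₁) ((√t : ℂ) • β₂) = wᴴ * β := by
    have := congrArg conjTranspose hw
    rwa [conjTranspose_conjTranspose, conjTranspose_mul, hβh.eq] at this
  rw [← opNorm_conjTranspose] at hw1
  generalize wᴴ = w' at *
  rw [← fromCols_toCols v] at hv hv1
  rw [← fromRows_toRows w'] at hw' hw1
  generalize v.toCols₁ = v₁ at *
  generalize v.toCols₂ = v₂ at *
  generalize w'.toRows₁ = w₁ at *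
  generalize w'.toRows₂ = w₂ at *
  rw [mul_fromCols] at hv
  have hv := fromCols_inj hv
  rw [fromRows_mul] at hw'
  have hw' := fromRows_inj hw'
  have hsc : (0 : ℂ) ≤ s := by rwa [Complex.zero_le_real]
  have htc : (0 : ℂ) ≤ t := by rwa [Complex.zero_le_real]
  refine ⟨α, sandwich v₁ g₁ w₁ + sandwich v₂ g₂ w₂, β, ?_, coeffGauge_rowcol_le h1 hv1 hw1 hg₁ hg₂,
    ?_, ?_⟩
  · rw [sandwich_add, sandwich_sandwich, sandwich_sandwich, ← hv.1, ← hv.2, ← hw'.1, ← hw'.2,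
      sandwich_smul_left, sandwich_smul_right, sandwich_smul_left, sandwich_smul_right, smul_smul,
      smul_smul, hs2, ht2, ← hA₁, ← hA₂, ← add_smul, ← Complex.ofReal_add, hst, Complex.ofReal_one,
      one_smul]
  · have := (hX₁.smul hsc).add (hX₂.smul htc)
    rw [hαh.eq, hα]
    convert this using 1
    ext i j
    simp
    ring
  · have := (hY₁.smul hsc).add (hY₂.smul htc)
    rw [hβh.eq, hβ]
    convert this using 1
    ext i j
    simp
    ring

theorem coeffGauge_sandwich_le {q : ℝ≥0∞} (h1 : 1 ≤ q) {n : ℕ} {K : ℝ≥0∞} {t : ℝ} (ht : 0 ≤ t)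
    {α β : Matrix (Fin n) (Fin n) ℂ} {g : Matrix (Fin n) (Fin n) (CoeffSpace d E S)}
    (hg : coeffGauge d E S q n g ≤ K)
    (hα : ((t : ℂ) • (1 : Matrix (Fin n) (Fin n) ℂ) - α * αᴴ).PosSemidef)
    (hβ : ((t : ℂ) • (1 : Matrix (Fin n) (Fin n) ℂ) - βᴴ * β).PosSemidef) :
    coeffGauge d E S q n (sandwich α g β) ≤ ENNReal.ofReal t * K := by
  refine matrixGauge_le fun a b ha hb => ?_
  rw [schattenNorm_two_mul' h1, sqrt_le_one_iff] at ha
  rw [schattenNorm_two_mul h1, sqrt_le_one_iff] at hb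
  rw [sandwich_sandwich]
  refine (coeffSchattenGauge_sandwich_le h1 _ _ g).trans ?_
  gcongr
  have h2 : rs q (a * α * (a * α)ᴴ) ≤ t := by
    refine (rs_mono h1 (H := (t : ℂ) • (a * aᴴ)) (posSemidef_self_mul_conjTranspose _) ?_).trans ?_
    · convert hα.mul_mul_conjTranspose_same a using 1
      simp only [conjTranspose_mul, Matrix.mul_sub, Matrix.sub_mul, Matrix.mul_smul,
        Matrix.smul_mul, Matrix.mul_one, Matrix.mul_assoc]
    · rw [rs_smul h1 (posSemidef_self_mul_conjTranspose _) ht]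
      exact mul_le_of_le_one_right ht ha
  have h3 : rs q ((β * b)ᴴ * (β * b)) ≤ t := by
    refine (rs_mono h1 (H := (t : ℂ) • (bᴴ * b)) (posSemidef_conjTranspose_mul_self _) ?_).trans ?_
    · convert hβ.conjTranspose_mul_mul_same b using 1
      simp only [conjTranspose_mul, Matrix.mul_sub, Matrix.sub_mul, Matrix.mul_smul,
        Matrix.smul_mul, Matrix.mul_one, Matrix.mul_assoc]
    · rw [rs_smul h1 (posSemidef_conjTranspose_mul_self _) ht]
      exact mul_le_of_le_one_right ht hb
  calc _ ≤ √t * √t := by gcongr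
    _ = t := Real.mul_self_sqrt ht

-- If the point is missed, a functional separates it from the convex set; adding a ball makes the
-- set open, so closedness of `factorDom` is not an issue. The functional is given by a pair of
-- matrices whose Hermitian parts are positive, and normalizing these to faithful states contradicts
-- the hypothesis because t < t'.
open scoped Matrix.Norms.L2Operator Pointwise in
theorem exists_factorDom_near {q : ℝ≥0∞} (h1 : 1 ≤ q) {K : ℝ≥0∞} {n : ℕ} (hn : n ≠ 0)
    (A : Matrix (Fin n) (Fin n) (CoeffSpace d E S)) {t t' δ : ℝ} (ht0 : 0 ≤ t) (ht : t < t')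
    (hδ : 0 < δ)
    (h : ∀ P Q : Matrix (Fin n) (Fin n) ℂ, P.PosDef → Q.PosDef → P.trace.re = 1 →
      Q.trace.re = 1 → ∃ α g β, A = sandwich α g β ∧ coeffGauge d E S q n g ≤ K ∧
        (P * (α * αᴴ)).trace.re ≤ t ∧ (Q * (βᴴ * β)).trace.re ≤ t) :
    ((t' : ℂ) • 1, (t' : ℂ) • 1) ∈ factorDom q K A + Metric.ball 0 δ := by
  have : NeZero n := ⟨hn⟩
  by_contra hcon
  have hconv : Convex ℝ (factorDom q K A + Metric.ball 0 δ) :=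
    (convex_factorDom h1 K A).add (convex_ball _ _)
  have hopen : IsOpen (factorDom q K A + Metric.ball 0 δ) := Metric.isOpen_ball.add_left
  obtain ⟨f, hf⟩ := geometric_hahn_banach_open_point hconv hopen hcon
  obtain ⟨P', hP'⟩ := exists_re_trace_eq (-(f.toLinearMap.comp (LinearMap.inl ℝ _ _)))
  obtain ⟨Q', hQ'⟩ := exists_re_trace_eq (-(f.toLinearMap.comp (LinearMap.inr ℝ _ _)))
  have hf' : ∀ X Y, f (X, Y) = -((P' * X).trace.re + (Q' * Y).trace.re) := by
    intro X Y
    have e : ((X, Y) : Matrix (Fin n) (Fin n) ℂ × Matrix (Fin n) (Fin n) ℂ) = (X, 0) + (0, Y) := by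
      simp
    rw [e, map_add, ← hP', ← hQ']
    simp [add_comm]
  have hlt : ∀ X Y, (X, Y) ∈ factorDom q K A → t' * (P'.trace.re + Q'.trace.re) <
      (P' * X).trace.re + (Q' * Y).trace.re := by
    intro X Y hXY
    have h2 := hf (X, Y) ⟨(X, Y), hXY, 0, Metric.mem_ball_self hδ, by simp⟩
    rw [hf', hf', neg_lt_neg_iff, Matrix.mul_smul, Matrix.mul_smul, Matrix.mul_one, Matrix.mul_one,
      trace_smul, trace_smul, smul_eq_mul, smul_eq_mul, Complex.re_ofReal_mul,
      Complex.re_ofReal_mul, ← mul_add] at h2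
    exact h2
  obtain ⟨α, g, β, hA, hg, -, -⟩ := h _ _ (posDef_inv_smul_one hn) (posDef_inv_smul_one hn)
    (trace_inv_smul_one hn) (trace_inv_smul_one hn)
  -- Adding any c X with X ≥ 0 stays inside `factorDom`, and the separating inequality for all c ≥ 0
  -- forces tr(P'X) to have nonnegative real part.
  have hP : (hermPart P').PosSemidef := hermPart_posSemidef fun X hX =>
    nonneg_of_forall_lt_add_mul (r := t' * (P'.trace.re + Q'.trace.re))
      (B := (P' * (α * αᴴ)).trace.re + (Q' * (βᴴ * β)).trace.re)
      fun c hc => by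
        have hc' : (0 : ℂ) ≤ c := by rwa [Complex.zero_le_real]
        have := hlt (α * αᴴ + (c : ℂ) • X) (βᴴ * β) ⟨α, g, β, hA, hg,
          by simpa using hX.smul hc', by simpa using PosSemidef.zero⟩
        rw [Matrix.mul_add, trace_add, Complex.add_re, Matrix.mul_smul, trace_smul, smul_eq_mul,
          Complex.re_ofReal_mul] at this
        linarith
  have hQ : (hermPart Q').PosSemidef := hermPart_posSemidef fun X hX =>
    nonneg_of_forall_lt_add_mul (r := t' * (P'.trace.re + Q'.trace.re))
      (B := (P' * (α * αᴴ)).trace.re + (Q' * (βᴴ * β)).trace.re)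
      fun c hc => by
        have hc' : (0 : ℂ) ≤ c := by rwa [Complex.zero_le_real]
        have := hlt (α * αᴴ) (βᴴ * β + (c : ℂ) • X) ⟨α, g, β, hA, hg,
          by simpa using PosSemidef.zero, by simpa using hX.smul hc'⟩
        rw [Matrix.mul_add, trace_add, Complex.add_re, Matrix.mul_smul, trace_smul, smul_eq_mul,
          Complex.re_ofReal_mul] at this
        linarith
  have hPt : (hermPart P').trace.re = P'.trace.re := by
    simpa using re_trace_hermPart_mul P' isHermitian_one
  have hQt : (hermPart Q').trace.re = Q'.trace.re := by
    simpa using re_trace_hermPart_mul Q' isHermitian_one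
  have hlt' : ∀ α g β, A = sandwich α g β → coeffGauge d E S q n g ≤ K →
      t' * ((hermPart P').trace.re + (hermPart Q').trace.re) <
      (hermPart P' * (α * αᴴ)).trace.re + (hermPart Q' * (βᴴ * β)).trace.re := by
    intro α g β hA hg
    rw [hPt, hQt, re_trace_hermPart_mul _ (isHermitian_mul_conjTranspose_self α),
      re_trace_hermPart_mul _ (isHermitian_conjTranspose_mul_self β)]
    exact hlt _ _ ⟨α, g, β, hA, hg, by simpa using PosSemidef.zero, by simpa using PosSemidef.zero⟩
  clear hlt hf' hf hPt hQt
  generalize hermPart P' = P at *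
  generalize hermPart Q' = Q at *
  have hP0 := (Complex.le_def.1 hP.trace_nonneg).1
  have hQ0 := (Complex.le_def.1 hQ.trace_nonneg).1
  rw [Complex.zero_re] at hP0 hQ0
  rcases (add_nonneg hP0 hQ0).eq_or_lt with h0 | h0
  · have hPz : P = 0 := eq_zero_of_re_trace_le_zero hP (by linarith)
    have hQz : Q = 0 := eq_zero_of_re_trace_le_zero hQ (by linarith)
    have := hlt' α g β hA hg
    rw [hPz, hQz] at this
    simp at this
  · have hn0 : (0 : ℝ) < n := by exact_mod_cast Nat.pos_of_ne_zero hn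
    -- Regularization adds at most 2ntε to the bound t(tr P + tr Q). This ε makes the addition
    -- smaller than the gap (t' − t)(tr P + tr Q); the `+ 1` covers t = 0.
    set ε := (t' - t) * (P.trace.re + Q.trace.re) / (2 * n * t + 1) with hε
    have hε0 : 0 < ε := div_pos (mul_pos (sub_pos.2 ht) h0) (by positivity)
    have hε1 : ε * (2 * n * t + 1) = (t' - t) * (P.trace.re + Q.trace.re) := by
      rw [hε]; field_simp
    obtain ⟨α, g, β, hA, hg, hα, hβ⟩ := h _ _ (posDef_regState hP hε0 hn)
      (posDef_regState hQ hε0 hn) (trace_regState hP hε0 hn) (trace_regState hQ hε0 hn)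
    have h3 := hlt' α g β hA hg
    have h4 := re_trace_mul_le_of_regState hP hε0 hn (posSemidef_self_mul_conjTranspose α) hα
    have h5 := re_trace_mul_le_of_regState hQ hε0 hn (posSemidef_conjTranspose_mul_self β) hβ
    nlinarith

open scoped Matrix.Norms.L2Operator in
/-- A minimax principle: a factorization that is good on average for all pairs of states yields
a factorization that is good uniformly. -/
theorem coeffGauge_le_of_forall_posDef {q : ℝ≥0∞} (h1 : 1 ≤ q) {K : ℝ≥0∞} (hK : K ≠ ∞) {n : ℕ}
    (A : Matrix (Fin n) (Fin n) (CoeffSpace d E S)) {t : ℝ} (ht0 : 0 ≤ t)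
    (h : ∀ P Q : Matrix (Fin n) (Fin n) ℂ, P.PosDef → Q.PosDef → P.trace.re = 1 →
      Q.trace.re = 1 → ∃ α g β, A = sandwich α g β ∧ coeffGauge d E S q n g ≤ K ∧
        (P * (α * αᴴ)).trace.re ≤ t ∧ (Q * (βᴴ * β)).trace.re ≤ t) :
    coeffGauge d E S q n A ≤ ENNReal.ofReal t * K := by
  -- For n = 0 there is no matrix of trace 1, so the hypothesis is void, but the only element is 0.
  rcases eq_or_ne n 0 with rfl | hn
  · rw [Subsingleton.elim A 0]
    refine (matrixGauge_le fun a b _ _ => ?_ : _ ≤ (0 : ℝ≥0∞)).trans zero_le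
    rw [sandwich_zero_mid, coeffSchattenGauge_zero h1]
  have key : ∀ δ : ℝ, 0 < δ → coeffGauge d E S q n A ≤ ENNReal.ofReal (t + 2 * δ) * K := by
    intro δ hδ
    obtain ⟨⟨X, Y⟩, ⟨α, g, β, hA, hg, hX, hY⟩, ⟨D, D'⟩, hD, hXY⟩ :=
      exists_factorDom_near h1 hn A ht0 (lt_add_of_pos_right t hδ) hδ h
    rw [mem_ball_zero_iff, Prod.norm_def, max_lt_iff] at hD
    have hX' : X + D = ((t + δ : ℝ) : ℂ) • 1 := congrArg Prod.fst hXY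
    have hY' : Y + D' = ((t + δ : ℝ) : ℂ) • 1 := congrArg Prod.snd hXY
    rw [hA]
    refine coeffGauge_sandwich_le h1 (by positivity) hg
      (posSemidef_of_near hδ ?_ hX hX' (isHermitian_mul_conjTranspose_self α))
      (posSemidef_of_near hδ ?_ hY hY' (isHermitian_conjTranspose_mul_self β))
    · rw [opNorm_eq]; exact hD.1.le
    · rw [opNorm_eq]; exact hD.2.le
  have hlim : Filter.Tendsto (fun δ : ℝ => ENNReal.ofReal (t + 2 * δ) * K) (nhdsWithin 0 (Set.Ioi 0))
      (nhds (ENNReal.ofReal t * K)) := by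
    refine Filter.Tendsto.mono_left ?_ nhdsWithin_le_nhds
    have hc : Continuous fun δ : ℝ => ENNReal.ofReal (t + 2 * δ) * K :=
      (ENNReal.continuous_mul_const hK).comp (ENNReal.continuous_ofReal.comp (by fun_prop))
    simpa using hc.tendsto 0
  exact ge_of_tendsto hlim (Filter.eventually_of_mem self_mem_nhdsWithin key)

end minimax

end

/-! ### Continuity of seminorms and L^p-norms of simple functions -/

section

variable {ι κ : Type*} [Fintype ι] [Fintype κ]
variable {E : Type*} [NormedAddCommGroup E] [NormedSpace ℂ E] [OperatorSpace E]

section seminorm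

variable {α : Type*} [Fintype α]

theorem seminorm_pi_le [DecidableEq α] (N : Seminorm ℂ (α → ℂ)) (z : α → ℂ) :
    N z ≤ (∑ k, N (Pi.single k 1)) * ‖z‖ := by
  have hz : z = ∑ k, z k • (Pi.single k (1 : ℂ) : α → ℂ) := by
    ext j; simp [Finset.sum_apply, Pi.single_apply]
  calc N z = N (∑ k, z k • (Pi.single k (1 : ℂ) : α → ℂ)) := by rw [← hz]
    _ ≤ ∑ k, N (z k • (Pi.single k (1 : ℂ) : α → ℂ)) :=
        Finset.le_sum_of_subadditive N (map_zero N).le (map_add_le_add N) _ _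
    _ ≤ ∑ k, N (Pi.single k 1) * ‖z‖ := by
        refine Finset.sum_le_sum fun k _ => ?_
        rw [map_smul_eq_mul, mul_comm]
        gcongr
        exact norm_le_pi_norm z k
    _ = _ := by rw [Finset.sum_mul]

theorem continuous_seminorm_pi (N : Seminorm ℂ (α → ℂ)) : Continuous N := by
  classical
  have hC : 0 ≤ ∑ k, N (Pi.single k 1) := Finset.sum_nonneg fun k _ => apply_nonneg N _
  refine LipschitzWith.continuous (K := ⟨∑ k, N (Pi.single k 1), hC⟩)
    (LipschitzWith.of_dist_le_mul fun x y => ?_)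
  rw [Real.dist_eq, dist_eq_norm]
  exact (abs_sub_map_le_sub N x y).trans (seminorm_pi_le N _)

end seminorm

section simple

variable {Ω : Type*} [MeasurableSpace Ω] {μ : Measure Ω}

theorem eLpNorm_simpleFunc_le_iff [IsFiniteMeasure μ] {β : Type*} {p : ℝ≥0∞} (h1 : 1 ≤ p)
    (ht : p ≠ ∞) (G : SimpleFunc Ω β) (h : β → ℝ) (h0 : ∀ b, 0 ≤ h b) {T : ℝ} (hT : 0 ≤ T) :
    eLpNorm (fun ω => h (G ω)) p μ ≤ ENNReal.ofReal T ↔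
      ∑ b ∈ G.range, μ.real (G ⁻¹' {b}) * h b ^ p.toReal ≤ T ^ p.toReal := by
  have hr := one_le_toReal h1 ht
  have hr0 : 0 < p.toReal := by positivity
  have hp0 : p ≠ 0 := by rintro rfl; simp at h1
  rw [eLpNorm_eq_lintegral_rpow_enorm_toReal hp0 ht, one_div, ENNReal.rpow_inv_le_iff hr0]
  have e : ∫⁻ ω, ‖h (G ω)‖ₑ ^ p.toReal ∂μ =
      ENNReal.ofReal (∑ b ∈ G.range, μ.real (G ⁻¹' {b}) * h b ^ p.toReal) := by
    have : (fun ω => ‖h (G ω)‖ₑ ^ p.toReal) = G.map (fun b => ‖h b‖ₑ ^ p.toReal) := by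
      ext ω; simp
    rw [this, SimpleFunc.lintegral_eq_lintegral, SimpleFunc.map_lintegral,
      ENNReal.ofReal_sum_of_nonneg fun b _ =>
        mul_nonneg measureReal_nonneg (Real.rpow_nonneg (h0 b) _)]
    refine Finset.sum_congr rfl fun b _ => ?_
    rw [ENNReal.ofReal_mul measureReal_nonneg, ofReal_measureReal, mul_comm,
      Real.enorm_eq_ofReal (h0 b), ENNReal.ofReal_rpow_of_nonneg (h0 b) hr0.le]
  rw [e, ENNReal.ofReal_rpow_of_nonneg hT hr0.le,
    ENNReal.ofReal_le_ofReal_iff (Real.rpow_nonneg hT _)]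

end simple

/-! ### Weights normalizing a family in ℓ^p(S^p(E)) -/

section weights

theorem mfun_add_smul_one [DecidableEq ι] {W : Matrix ι ι ℂ} (hW : W.IsHermitian) (ε : ℝ)
    (f : ℝ → ℝ) : mfun (W + (ε : ℂ) • 1) f = mfun W (fun x => f (x + ε)) := by
  have d := IsDecomp.of_eigen hW
  have e : W + (ε : ℂ) • (1 : Matrix ι ι ℂ) = mfun W (fun x => x + ε) := by
    rw [d.mfun_eq]
    conv_lhs => rw [d.eq]
    have h1 : (1 : Matrix ι ι ℂ) = (hW.eigenvectorUnitary : Matrix ι ι ℂ) *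
        (hW.eigenvectorUnitary : Matrix ι ι ℂ)ᴴ := d.right.symm
    rw [h1]
    have : diagonal (fun i => ((hW.eigenvalues i + ε : ℝ) : ℂ)) =
        diagonal (fun i => (hW.eigenvalues i : ℂ)) + (ε : ℂ) • (1 : Matrix ι ι ℂ) := by
      ext i j
      by_cases hij : i = j
      · subst hij; simp
      · simp [hij]
    rw [this, Matrix.mul_add, Matrix.add_mul]
    simp
  rw [e, mfun_mfun hW]

/-- One-sided weights: a positive definite `Z` normalizing a weighted family of matrices. -/
theorem exists_normalizing_weight {n : ℕ} {α : Type*} [Fintype α] {p : ℝ≥0∞} (h1 : 1 ≤ p)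
    (ht : p ≠ ∞) (a : α → Matrix (Fin n) (Fin n) ℂ) (m t : α → ℝ) (hm : ∀ k, 0 ≤ m k)
    (ha : ∀ k, rs p (a k * (a k)ᴴ) ≤ t k) {T ε : ℝ} (hT : ∑ k, m k * t k ^ p.toReal ≤ T)
    (hε : 0 < ε) :
    ∃ Z : Matrix (Fin n) (Fin n) ℂ, Z.PosDef ∧ Z.trace.re ≤ T + n * ε ∧
      opNorm (mfun Z (fun x => x ^ (-(1 / p.toReal / 2)))) ≤ ε ^ (-(1 / p.toReal / 2)) ∧
      ∀ c : Matrix (Fin n) (Fin n) ℂ, rs p (c * cᴴ) ≤ 1 →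
        ∑ k, (m k ^ (1 / p.toReal) *
          rs p ((c * mfun Z (fun x => x ^ (-(1 / p.toReal / 2))) * a k) *
            (c * mfun Z (fun x => x ^ (-(1 / p.toReal / 2))) * a k)ᴴ)) ^ p.toReal ≤ 1 := by
  have hr := one_le_toReal h1 ht
  have hr0 : 0 < p.toReal := by positivity
  have hps : ∀ k, (a k * (a k)ᴴ).PosSemidef := fun k => posSemidef_self_mul_conjTranspose _
  have hY0 : ∀ k, (mfun (a k * (a k)ᴴ) (fun x => x ^ p.toReal)).PosSemidef := fun k =>
    mfun_posSemidef (hps k) fun x hx => Real.rpow_nonneg hx _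
  -- The index `none` carries ε·1, which makes the sum Z invertible and bounds Z^{-1/2p}
  -- independently of the family. The other terms are chosen so that their (1/p)-th powers are
  -- m_k^{1/p} a_k a_k*, as `sum_rs_normalized_le` requires.
  set Y : Option α → Matrix (Fin n) (Fin n) ℂ := fun o => o.elim ((ε : ℂ) • 1)
    fun k => (m k : ℂ) • mfun (a k * (a k)ᴴ) (fun x => x ^ p.toReal) with hYdef
  have hεc : (0 : ℂ) < ε := by exact_mod_cast hε
  have hY : ∀ o, (Y o).PosSemidef := by
    rintro (_ | k)
    · exact PosSemidef.one.smul hεc.le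
    · exact (hY0 k).smul (by exact_mod_cast hm k)
  have hW : (∑ k, Y (some k)).PosSemidef := posSemidef_sum _ fun k _ => hY _
  have hZ : ∑ o, Y o = (∑ k, Y (some k)) + (ε : ℂ) • 1 := by
    rw [Fintype.sum_option, add_comm]; rfl
  refine ⟨∑ o, Y o, ?_, ?_, ?_, fun c hc => ?_⟩
  · rw [hZ]; exact PosDef.posSemidef_add hW (PosDef.one.smul hεc)
  · rw [hZ, trace_add, trace_sum, Complex.add_re, Complex.re_sum, trace_smul, trace_one]
    have : ∀ k, (Y (some k)).trace.re = m k * rs p (a k * (a k)ᴴ) ^ p.toReal := by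
      intro k
      rw [rs_rpow h1 ht (hps k)]
      change ((m k : ℂ) • mfun (a k * (a k)ᴴ) (fun x => x ^ p.toReal)).trace.re = _
      rw [trace_smul, smul_eq_mul, Complex.re_ofReal_mul]
    simp only [this]
    have h3 : ∑ k, m k * rs p (a k * (a k)ᴴ) ^ p.toReal ≤ T := by
      refine le_trans (Finset.sum_le_sum fun k _ => ?_) hT
      exact mul_le_mul_of_nonneg_left (Real.rpow_le_rpow (rs_nonneg h1 _) (ha k) hr0.le) (hm k)
    have h4 : ((ε : ℂ) • ((Fintype.card (Fin n) : ℕ) : ℂ)).re = n * ε := by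
      simp [mul_comm]
    rw [h4]; linarith
  · rw [hZ, mfun_add_smul_one hW.isHermitian]
    refine opNorm_le_of_posSemidef (by positivity) ?_
    rw [(mfun_isHermitian _ _).eq, mfun_mul]
    have e : (((ε ^ (-(1 / p.toReal / 2))) ^ 2 : ℝ) : ℂ) • (1 : Matrix (Fin n) (Fin n) ℂ) =
        mfun (∑ k, Y (some k)) (fun _ => (ε ^ (-(1 / p.toReal / 2))) ^ 2) := by
      have d := IsDecomp.of_eigen hW.isHermitian
      rw [d.mfun_eq, ← smul_one_eq_diagonal, Matrix.mul_smul, Matrix.smul_mul, Matrix.mul_one,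
        d.right]
    rw [e, mfun_sub]
    refine mfun_posSemidef hW fun x hx => ?_
    have : (x + ε) ^ (-(1 / p.toReal / 2)) ≤ ε ^ (-(1 / p.toReal / 2)) :=
      Real.rpow_le_rpow_of_nonpos hε (by linarith) (by
        have : 0 ≤ 1 / p.toReal / 2 := by positivity
        linarith)
    have h0 : 0 ≤ (x + ε) ^ (-(1 / p.toReal / 2)) := by positivity
    nlinarith
  · have h2 := sum_rs_normalized_le h1 ht hY cᴴ
    rw [conjTranspose_conjTranspose] at h2
    have h3 : rs p (cᴴ * c) ^ p.toReal ≤ 1 :=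
      Real.rpow_le_one (rs_nonneg h1 _) (by rwa [rs_conjTranspose_mul_self]) hr0.le
    refine le_trans ?_ (h2.trans h3)
    have hNh := mfun_isHermitian (∑ o, Y o) (fun x => x ^ (-(1 / p.toReal / 2)))
    generalize mfun (∑ o, Y o) (fun x => x ^ (-(1 / p.toReal / 2))) = N at *
    rw [Fintype.sum_option]
    refine le_trans (le_of_eq ?_) (le_add_of_nonneg_left (Real.rpow_nonneg (rs_nonneg h1 _) _))
    refine Finset.sum_congr rfl fun k _ => ?_
    have hs : 1 / p.toReal ≠ 0 := by positivity
    have e1 : mfun (Y (some k)) (fun x => x ^ (1 / p.toReal)) =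
        ((m k ^ (1 / p.toReal) : ℝ) : ℂ) • (a k * (a k)ᴴ) := by
      change mfun ((m k : ℂ) • mfun (a k * (a k)ᴴ) (fun x => x ^ p.toReal)) _ = _
      rw [mfun_smul (hY0 k).isHermitian, mfun_mfun (hps k).isHermitian]
      have d := IsDecomp.of_eigen (hps k).isHermitian
      have e2 : mfun (a k * (a k)ᴴ) (fun x => (m k * x ^ p.toReal) ^ (1 / p.toReal)) =
          mfun (a k * (a k)ᴴ) (fun x => m k ^ (1 / p.toReal) * x) :=
        mfun_congr (hps k) fun x hx => by
          rw [Real.mul_rpow (hm k) (Real.rpow_nonneg hx _), ← Real.rpow_mul hx,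
            mul_one_div_cancel hr0.ne', Real.rpow_one]
      rw [e2, ← mfun_smul (hps k).isHermitian _ (fun x => x), mfun_id]
      exact (hps k).isHermitian.smul (by simp [IsSelfAdjoint])
    have hYh := mfun_isHermitian (Y (some k)) (fun x => x ^ (1 / p.toReal / 2))
    rw [← mfun_rpow_half_sq (hY _) _ hs] at e1
    generalize mfun (Y (some k)) (fun x => x ^ (1 / p.toReal / 2)) = H at *
    rw [← rs_smul h1 (posSemidef_self_mul_conjTranspose _) (Real.rpow_nonneg (hm k) _)]
    congr 1
    rw [← rs_conjTranspose_mul_self]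
    congr 1
    have e3 : (H * N * cᴴ)ᴴ * (H * N * cᴴ) = c * N * (H * H) * (N * cᴴ) := by
      simp only [conjTranspose_mul, conjTranspose_conjTranspose, hNh.eq, hYh.eq, Matrix.mul_assoc]
    rw [e3, e1]
    simp only [conjTranspose_mul, hNh.eq, Matrix.mul_smul,
      Matrix.smul_mul, Matrix.mul_assoc]

/-- Two-sided weights normalizing a finite family in `ℓ^p(S^p(E))`. -/
theorem exists_normalizing_weights {n : ℕ} {α : Type*} [Fintype α] {p : ℝ≥0∞} (h1 : 1 ≤ p)
    (ht : p ≠ ∞) (z : α → Matrix (Fin n) (Fin n) E) (m : α → ℝ) (hm : ∀ k, 0 ≤ m k) {T ε : ℝ}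
    (hT : ∑ k, m k * vectorSchattenNorm p (z k) ^ p.toReal < T) (hε : 0 < ε) :
    ∃ Z Z' : Matrix (Fin n) (Fin n) ℂ, Z.PosDef ∧ Z'.PosDef ∧ Z.trace.re ≤ T + n * ε ∧
      Z'.trace.re ≤ T + n * ε ∧
      opNorm (mfun Z (fun x => x ^ (-(1 / p.toReal / 2)))) ≤ ε ^ (-(1 / p.toReal / 2)) ∧
      opNorm (mfun Z' (fun x => x ^ (-(1 / p.toReal / 2)))) ≤ ε ^ (-(1 / p.toReal / 2)) ∧
      ∀ c d : Matrix (Fin n) (Fin n) ℂ, rs p (c * cᴴ) ≤ 1 → rs p (dᴴ * d) ≤ 1 →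
        ∑ k, m k * vectorSchattenNorm p (sandwich
          (c * mfun Z (fun x => x ^ (-(1 / p.toReal / 2)))) (z k)
          (mfun Z' (fun x => x ^ (-(1 / p.toReal / 2))) * d)) ^ p.toReal ≤ 1 := by
  have hr := one_le_toReal h1 ht
  have hr0 : 0 < p.toReal := by positivity
  -- The strict inequality leaves room for factorizations that are optimal only up to τ.
  obtain ⟨τ, hτ0, hτ⟩ : ∃ τ : ℝ, 0 < τ ∧
      ∑ k, m k * (vectorSchattenNorm p (z k) + τ) ^ p.toReal ≤ T := by
    have hc : Continuous fun τ : ℝ => ∑ k, m k * (vectorSchattenNorm p (z k) + τ) ^ p.toReal :=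
      continuous_finsetSum _ fun k _ => continuous_const.mul
        ((continuous_const.add continuous_id).rpow_const fun _ => Or.inr hr0.le)
    have h2 := (hc.tendsto 0).eventually_lt_const (by simpa using hT)
    obtain ⟨τ, h3, h4⟩ := ((h2.filter_mono nhdsWithin_le_nhds).and
      (self_mem_nhdsWithin (a := (0 : ℝ)) (s := Set.Ioi 0))).exists
    exact ⟨τ, h4, h3.le⟩
  choose a y b hx hy ha hb using fun k =>
    exists_factorization h1 (lt_add_of_pos_right (vectorSchattenNorm p (z k)) hτ0)
  obtain ⟨Z, hZ, hZt, hZn, hZc⟩ := exists_normalizing_weight h1 ht a m _ hm ha hτ hε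
  obtain ⟨Z', hZ', hZt', hZn', hZc'⟩ := exists_normalizing_weight h1 ht (fun k => (b k)ᴴ) m _ hm
    (fun k => by rw [conjTranspose_conjTranspose]; exact hb k) hτ hε
  refine ⟨Z, Z', hZ, hZ', hZt, hZt', hZn, hZn', fun c d hc hd => ?_⟩
  have hA := hZc c hc
  have hB := hZc' dᴴ (by rwa [conjTranspose_conjTranspose])
  have hNh := mfun_isHermitian Z' (fun x => x ^ (-(1 / p.toReal / 2)))
  generalize mfun Z (fun x => x ^ (-(1 / p.toReal / 2))) = N at *
  generalize mfun Z' (fun x => x ^ (-(1 / p.toReal / 2))) = N' at *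
  have hms : ∀ k, 0 ≤ m k ^ (1 / p.toReal) := fun k => Real.rpow_nonneg (hm k) _
  have key := sum_rpow_le_of_le_sqrt_mul_sqrt hr0.le
    (v := fun k => m k ^ (1 / p.toReal) * vectorSchattenNorm p (sandwich (c * N) (z k) (N' * d)))
    (fun k => mul_nonneg (hms k) (vsn_nonneg h1 _))
    (fun k => mul_nonneg (hms k) (rs_nonneg h1 _))
    (fun k => mul_nonneg (hms k) (rs_nonneg h1 _)) (fun k => ?_) hA hB
  · refine le_trans (le_of_eq (Finset.sum_congr rfl fun k _ => ?_)) key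
    rw [Real.mul_rpow (hms k) (vsn_nonneg h1 _), ← Real.rpow_mul (hm k),
      one_div_mul_cancel hr0.ne', Real.rpow_one]
  · have e : sandwich (c * N) (z k) (N' * d) = sandwich (c * N * a k) (y k) (dᴴ * N' * (b k)ᴴ)ᴴ := by
      rw [hx k, sandwich_sandwich]
      simp only [conjTranspose_mul, conjTranspose_conjTranspose, hNh.eq, Matrix.mul_assoc]
    rw [e, Real.sqrt_mul (hms k), Real.sqrt_mul (hms k)]
    have := vsn_sandwich_le_of_matNormOn_le_one h1 (c * N * a k) (hy k) (dᴴ * N' * (b k)ᴴ)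
    calc _ ≤ m k ^ (1 / p.toReal) * _ := mul_le_mul_of_nonneg_left this (hms k)
      _ = (√(m k ^ (1 / p.toReal)) * √(m k ^ (1 / p.toReal))) * _ := by
          rw [Real.mul_self_sqrt (hms k)]
      _ = _ := by ring

end weights

/-! ### Normalizing functions in L^p(S^p(E)) -/

section factorization

/-- The two-sided action of scalar matrices as a linear map. -/
def sandwichLin {V m k l n : Type*} [Fintype k] [Fintype l] [AddCommGroup V] [Module ℂ V]
    (a : Matrix m k ℂ) (b : Matrix l n ℂ) : Matrix k l V →ₗ[ℂ] Matrix m n V where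
  toFun x := sandwich a x b
  map_add' x y := sandwich_add a x y b
  map_smul' c x := sandwich_smul c a x b

theorem vsn_sandwich_le_of_opNorm_le {q : ℝ≥0∞} (h1 : 1 ≤ q) {a b : Matrix ι ι ℂ} {s t : ℝ}
    (hs : 0 < s) (ht : 0 < t) (ha : opNorm a ≤ s) (hb : opNorm b ≤ t) (x : Matrix ι ι E) :
    vectorSchattenNorm q (sandwich a x b) ≤ s * t * vectorSchattenNorm q x := by
  have hn : ∀ {r : ℝ} {y : Matrix ι ι ℂ}, 0 < r → opNorm y ≤ r →
      opNorm (((r⁻¹ : ℝ) : ℂ) • y) ≤ 1 := by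
    intro r y hr hy
    rw [opNorm_smul, Complex.norm_real, Real.norm_of_nonneg (by positivity), inv_mul_le_iff₀ hr]
    simpa using hy
  have e : sandwich a x b = ((s * t : ℝ) : ℂ) •
      sandwich (((s⁻¹ : ℝ) : ℂ) • a) x (((t⁻¹ : ℝ) : ℂ) • b) := by
    rw [sandwich_smul_left, sandwich_smul_right, smul_smul, smul_smul, ← Complex.ofReal_mul,
      ← Complex.ofReal_mul, show s * t * s⁻¹ * t⁻¹ = 1 by field_simp, Complex.ofReal_one, one_smul]
  rw [e, vsn_smul h1, Complex.norm_real, Real.norm_of_nonneg (by positivity)]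
  gcongr
  exact vsn_contraction_le h1 (hn hs ha) (hn ht hb) x

variable {Ω : Type*} [MeasurableSpace Ω] {μ : Measure Ω}

theorem eLpNorm_seminorm_add_le {α : Type*} [Fintype α] {p : ℝ≥0∞} (h1 : 1 ≤ p)
    (N : Seminorm ℂ (α → ℂ)) {φ ψ : Ω → α → ℂ} (hφ : AEStronglyMeasurable φ μ)
    (hψ : AEStronglyMeasurable ψ μ) :
    eLpNorm (fun ω => N (φ ω)) p μ ≤
      eLpNorm (fun ω => N (ψ ω)) p μ + eLpNorm (fun ω => N (φ ω - ψ ω)) p μ := by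
  refine le_trans (eLpNorm_mono_real (g := fun ω => N (ψ ω) + N (φ ω - ψ ω)) fun ω => ?_)
    (eLpNorm_add_le ((continuous_seminorm_pi N).comp_aestronglyMeasurable hψ)
      ((continuous_seminorm_pi N).comp_aestronglyMeasurable (hφ.sub hψ)) h1)
  rw [Real.norm_of_nonneg (apply_nonneg N _)]
  calc N (φ ω) = N (ψ ω + (φ ω - ψ ω)) := by rw [add_sub_cancel]
    _ ≤ _ := map_add_le_add N _ _

theorem eLpNorm_le_ofReal_mul_eLpNorm {F : Type*} [NormedAddCommGroup F] {p : ℝ≥0∞} {f : Ω → ℝ}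
    {g : Ω → F} {C : ℝ} (h0 : ∀ ω, 0 ≤ f ω) (h : ∀ ω, f ω ≤ C * ‖g ω‖) :
    eLpNorm f p μ ≤ ENNReal.ofReal C * eLpNorm g p μ :=
  eLpNorm_le_mul_eLpNorm_of_ae_le_mul
    (Filter.Eventually.of_forall fun ω => by rw [Real.norm_of_nonneg (h0 ω)]; exact h ω) p

/-- Factorization of a function in the unit ball of `L^p(S^p(E))` through the unit ball of
`M_n(L_E^p)`, up to an arbitrarily small error. -/
theorem exists_weights_of_eLpNorm_le_one [IsFiniteMeasure μ] {n : ℕ} {α : Type*} [Fintype α]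
    {p : ℝ≥0∞} (h1 : 1 ≤ p) (ht : p ≠ ∞) (L : (α → ℂ) →ₗ[ℂ] Matrix (Fin n) (Fin n) E)
    {φ : Ω → α → ℂ} (hφ : MemLp φ p μ)
    (h : eLpNorm (fun ω => vectorSchattenNorm p (L (φ ω))) p μ ≤ 1) {δ : ℝ} (hδ : 0 < δ) :
    ∃ Z Z' : Matrix (Fin n) (Fin n) ℂ, Z.PosDef ∧ Z'.PosDef ∧ Z.trace.re ≤ 1 + δ ∧
      Z'.trace.re ≤ 1 + δ ∧
      ∀ c d : Matrix (Fin n) (Fin n) ℂ, rs p (c * cᴴ) ≤ 1 → rs p (dᴴ * d) ≤ 1 →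
        eLpNorm (fun ω => vectorSchattenNorm p (sandwich
          (c * mfun Z (fun x => x ^ (-(1 / p.toReal / 2)))) (L (φ ω))
          (mfun Z' (fun x => x ^ (-(1 / p.toReal / 2))) * d))) p μ ≤ ENNReal.ofReal (1 + δ) := by
  classical
  have hr := one_le_toReal h1 ht
  have hr0 : 0 < p.toReal := by positivity
  set N : Seminorm ℂ (α → ℂ) := (vsnSeminorm p h1).comp L with hN
  set C := ∑ k, N (Pi.single k 1) with hCdef
  have hC : 0 ≤ C := Finset.sum_nonneg fun k _ => apply_nonneg N _
  obtain ⟨τ, hτ0, hτ⟩ : ∃ τ : ℝ, 0 < τ ∧ (1 + τ) ^ p.toReal < 1 + δ / 2 := by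
    have hc : Continuous fun τ : ℝ => (1 + τ) ^ p.toReal :=
      (continuous_const.add continuous_id).rpow_const fun _ => Or.inr hr0.le
    have h2 := (hc.tendsto 0).eventually_lt_const (u := 1 + δ / 2) (by
      rw [add_zero, Real.one_rpow]; linarith)
    obtain ⟨τ, h3, h4⟩ := ((h2.filter_mono nhdsWithin_le_nhds).and
      (self_mem_nhdsWithin (a := (0 : ℝ)) (s := Set.Ioi 0))).exists
    exact ⟨τ, h4, h3⟩
  set ε := δ / (2 * (n + 1)) with hεdef
  have hε : 0 < ε := by positivity
  set B := ε ^ (-(1 / p.toReal / 2)) with hBdef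
  have hB : 0 < B := Real.rpow_pos_of_pos hε _
  -- The weights have norm at most B, which depends on ε alone, so the precision η of the simple
  -- approximation can be fixed before the weights are known. The first term keeps the simple
  -- function of norm at most 1 + τ, the second makes the weighted error at most δ.
  set η := min (τ / (C + 1)) (δ / ((C + 1) * (B * B))) with hηdef
  have hη : 0 < η := lt_min (by positivity) (by positivity)
  have hη1 : C * η ≤ τ := by
    calc C * η ≤ (C + 1) * (τ / (C + 1)) :=
          mul_le_mul (by linarith) (min_le_left _ _) hη.le (by positivity)
      _ = τ := by field_simp
  have hη2 : B * B * C * η ≤ δ := by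
    calc B * B * C * η ≤ B * B * (C + 1) * (δ / ((C + 1) * (B * B))) :=
          mul_le_mul (by gcongr; linarith) (min_le_right _ _) hη.le (by positivity)
      _ = δ := by field_simp
  obtain ⟨G, hG, hGm⟩ := hφ.exists_simpleFunc_eLpNorm_sub_lt ht
    (ε := ENNReal.ofReal η) (by simpa using hη)
  have hNz : ∀ z, N z ≤ C * ‖z‖ := fun z => seminorm_pi_le N z
  have hNG : eLpNorm (fun ω => N (G ω)) p μ ≤ ENNReal.ofReal (1 + τ) := by
    refine (eLpNorm_seminorm_add_le h1 N hGm.1 hφ.1).trans ?_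
    rw [ENNReal.ofReal_add zero_le_one hτ0.le, ENNReal.ofReal_one]
    refine add_le_add h (le_trans (eLpNorm_le_ofReal_mul_eLpNorm (g := φ - ⇑G) (C := C)
      (fun ω => apply_nonneg N _) fun ω => ?_) ?_)
    · rw [Pi.sub_apply, norm_sub_rev]; exact hNz _
    · refine (mul_le_mul_right hG.le _).trans ?_
      rw [← ENNReal.ofReal_mul hC]
      exact ENNReal.ofReal_le_ofReal hη1
  rw [eLpNorm_simpleFunc_le_iff h1 ht G N (fun b => apply_nonneg N b) (by positivity),
    ← Finset.sum_coe_sort] at hNG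
  obtain ⟨Z, Z', hZ, hZ', hZt, hZt', hZn, hZn', hcd⟩ := exists_normalizing_weights h1 ht
    (fun g : G.range => L g) (fun g => μ.real (G ⁻¹' {(g : α → ℂ)}))
    (fun _ => measureReal_nonneg) (hNG.trans_lt hτ) hε
  have hnε : 1 + δ / 2 + n * ε ≤ 1 + δ := by
    have : (n + 1) * ε = δ / 2 := by rw [hεdef]; field_simp
    nlinarith
  refine ⟨Z, Z', hZ, hZ', hZt.trans hnε, hZt'.trans hnε, fun c d hc hd => ?_⟩
  have hmain := hcd c d hc hd
  have hcn : opNorm (c * mfun Z (fun x => x ^ (-(1 / p.toReal / 2)))) ≤ B := by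
    refine (opNorm_mul_le _ _).trans ((mul_le_of_le_one_left (opNorm_nonneg _) ?_).trans hZn)
    exact (opNorm_le_sqrt_rs' h1 c).trans (sqrt_le_one_iff.2 hc)
  have hdn : opNorm (mfun Z' (fun x => x ^ (-(1 / p.toReal / 2))) * d) ≤ B := by
    refine (opNorm_mul_le _ _).trans ((mul_le_of_le_one_right (opNorm_nonneg _) ?_).trans hZn')
    exact (opNorm_le_sqrt_rs h1 d).trans (sqrt_le_one_iff.2 hd)
  generalize c * mfun Z (fun x => x ^ (-(1 / p.toReal / 2))) = c' at *
  generalize mfun Z' (fun x => x ^ (-(1 / p.toReal / 2))) * d = d' at *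
  set M : Seminorm ℂ (α → ℂ) := (vsnSeminorm p h1).comp ((sandwichLin c' d').comp L) with hM
  have hMG : eLpNorm (fun ω => M (G ω)) p μ ≤ ENNReal.ofReal 1 := by
    rw [eLpNorm_simpleFunc_le_iff h1 ht G M (fun b => apply_nonneg M b) zero_le_one,
      ← Finset.sum_coe_sort, Real.one_rpow]
    exact hmain
  refine (eLpNorm_seminorm_add_le h1 M hφ.1 hGm.1).trans ?_
  rw [ENNReal.ofReal_add zero_le_one hδ.le]
  refine add_le_add hMG (le_trans (eLpNorm_le_ofReal_mul_eLpNorm (g := φ - ⇑G) (C := B * B * C)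
    (fun ω => apply_nonneg M _) fun ω => ?_) ?_)
  · refine (vsn_sandwich_le_of_opNorm_le h1 hB hB hcn hdn (L (φ ω - G ω))).trans ?_
    rw [mul_assoc (B * B)]
    exact mul_le_mul_of_nonneg_left (hNz _) (by positivity)
  · refine (mul_le_mul_right hG.le _).trans ?_
    rw [← ENNReal.ofReal_mul (by positivity)]
    exact ENNReal.ofReal_le_ofReal hη2

end factorization

end

section

/-! ### Real contractions as convex combinations of orthogonal matrices -/

section convexHull

variable {n : ℕ}

/-- A singular value decomposition of a real contraction. -/
theorem exists_svd_of_contraction {X : Matrix (Fin n) (Fin n) ℝ} (hX : (1 - Xᵀ * X).PosSemidef) :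
    ∃ B V : Matrix (Fin n) (Fin n) ℝ, B ∈ orthogonalGroup (Fin n) ℝ ∧
      V ∈ orthogonalGroup (Fin n) ℝ ∧ ∃ s : Fin n → ℝ, (∀ i, 0 ≤ s i ∧ s i ≤ 1) ∧
        X = B * diagonal s * V := by
  have hH : (Xᵀ * X).IsHermitian := by
    simpa [conjTranspose_eq_transpose_of_trivial] using isHermitian_conjTranspose_mul_self X
  set V : Matrix (Fin n) (Fin n) ℝ := (hH.eigenvectorUnitary : Matrix (Fin n) (Fin n) ℝ) with hV
  have hV1 : Vᵀ * V = 1 := by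
    have := (Unitary.mem_iff.1 hH.eigenvectorUnitary.2).1
    rwa [star_eq_conjTranspose, conjTranspose_eq_transpose_of_trivial] at this
  have hV2 : V * Vᵀ = 1 := mul_eq_one_comm.1 hV1
  set W := X * V with hW
  set l := hH.eigenvalues with hl
  have hWW : Wᵀ * W = diagonal l := by
    have h1 := hH.spectral_theorem
    rw [Unitary.conjStarAlgAut_apply, ← hV] at h1
    have h2 : (RCLike.ofReal ∘ hH.eigenvalues : Fin n → ℝ) = l := rfl
    rw [h2] at h1
    rw [hW, transpose_mul, Matrix.mul_assoc, ← Matrix.mul_assoc Xᵀ, h1]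
    have h3 : (star (hH.eigenvectorUnitary : Matrix (Fin n) (Fin n) ℝ)) = Vᵀ := by
      rw [star_eq_conjTranspose, conjTranspose_eq_transpose_of_trivial]
    rw [h3, Matrix.mul_assoc _ Vᵀ V, hV1, Matrix.mul_one, ← Matrix.mul_assoc, hV1, Matrix.one_mul]
  have hWij : ∀ i j, ∑ k, W k i * W k j = if i = j then l i else 0 := by
    intro i j
    have := congrFun (congrFun hWW i) j
    rw [mul_apply, diagonal_apply] at this
    simpa [transpose_apply] using this
  have hl0 : ∀ i, 0 ≤ l i := by
    intro i
    have := hWij i i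
    rw [if_pos rfl] at this
    rw [← this]
    exact Finset.sum_nonneg fun k _ => mul_self_nonneg _
  have hl1 : ∀ i, l i ≤ 1 := by
    intro i
    have h1 := hX.conjTranspose_mul_mul_same V
    rw [conjTranspose_eq_transpose_of_trivial] at h1
    have h2 : Vᵀ * (1 - Xᵀ * X) * V = 1 - diagonal l := by
      rw [← hWW, hW, transpose_mul, Matrix.mul_sub, Matrix.sub_mul, Matrix.mul_one, hV1]
      simp only [Matrix.mul_assoc]
    rw [h2] at h1
    have h3 := h1.diag_nonneg (i := i)
    simpa using h3
  set v : Fin n → EuclideanSpace ℝ (Fin n) := fun i => WithLp.toLp 2 fun k => W k i / √(l i) with hv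
  have hin : ∀ i j, inner ℝ (v i) (v j) = (if i = j then l i else 0) / (√(l i) * √(l j)) := by
    intro i j
    rw [← hWij, Finset.sum_div, PiLp.inner_apply]
    refine Finset.sum_congr rfl fun k _ => ?_
    simp only [hv, RCLike.inner_apply, conj_trivial]
    rw [div_mul_div_comm, mul_comm (W k j), mul_comm (√(l j))]
  -- The normalized columns of X V with nonzero singular value are orthonormal and are completed to
  -- a basis. The remaining columns of X V vanish, so the choice of the completion is immaterial.
  obtain ⟨b, hb⟩ := Orthonormal.exists_orthonormalBasis_extension_of_card_eq (𝕜 := ℝ)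
    (E := EuclideanSpace ℝ (Fin n)) (ι := Fin n) (by simp) (v := v) (s := {i | l i ≠ 0}) (by
      rw [orthonormal_iff_ite]
      rintro ⟨i, hi⟩ ⟨j, hj⟩
      have h1 := hin i j
      simp only [Set.domRestrict_apply, Subtype.mk.injEq]
      rw [h1]
      by_cases hij : i = j
      · subst hij
        rw [if_pos rfl, if_pos rfl, Real.mul_self_sqrt (hl0 i)]
        exact div_self hi
      · rw [if_neg hij, if_neg hij, zero_div])
  refine ⟨of fun k i => b i k, Vᵀ, ?_, ?_, fun i => √(l i), fun i => ⟨Real.sqrt_nonneg _,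
    sqrt_le_one_iff.2 (hl1 i)⟩, ?_⟩
  · rw [mem_orthogonalGroup_iff']
    ext i j
    have := (orthonormal_iff_ite.1 b.orthonormal) i j
    rw [PiLp.inner_apply] at this
    simp only [RCLike.inner_apply, conj_trivial] at this
    rw [mul_apply, one_apply, ← this]
    refine Finset.sum_congr rfl fun k _ => ?_
    simp [mul_comm]
  · rw [mem_orthogonalGroup_iff]
    rw [transpose_transpose, hV1]
  · have h1 : X = W * Vᵀ := by rw [hW, Matrix.mul_assoc, hV2, Matrix.mul_one]
    rw [h1]
    congr 1
    ext k i
    rw [mul_diagonal, of_apply]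
    by_cases hi : l i = 0
    · have h2 := hWij i i
      rw [if_pos rfl, hi] at h2
      have h3 := (Finset.sum_eq_zero_iff_of_nonneg fun k _ => mul_self_nonneg (W k i)).1 h2 k
        (Finset.mem_univ k)
      rw [hi, Real.sqrt_zero, mul_zero]
      exact mul_self_eq_zero.1 h3
    · rw [hb i hi]
      have h2 : √(l i) ≠ 0 := fun h => hi ((Real.sqrt_eq_zero (hl0 i)).1 h)
      simp only [hv]
      rw [div_mul_cancel₀ _ h2]

theorem diagonal_sign_mem_orthogonalGroup {s : Fin n → ℝ} (hs : ∀ i, s i = -1 ∨ s i = 1) :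
    diagonal s ∈ orthogonalGroup (Fin n) ℝ := by
  rw [mem_orthogonalGroup_iff, diagonal_transpose, diagonal_mul_diagonal, ← diagonal_one]
  congr 1
  ext i
  rcases hs i with h | h <;> simp [h]

/-- Real contractions are convex combinations of orthogonal matrices. -/
theorem mem_convexHull_orthogonalGroup {X : Matrix (Fin n) (Fin n) ℝ}
    (hX : (1 - Xᵀ * X).PosSemidef) :
    X ∈ convexHull ℝ (orthogonalGroup (Fin n) ℝ : Set (Matrix (Fin n) (Fin n) ℝ)) := by
  obtain ⟨B, V, hB, hV, s, hs, rfl⟩ := exists_svd_of_contraction hX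
  -- The cube [−1, 1]^n is the convex hull of the sign vectors, and the linear map s ↦ B diag(s) V
  -- sends sign vectors to orthogonal matrices.
  have h1 : s ∈ convexHull ℝ (Set.pi Set.univ fun _ : Fin n => ({-1, 1} : Set ℝ)) := by
    rw [convexHull_pi]
    intro i _
    rw [convexHull_pair, segment_eq_Icc (by norm_num)]
    exact ⟨by linarith [(hs i).1], (hs i).2⟩
  let f : (Fin n → ℝ) →ₗ[ℝ] Matrix (Fin n) (Fin n) ℝ :=
    { toFun := fun s => B * diagonal s * V
      map_add' := fun x y => by rw [← Matrix.add_mul, ← Matrix.mul_add, diagonal_add]; rfl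
      map_smul' := fun c x => by
        rw [RingHom.id_apply, ← Matrix.smul_mul, ← Matrix.mul_smul, ← diagonal_smul] }
  have h2 : f s ∈ f '' convexHull ℝ (Set.pi Set.univ fun _ : Fin n => ({-1, 1} : Set ℝ)) :=
    ⟨s, h1, rfl⟩
  rw [LinearMap.image_convexHull] at h2
  refine convexHull_mono ?_ h2
  rintro _ ⟨t, ht, rfl⟩
  exact mul_mem (mul_mem hB (diagonal_sign_mem_orthogonalGroup fun i => by
    simpa using ht i (Set.mem_univ i))) hV

/-- The complexification of a real matrix. -/
def complexify {m : Type*} : Matrix m m ℝ →ₗ[ℝ] Matrix m m ℂ where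
  toFun X := X.map Complex.ofReal
  map_add' X Y := by ext; simp
  map_smul' c X := by ext; simp

theorem complexify_mul {m : Type*} [Fintype m] (X Y : Matrix m m ℝ) :
    complexify (X * Y) = complexify X * complexify Y := by
  change (X * Y).map Complex.ofRealHom = X.map Complex.ofRealHom * Y.map Complex.ofRealHom
  rw [Matrix.map_mul]

/-- The complexified orthogonal matrices. -/
def orthSet (n : ℕ) : Set (Matrix (Fin n) (Fin n) ℂ) :=
  complexify '' (orthogonalGroup (Fin n) ℝ : Set (Matrix (Fin n) (Fin n) ℝ))

/-- Testing the complex positivity of 1 − C* C on real vectors gives the corresponding real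
statement for the real matrix underlying C. -/
theorem mem_convexHull_orthSet {C : Matrix (Fin n) (Fin n) ℂ} (hC : opNorm C ≤ 1)
    (him : ∀ i j, (C i j).im = 0) : C ∈ convexHull ℝ (orthSet n) := by
  have e : complexify (C.map Complex.re) = C := by
    ext i j
    exact Complex.ext rfl (him i j).symm
  rw [orthSet, ← LinearMap.image_convexHull]
  refine ⟨C.map Complex.re, mem_convexHull_orthogonalGroup ?_, e⟩
  have h1 := posSemidef_one_sub_of_opNorm_le_one hC
  refine PosSemidef.of_dotProduct_mulVec_nonneg ?_ fun x => ?_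
  · refine isHermitian_one.sub ?_
    simpa [conjTranspose_eq_transpose_of_trivial] using
      isHermitian_conjTranspose_mul_self (C.map Complex.re)
  · have h2 := (Complex.le_def.1 (h1.dotProduct_mulVec_nonneg fun i => (x i : ℂ))).1
    have e2 : (1 : Matrix (Fin n) (Fin n) ℂ) - Cᴴ * C =
        complexify (1 - (C.map Complex.re)ᵀ * C.map Complex.re) := by
      have h3 : complexify (1 : Matrix (Fin n) (Fin n) ℝ) = 1 := by
        ext i j
        by_cases hij : i = j
        · subst hij; simp [complexify]
        · simp [complexify, hij]
      have h4 : complexify (C.map Complex.re)ᵀ = Cᴴ := by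
        conv_rhs => rw [← e]
        ext i j; simp [complexify]
      rw [map_sub, complexify_mul, h3, h4, e]
    rw [e2] at h2
    have e3 : (star fun i => (x i : ℂ)) ⬝ᵥ complexify (1 - (C.map Complex.re)ᵀ * C.map Complex.re) *ᵥ
        (fun i => (x i : ℂ)) =
        ((star x ⬝ᵥ (1 - (C.map Complex.re)ᵀ * C.map Complex.re) *ᵥ x : ℝ) : ℂ) := by
      simp only [dotProduct, mulVec, complexify, LinearMap.coe_mk, AddHom.coe_mk, map_apply,
        Pi.star_apply, star_trivial, Complex.star_def, Complex.conj_ofReal]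
      push_cast
      rfl
    rw [e3] at h2
    simpa using h2

end convexHull

end

section

/-! ### Seminorms on families of matrices -/

section fam

variable {I : Type*} {d : I → ℕ} {S : Finset I}

/-- Families of complex matrices of sizes `d_σ`, `σ ∈ S`. -/
abbrev MatFam {I : Type*} (d : I → ℕ) (S : Finset I) :=
  ∀ σ : S, Matrix (Fin (d σ)) (Fin (d σ)) ℂ

/-- The family of matrices with prescribed entries. -/
def famOfVec : (((σ : S) × (Fin (d σ) × Fin (d σ))) → ℂ) →ₗ[ℂ] MatFam d S where
  toFun z σ := of fun i j => z ⟨σ, i, j⟩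
  map_add' _ _ := rfl
  map_smul' _ _ := rfl

/-- The entries of a family of matrices. -/
def famVec (r : MatFam d S) : ((σ : S) × (Fin (d σ) × Fin (d σ))) → ℂ :=
  fun k => r k.1 k.2.1 k.2.2

theorem measurable_seminorm_fam {X : Type*} [MeasurableSpace X] (M : Seminorm ℂ (MatFam d S))
    {r : X → MatFam d S} (hr : ∀ σ i j, Measurable fun x => r x σ i j) :
    Measurable fun x => M (r x) := by
  have h1 : Measurable fun x => famVec (r x) :=
    measurable_pi_lambda _ fun k => hr k.1 k.2.1 k.2.2
  exact (continuous_seminorm_pi (M.comp famOfVec)).measurable.comp h1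

theorem norm_apply_le_opNorm {m n : Type*} [Fintype m] [Fintype n] (a : Matrix m n ℂ) (i : m)
    (j : n) : ‖a i j‖ ≤ opNorm a := by
  classical
  rw [opNorm_eq]
  have h1 := Matrix.l2_opNorm_mulVec a (WithLp.toLp 2 (Pi.single j (1 : ℂ)))
  have h2 : ‖WithLp.toLp 2 (Pi.single j (1 : ℂ) : n → ℂ)‖ = 1 := by simp
  rw [h2, mul_one] at h1
  refine le_trans ?_ h1
  have h3 := PiLp.norm_apply_le (p := 2) ((EuclideanSpace.equiv m ℂ).symm
    (a *ᵥ (WithLp.toLp 2 (Pi.single j (1 : ℂ) : n → ℂ)).ofLp)) i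
  refine le_trans (le_of_eq ?_) h3
  simp [col_apply]

/-- A seminorm on families of matrices is bounded by a multiple of the operator norm. -/
theorem exists_seminorm_fam_le (M : Seminorm ℂ (MatFam d S)) :
    ∃ C : ℝ, 0 ≤ C ∧ ∀ (r : MatFam d S) (c : ℝ), 0 ≤ c → (∀ σ, opNorm (r σ) ≤ c) → M r ≤ C * c := by
  classical
  refine ⟨∑ k, (M.comp famOfVec) (Pi.single k 1),
    Finset.sum_nonneg fun k _ => apply_nonneg _ _, fun r c hc hr => ?_⟩
  have h1 := seminorm_pi_le (M.comp famOfVec) (famVec r)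
  refine le_trans h1 (mul_le_mul_of_nonneg_left ?_
    (Finset.sum_nonneg fun k _ => apply_nonneg _ _))
  exact (pi_norm_le_iff_of_nonneg hc).2 fun k =>
    (norm_apply_le_opNorm (r k.1) k.2.1 k.2.2).trans (hr k.1)

end fam

/-! ### The contraction principle for quantized Rademacher systems -/

section orthogonal

theorem complexify_conjTranspose_mul_self {n : ℕ} (u : orthogonalGroup (Fin n) ℝ) :
    (complexify (u : Matrix (Fin n) (Fin n) ℝ))ᴴ * complexify (u : Matrix (Fin n) (Fin n) ℝ) = 1 := by
  have h : (complexify (u : Matrix (Fin n) (Fin n) ℝ))ᴴ =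
      complexify (u : Matrix (Fin n) (Fin n) ℝ)ᵀ := by
    ext i j; simp [complexify]
  rw [h, ← complexify_mul]
  have h2 : (u : Matrix (Fin n) (Fin n) ℝ)ᵀ * (u : Matrix (Fin n) (Fin n) ℝ) = 1 :=
    (mem_orthogonalGroup_iff' (Fin n) ℝ).1 u.2
  rw [h2]
  ext i j
  by_cases hij : i = j
  · subst hij; simp [complexify]
  · simp [complexify, hij]

theorem opNorm_complexify_le_one {n : ℕ} (u : orthogonalGroup (Fin n) ℝ) :
    opNorm (complexify (u : Matrix (Fin n) (Fin n) ℝ)) ≤ 1 :=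
  opNorm_le_one_of_isometry (complexify_conjTranspose_mul_self u)

instance (n : ℕ) : BorelSpace (orthogonalGroup (Fin n) ℝ) := ⟨rfl⟩

theorem measurable_complexify_apply {n : ℕ} (i j : Fin n) :
    Measurable fun u : orthogonalGroup (Fin n) ℝ =>
      complexify (u : Matrix (Fin n) (Fin n) ℝ) i j := by
  have : Continuous fun u : orthogonalGroup (Fin n) ℝ =>
      complexify (u : Matrix (Fin n) (Fin n) ℝ) i j :=
    Complex.continuous_ofReal.comp ((continuous_apply_apply i j).comp continuous_subtype_val)
  exact this.measurable

variable {Ω : Type*} [MeasurableSpace Ω] {μ : Measure Ω} {I : Type*} {d : I → ℕ} {S : Finset I}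
  {ρ : ∀ σ : I, Ω → Matrix.orthogonalGroup (Fin (d σ)) ℝ}

/-- The values of a quantized Rademacher system, as families of complex matrices. -/
def rhoFam (S : Finset I) (ρ : ∀ σ : I, Ω → Matrix.orthogonalGroup (Fin (d σ)) ℝ) (ω : Ω) :
    MatFam d S := fun σ => complexify (ρ σ ω : Matrix (Fin (d σ)) (Fin (d σ)) ℝ)

theorem measurable_rhoFam_apply (hρ : IsQuantizedRademacher μ ρ) (σ : S) (i j : Fin (d σ)) :
    Measurable fun ω => rhoFam S ρ ω σ i j :=
  (measurable_complexify_apply i j).comp (hρ.measurable σ)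

theorem opNorm_rhoFam_le_one (ω : Ω) (σ : S) : opNorm (rhoFam S ρ ω σ) ≤ 1 :=
  opNorm_complexify_le_one _

theorem measurable_mul_apply {X : Type*} [MeasurableSpace X] {m : ℕ}
    {a b : X → Matrix (Fin m) (Fin m) ℂ} (ha : ∀ i j, Measurable fun x => a x i j)
    (hb : ∀ i j, Measurable fun x => b x i j) (i j : Fin m) :
    Measurable fun x => (a x * b x) i j := by
  simp only [mul_apply]
  exact Finset.measurable_sum _ fun k _ => (ha i k).mul (hb k j)

/-- By independence the joint law is the product of the Haar laws, and this product is invariant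
under left translation in the product group. -/
theorem map_mul_rho (hρ : IsQuantizedRademacher μ ρ)
    (u : ∀ σ : S, orthogonalGroup (Fin (d σ)) ℝ) :
    (μ.map fun ω (σ : S) => ρ σ ω).map (fun r => u * r) = μ.map fun ω (σ : S) => ρ σ ω := by
  have := hρ.isProbabilityMeasure
  have hind : iIndepFun (fun σ : S => ρ σ) μ := hρ.indep.precomp Subtype.val_injective
  rw [iIndepFun.map_fun_eq_pi_map (f := fun σ : S => ρ σ)
    (fun σ => (hρ.measurable σ).aemeasurable) hind]
  have h1 : ∀ σ : S, (μ.map (ρ σ)).IsMulLeftInvariant := fun σ =>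
    (hρ.haar σ).toIsMulLeftInvariant
  have h2 : ∀ σ : S, IsProbabilityMeasure (μ.map (ρ σ)) := fun σ =>
    Measure.isProbabilityMeasure_map (hρ.measurable σ).aemeasurable
  exact map_mul_left_eq_self _ u

theorem eLpNorm_mul_rho (hρ : IsQuantizedRademacher μ ρ) (q : ℝ≥0∞) (M : Seminorm ℂ (MatFam d S))
    (u : ∀ σ : S, orthogonalGroup (Fin (d σ)) ℝ) :
    eLpNorm (fun ω => M ((fun σ : S => complexify (u σ : Matrix (Fin (d σ)) (Fin (d σ)) ℝ)) *
      rhoFam S ρ ω)) q μ = eLpNorm (fun ω => M (rhoFam S ρ ω)) q μ := by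
  have hm : Measurable fun ω (σ : S) => ρ σ ω := measurable_pi_lambda _ fun σ => hρ.measurable σ
  have hg : Measurable fun r : (∀ σ : S, orthogonalGroup (Fin (d σ)) ℝ) =>
      M fun σ => complexify (r σ : Matrix (Fin (d σ)) (Fin (d σ)) ℝ) :=
    measurable_seminorm_fam M fun σ i j =>
      (measurable_complexify_apply i j).comp (measurable_pi_apply σ)
  have e1 : eLpNorm (fun ω => M (rhoFam S ρ ω)) q μ = eLpNorm (fun r :
      (∀ σ : S, orthogonalGroup (Fin (d σ)) ℝ) =>
        M fun σ => complexify (r σ : Matrix (Fin (d σ)) (Fin (d σ)) ℝ)) q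
          (μ.map fun ω (σ : S) => ρ σ ω) := by
    rw [eLpNorm_map_measure hg.aestronglyMeasurable hm.aemeasurable]; rfl
  have hmu : Measurable fun r : (∀ σ : S, orthogonalGroup (Fin (d σ)) ℝ) => u * r :=
    measurable_const_mul u
  rw [e1, ← map_mul_rho hρ u, eLpNorm_map_measure hg.aestronglyMeasurable hmu.aemeasurable,
    eLpNorm_map_measure (hg.comp hmu).aestronglyMeasurable hm.aemeasurable]
  congr 1
  ext ω
  simp only [Function.comp_apply, Pi.mul_apply]
  congr 1
  ext σ : 1
  exact (complexify_mul _ _).symm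

theorem measurable_seminorm_mul_rho (hρ : IsQuantizedRademacher μ ρ) (M : Seminorm ℂ (MatFam d S))
    (C : MatFam d S) : Measurable fun ω => M (C * rhoFam S ρ ω) :=
  measurable_seminorm_fam M fun σ => measurable_mul_apply (fun _ _ => measurable_const)
    (measurable_rhoFam_apply hρ σ)

theorem eLpNorm_rho_ne_top (hρ : IsQuantizedRademacher μ ρ) (q : ℝ≥0∞)
    (M : Seminorm ℂ (MatFam d S)) (C : MatFam d S) :
    eLpNorm (fun ω => M (C * rhoFam S ρ ω)) q μ ≠ ∞ := by
  have := hρ.isProbabilityMeasure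
  obtain ⟨K, hK, hM⟩ := exists_seminorm_fam_le M
  have hc : ∀ σ, opNorm (C σ) ≤ ∑ σ, opNorm (C σ) := fun σ =>
    Finset.single_le_sum (f := fun σ => opNorm (C σ)) (fun σ _ => opNorm_nonneg _)
      (Finset.mem_univ σ)
  refine (MemLp.of_bound (C := K * ∑ σ, opNorm (C σ))
    (measurable_seminorm_mul_rho hρ M C).aestronglyMeasurable
    (Filter.Eventually.of_forall fun ω => ?_)).2.ne
  rw [Real.norm_of_nonneg (apply_nonneg M _)]
  refine hM _ _ (Finset.sum_nonneg fun σ _ => opNorm_nonneg _) fun σ => ?_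
  exact (opNorm_mul_le _ _).trans ((mul_le_of_le_one_right (opNorm_nonneg _)
    (opNorm_rhoFam_le_one ω σ)).trans (hc σ))

/-- The seminorm `C ↦ ‖M(C ρ)‖_{L^q}`. -/
def rhoSeminorm (hρ : IsQuantizedRademacher μ ρ) {q : ℝ≥0∞} (h1 : 1 ≤ q)
    (M : Seminorm ℂ (MatFam d S)) : Seminorm ℂ (MatFam d S) :=
  Seminorm.ofSMulLE (fun C => (eLpNorm (fun ω => M (C * rhoFam S ρ ω)) q μ).toReal)
    (by simp)
    (fun C D => by
      rw [← ENNReal.toReal_add (eLpNorm_rho_ne_top hρ q M C) (eLpNorm_rho_ne_top hρ q M D)]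
      refine ENNReal.toReal_mono (ENNReal.add_ne_top.2
        ⟨eLpNorm_rho_ne_top hρ q M C, eLpNorm_rho_ne_top hρ q M D⟩) ?_
      refine le_trans (eLpNorm_mono_real fun ω => ?_)
        (eLpNorm_add_le (measurable_seminorm_mul_rho hρ M C).aestronglyMeasurable
          (measurable_seminorm_mul_rho hρ M D).aestronglyMeasurable h1)
      rw [Real.norm_of_nonneg (apply_nonneg M _), add_mul]
      exact map_add_le_add M _ _)
    (fun c C => by
      have e : (fun ω => M (c • C * rhoFam S ρ ω)) =
          ‖c‖ • fun ω => M (C * rhoFam S ρ ω) := by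
        ext ω
        have h2 : c • C * rhoFam S ρ ω = c • (C * rhoFam S ρ ω) := by
          ext σ : 1
          exact Matrix.smul_mul c (C σ) _
        rw [h2, map_smul_eq_mul]; rfl
      rw [e, eLpNorm_const_smul, ENNReal.toReal_mul]
      simp)

theorem ofReal_rhoSeminorm (hρ : IsQuantizedRademacher μ ρ) {q : ℝ≥0∞} (h1 : 1 ≤ q)
    (M : Seminorm ℂ (MatFam d S)) (C : MatFam d S) :
    ENNReal.ofReal (rhoSeminorm hρ h1 M C) = eLpNorm (fun ω => M (C * rhoFam S ρ ω)) q μ :=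
  ENNReal.ofReal_toReal (eLpNorm_rho_ne_top hρ q M C)

/-- C lies in the convex hull of the families of orthogonal matrices, the hull of a product being
the product of the hulls. Left invariance gives the seminorm the value at 1 on all such families,
and sublevel sets of a seminorm are convex. -/
theorem rhoSeminorm_le_one_of_real (hρ : IsQuantizedRademacher μ ρ) {q : ℝ≥0∞} (h1 : 1 ≤ q)
    (M : Seminorm ℂ (MatFam d S)) {C : MatFam d S} (hC : ∀ σ, opNorm (C σ) ≤ 1)
    (him : ∀ σ i j, (C σ i j).im = 0) : rhoSeminorm hρ h1 M C ≤ rhoSeminorm hρ h1 M 1 := by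
  have h2 : C ∈ convexHull ℝ (Set.pi Set.univ fun σ : S => orthSet (d σ)) :=
    mem_convexHull_pi fun σ _ => mem_convexHull_orthSet (hC σ) (him σ)
  have h3 : Convex ℝ {D | D ∈ Set.univ ∧ rhoSeminorm hρ h1 M D ≤ rhoSeminorm hρ h1 M 1} :=
    (rhoSeminorm hρ h1 M).convexOn.convex_le _
  refine (convexHull_min ?_ h3 h2).2
  intro u hu
  choose v hv huv using fun σ => hu σ (Set.mem_univ σ)
  have e : u = fun σ : S => complexify
      ((⟨v σ, hv σ⟩ : orthogonalGroup (Fin (d σ)) ℝ) : Matrix (Fin (d σ)) (Fin (d σ)) ℝ) := by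
    ext σ : 1
    exact (huv σ).symm
  refine ⟨Set.mem_univ _, le_of_eq (congrArg ENNReal.toReal ?_)⟩
  rw [e, eLpNorm_mul_rho hρ q M (fun σ => ⟨v σ, hv σ⟩)]
  simp only [one_mul]

/-- The contraction principle for real multipliers. -/
theorem rhoSeminorm_le_of_real (hρ : IsQuantizedRademacher μ ρ) {q : ℝ≥0∞} (h1 : 1 ≤ q)
    (M : Seminorm ℂ (MatFam d S)) {C : MatFam d S} {c : ℝ} (hc : 0 ≤ c)
    (hC : ∀ σ, opNorm (C σ) ≤ c) (him : ∀ σ i j, (C σ i j).im = 0) :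
    rhoSeminorm hρ h1 M C ≤ c * rhoSeminorm hρ h1 M 1 := by
  rcases hc.eq_or_lt with rfl | hc
  · have : C = 0 := by
      ext σ : 1
      exact eq_zero_of_opNorm_le_zero (hC σ)
    rw [this, map_zero, zero_mul]
  · have e : C = ((c : ℝ) : ℂ) • ((c⁻¹ : ℝ) : ℂ) • C := by
      rw [smul_smul, ← Complex.ofReal_mul, mul_inv_cancel₀ hc.ne', Complex.ofReal_one, one_smul]
    rw [e, map_smul_eq_mul, Complex.norm_real, Real.norm_of_nonneg hc.le]
    refine mul_le_mul_of_nonneg_left (rhoSeminorm_le_one_of_real hρ h1 M (fun σ => ?_)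
      fun σ i j => ?_) hc.le
    · rw [Pi.smul_apply, opNorm_smul, Complex.norm_real, Real.norm_of_nonneg (by positivity),
        inv_mul_le_iff₀ hc, mul_one]
      exact hC σ
    · rw [Pi.smul_apply, Matrix.smul_apply, smul_eq_mul, Complex.im_ofReal_mul, him, mul_zero]

theorem opNorm_map_star {n : ℕ} (C : Matrix (Fin n) (Fin n) ℂ) :
    opNorm (C.map star) ≤ opNorm C := by
  have h := posSemidef_opNorm_sq_sub C le_rfl
  refine opNorm_le_of_posSemidef (opNorm_nonneg _) ?_
  have e : ((opNorm C ^ 2 : ℝ) : ℂ) • (1 : Matrix (Fin n) (Fin n) ℂ) -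
      (C.map star)ᴴ * C.map star =
      (((opNorm C ^ 2 : ℝ) : ℂ) • (1 : Matrix (Fin n) (Fin n) ℂ) - Cᴴ * C)ᵀ := by
    rw [transpose_sub, transpose_smul, transpose_one, transpose_mul]
    congr 1
    ext i j
    simp [mul_apply]
  rw [e]
  exact h.transpose

/-- The contraction principle for complex multipliers. -/
theorem rhoSeminorm_le (hρ : IsQuantizedRademacher μ ρ) {q : ℝ≥0∞} (h1 : 1 ≤ q)
    (M : Seminorm ℂ (MatFam d S)) {C : MatFam d S} {c : ℝ} (hc : 0 ≤ c)
    (hC : ∀ σ, opNorm (C σ) ≤ c) :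
    rhoSeminorm hρ h1 M C ≤ 2 * c * rhoSeminorm hρ h1 M 1 := by
  -- Entrywise real and imaginary parts. Entrywise conjugation does not increase the operator norm,
  -- so each part is still bounded by c; treating the parts separately is the origin of the factor
  -- 2.
  set C₁ : MatFam d S := fun σ => (2⁻¹ : ℂ) • (C σ + (C σ).map star) with hC₁
  set C₂ : MatFam d S := fun σ => (-(2⁻¹ : ℂ) * Complex.I) • (C σ + (-1 : ℂ) • (C σ).map star)
    with hC₂
  have e : C = C₁ + Complex.I • C₂ := by
    ext σ i j
    simp only [hC₁, hC₂, Pi.add_apply, Pi.smul_apply, Matrix.add_apply, Matrix.smul_apply,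
      map_apply, smul_eq_mul]
    linear_combination (2⁻¹ * (C σ i j - star (C σ i j))) * Complex.I_mul_I
  have hadd : ∀ {m : ℕ} (a b : Matrix (Fin m) (Fin m) ℂ), opNorm (a + b) ≤ opNorm a + opNorm b := by
    intro m a b
    rw [opNorm_eq, opNorm_eq, opNorm_eq]
    open scoped Matrix.Norms.L2Operator in exact norm_add_le a b
  have b1 : ∀ σ, opNorm (C₁ σ) ≤ c := by
    intro σ
    have h2 := hadd (C σ) ((C σ).map star)
    have h3 := (opNorm_map_star (C σ)).trans (hC σ)
    have h4 := hC σ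
    have h5 : ‖(2⁻¹ : ℂ)‖ = 2⁻¹ := by norm_num
    rw [hC₁, opNorm_smul, h5]
    linarith
  have b2 : ∀ σ, opNorm (C₂ σ) ≤ c := by
    intro σ
    have h2 := hadd (C σ) ((-1 : ℂ) • (C σ).map star)
    rw [opNorm_smul _ ((C σ).map star)] at h2
    have h3 := (opNorm_map_star (C σ)).trans (hC σ)
    have h4 := hC σ
    have h5 : ‖-(2⁻¹ : ℂ) * Complex.I‖ = 2⁻¹ := by simp
    have h6 : ‖(-1 : ℂ)‖ = 1 := by simp
    rw [h6, one_mul] at h2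
    rw [hC₂, opNorm_smul, h5]
    linarith
  have i1 : ∀ σ i j, (C₁ σ i j).im = 0 := by
    intro σ i j
    simp [hC₁]
  have i2 : ∀ σ i j, (C₂ σ i j).im = 0 := by
    intro σ i j
    simp [hC₂]
  have h2 := rhoSeminorm_le_of_real hρ h1 M hc b1 i1
  have h3 := rhoSeminorm_le_of_real hρ h1 M hc b2 i2
  rw [e]
  refine (map_add_le_add _ _ _).trans ?_
  rw [map_smul_eq_mul, Complex.norm_I, one_mul]
  linarith

end orthogonal

end

section

/-! ### Exchanging mixed norms -/

section swap

variable {Ω : Type*} [MeasurableSpace Ω] {μ : Measure Ω}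

theorem eLpNorm_rpow_toReal {q : ℝ≥0∞} (h1 : 1 ≤ q) (ht : q ≠ ∞) (f : Ω → ℝ) :
    eLpNorm f q μ ^ q.toReal = ∫⁻ x, ‖f x‖ₑ ^ q.toReal ∂μ := by
  have hr := one_le_toReal h1 ht
  rw [eLpNorm_eq_lintegral_rpow_enorm_toReal (by rintro rfl; simp at h1) ht, ← ENNReal.rpow_mul,
    one_div_mul_cancel (by positivity), ENNReal.rpow_one]

theorem lintegral_eLpNorm_rpow_swap [SFinite μ] {q : ℝ≥0∞} (h1 : 1 ≤ q) (ht : q ≠ ∞)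
    {F : Ω → Ω → ℝ} (hF : Measurable (Function.uncurry F)) :
    ∫⁻ x, eLpNorm (fun y => F x y) q μ ^ q.toReal ∂μ =
      ∫⁻ y, eLpNorm (fun x => F x y) q μ ^ q.toReal ∂μ := by
  simp only [eLpNorm_rpow_toReal h1 ht]
  exact lintegral_lintegral_swap ((hF.enorm.pow_const _).aemeasurable)

theorem measurable_eLpNorm_left [SFinite μ] {q : ℝ≥0∞} (h1 : 1 ≤ q) (ht : q ≠ ∞)
    {F : Ω → Ω → ℝ} (hF : Measurable (Function.uncurry F)) :
    Measurable fun y => eLpNorm (fun x => F x y) q μ := by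
  simp only [eLpNorm_eq_lintegral_rpow_enorm_toReal
    (show q ≠ 0 by rintro rfl; simp at h1) ht]
  exact ((hF.enorm.pow_const q.toReal).lintegral_prod_left').pow_const _

/-- Swapping the order of mixed norms. -/
theorem lintegral_eLpNorm_le [IsProbabilityMeasure μ] {q : ℝ≥0∞} (h1 : 1 ≤ q)
    {F : Ω → Ω → ℝ} (hF : Measurable (Function.uncurry F)) {K : ℝ≥0∞}
    (h : ∀ x, eLpNorm (fun y => F x y) q μ ≤ K) :
    ∫⁻ y, eLpNorm (fun x => F x y) q μ ∂μ ≤ K := by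
  by_cases ht : q = ∞
  · subst ht
    simp only [eLpNorm_exponent_top] at h ⊢
    have h2 : ∀ᵐ x ∂μ, ∀ᵐ y ∂μ, ‖F x y‖ₑ ≤ K :=
      Filter.Eventually.of_forall fun x => (ae_le_eLpNormEssSup).mono fun y hy => hy.trans (h x)
    have h3 := (Measure.ae_ae_comm (p := fun x y => ‖F x y‖ₑ ≤ K)
      (measurableSet_le hF.enorm measurable_const)).1 h2
    calc _ ≤ ∫⁻ _, K ∂μ := by
          refine lintegral_mono_ae (h3.mono fun y hy => ?_)
          exact eLpNormEssSup_le_of_ae_enorm_bound hy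
      _ = K := by simp
  · have hr := one_le_toReal h1 ht
    have hr0 : 0 < q.toReal := by positivity
    have hm := measurable_eLpNorm_left (μ := μ) h1 ht hF
    -- On a probability space the outer L^1-norm is at most the outer L^q-norm, and the latter can
    -- be exchanged with the inner one by Tonelli's theorem.
    have h2 : eLpNorm (fun y => eLpNorm (fun x => F x y) q μ) 1 μ ≤
        eLpNorm (fun y => eLpNorm (fun x => F x y) q μ) q μ :=
      eLpNorm_le_eLpNorm_of_exponent_le h1 hm.aestronglyMeasurable
    rw [eLpNorm_one_eq_lintegral_enorm,
      eLpNorm_eq_lintegral_rpow_enorm_toReal (by rintro rfl; simp at h1) ht] at h2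
    simp only [enorm_eq_self] at h2
    refine h2.trans ?_
    rw [← lintegral_eLpNorm_rpow_swap h1 ht hF, one_div, ENNReal.rpow_inv_le_iff hr0]
    calc _ ≤ ∫⁻ _, K ^ q.toReal ∂μ := lintegral_mono fun x => ENNReal.rpow_le_rpow (h x) hr0.le
      _ = _ := by simp

end swap

/-! ### Polynomials as pairings of coefficients with families -/

section pairing

variable {ι : Type*} [Fintype ι] {I : Type*} {d : I → ℕ} {S : Finset I}
variable {E : Type*} [NormedAddCommGroup E] [NormedSpace ℂ E]

/-- The pairing `r ↦ ∑ d_σ tr(A^σ r^σ)` of a matrix over `𝓛_E(S)` with a family of scalar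
matrices. -/
def pairMap (A : Matrix ι ι (CoeffSpace d E S)) : MatFam d S →ₗ[ℂ] Matrix ι ι E where
  toFun r := of fun i j => ∑ σ : S, (d σ : ℂ) • ∑ k, ∑ l, r σ l k • A i j σ k l
  map_add' r s := by
    ext i j
    simp only [of_apply, Pi.add_apply, Matrix.add_apply, add_smul, Finset.sum_add_distrib, smul_add]
  map_smul' c r := by
    ext i j
    simp only [of_apply, Pi.smul_apply, Matrix.smul_apply, smul_eq_mul, Finset.smul_sum,
      RingHom.id_apply, smul_smul]
    refine Finset.sum_congr rfl fun σ _ => Finset.sum_congr rfl fun k _ =>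
      Finset.sum_congr rfl fun l _ => ?_
    congr 1
    ring

/-- Cyclicity of the trace, tr(Axy) = tr(yAx): a factor on the right of the system becomes a left
multiplication of the coefficients. -/
theorem pairMap_mul (A : Matrix ι ι (CoeffSpace d E S)) (x y : MatFam d S) :
    pairMap A (x * y) = pairMap (A.map (lmul y)) x := by
  ext i j
  simp only [pairMap, LinearMap.coe_mk, AddHom.coe_mk, of_apply, map_apply, lmul, Pi.mul_apply,
    mul_apply, sandwich_apply]
  refine Finset.sum_congr rfl fun σ _ => congrArg _ ?_
  calc _ = ∑ k, ∑ l, ∑ m, x σ l m • y σ m k • A i j σ k l := by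
        simp only [Finset.sum_smul, smul_smul]
    _ = ∑ m, ∑ l, ∑ k, x σ l m • y σ m k • A i j σ k l := by
        rw [Finset.sum_congr rfl fun k _ => Finset.sum_comm, Finset.sum_comm]
        exact Finset.sum_congr rfl fun m _ => Finset.sum_comm
    _ = _ := by
        refine Finset.sum_congr rfl fun m _ => Finset.sum_congr rfl fun l _ => ?_
        rw [Finset.smul_sum]
        refine Finset.sum_congr rfl fun k _ => ?_
        rw [Finset.sum_eq_single l (fun b _ hb => by simp [hb]) (by simp)]
        simp

variable [OperatorSpace E] {Ω : Type*} [MeasurableSpace Ω] {μ : Measure Ω}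

/-- The restriction of a system to a finite set of indices. -/
def sysFam (S : Finset I) (φ : System Ω d) (ω : Ω) : MatFam d S := fun σ => φ σ ω

/-- The seminorm `r ↦ ‖a · (∑ d_σ tr(A^σ r^σ)) · b‖_{S^q(E)}`. -/
def pairSeminorm {q : ℝ≥0∞} (h1 : 1 ≤ q) (a b : Matrix ι ι ℂ)
    (A : Matrix ι ι (CoeffSpace d E S)) : Seminorm ℂ (MatFam d S) :=
  (vsnSeminorm q h1).comp ((sandwichLin a b).comp (pairMap A))

theorem pairSeminorm_apply {q : ℝ≥0∞} (h1 : 1 ≤ q) (a b : Matrix ι ι ℂ)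
    (A : Matrix ι ι (CoeffSpace d E S)) (r : MatFam d S) :
    pairSeminorm h1 a b A r = vectorSchattenNorm q (sandwich a (pairMap A r) b) := rfl

theorem sandwich_fun_apply {n : ℕ} (a b : Matrix (Fin n) (Fin n) ℂ)
    (f : Matrix (Fin n) (Fin n) (Ω → E)) (ω : Ω) :
    (of fun i j => sandwich a f b i j ω) = sandwich a (of fun i j => f i j ω) b := by
  ext i j
  simp [sandwich_apply, Finset.sum_apply]

theorem map_inverseTransform_apply (φ : System Ω d) {n : ℕ}
    (A : Matrix (Fin n) (Fin n) (CoeffSpace d E S)) (ω : Ω) :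
    (of fun i j => (A.map (inverseTransform E φ S)).map Subtype.val i j ω) =
      pairMap A (sysFam S φ ω) := rfl

theorem pairSeminorm_sysFam {q : ℝ≥0∞} (h1 : 1 ≤ q) (φ : System Ω d) {n : ℕ}
    (a b : Matrix (Fin n) (Fin n) ℂ) (A : Matrix (Fin n) (Fin n) (CoeffSpace d E S)) :
    (fun ω => pairSeminorm h1 a b A (sysFam S φ ω)) = fun ω => vectorSchattenNorm q
      (of fun i j => sandwich a ((A.map (inverseTransform E φ S)).map Subtype.val) b i j ω) := by
  ext ω
  rw [sandwich_fun_apply, pairSeminorm_apply, map_inverseTransform_apply]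

theorem eLpNorm_pairSeminorm_le_polyGauge {q : ℝ≥0∞} (h1 : 1 ≤ q) (φ : System Ω d) {n : ℕ}
    {a b : Matrix (Fin n) (Fin n) ℂ} (ha : schattenNorm (2 * q) a ≤ 1)
    (hb : schattenNorm (2 * q) b ≤ 1) (A : Matrix (Fin n) (Fin n) (CoeffSpace d E S)) :
    eLpNorm (fun ω => pairSeminorm h1 a b A (sysFam S φ ω)) q μ ≤
      polyGauge μ E φ S q n (A.map (inverseTransform E φ S)) := by
  rw [pairSeminorm_sysFam, polyGauge, functionGauge]
  exact le_matrixGauge (fun k (f : Matrix (Fin k) (Fin k) (Ω → E)) => eLpNorm (fun ω => vectorSchattenNorm q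
    (of fun i j => f i j ω)) q μ) ha hb ((A.map (inverseTransform E φ S)).map Subtype.val)

theorem polyGauge_inverseTransform_le {q : ℝ≥0∞} (h1 : 1 ≤ q) (φ : System Ω d) {n : ℕ}
    {A : Matrix (Fin n) (Fin n) (CoeffSpace d E S)} {K : ℝ≥0∞}
    (h : ∀ a b : Matrix (Fin n) (Fin n) ℂ, schattenNorm (2 * q) a ≤ 1 →
      schattenNorm (2 * q) b ≤ 1 →
      eLpNorm (fun ω => pairSeminorm h1 a b A (sysFam S φ ω)) q μ ≤ K) :
    polyGauge μ E φ S q n (A.map (inverseTransform E φ S)) ≤ K := by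
  rw [polyGauge, functionGauge]
  refine matrixGauge_le fun a b ha hb => ?_
  have := h a b ha hb
  rwa [pairSeminorm_sysFam] at this

end pairing

/-! ### The reproducing formula -/

section ubqos

variable {Ω : Type*} [MeasurableSpace Ω] {μ : Measure Ω} {I : Type*} {d : I → ℕ} {φ : System Ω d}
  {S : Finset I}

theorem IsUBQOS.ae_opNorm_le (hφ : IsUBQOS μ φ) (S : Finset I) :
    ∀ᵐ ω ∂μ, ∀ σ : S, opNorm (sysFam S φ ω σ) ≤ (uniformBound μ φ).toReal := by
  rw [ae_all_iff]
  intro σ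
  have h := ENNReal.ae_le_essSup (μ := μ) fun ω => ENNReal.ofReal (opNorm (φ σ ω))
  filter_upwards [h] with ω hω
  have h2 : ENNReal.ofReal (opNorm (φ σ ω)) ≤ uniformBound μ φ :=
    hω.trans (le_iSup (fun σ : I => essSup (fun ω => ENNReal.ofReal (opNorm (φ σ ω))) μ) σ)
  exact (ENNReal.ofReal_le_iff_le_toReal hφ.bounded.ne).1 h2

theorem IsUBQOS.integrable_mul_star (hφ : IsUBQOS μ φ) (σ : S) (i j k l : Fin (d σ)) :
    Integrable (fun ω => φ σ ω i j * star (φ σ ω k l)) μ := by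
  have := hφ.isProbabilityMeasure
  refine Integrable.of_bound (C := (uniformBound μ φ).toReal * (uniformBound μ φ).toReal)
    ((hφ.measurable σ i j).mul (continuous_star.measurable.comp (hφ.measurable σ k l))).aestronglyMeasurable ?_
  filter_upwards [hφ.ae_opNorm_le S] with ω hω
  rw [norm_mul, norm_star]
  exact mul_le_mul ((norm_apply_le_opNorm _ _ _).trans (hω σ))
    ((norm_apply_le_opNorm _ _ _).trans (hω σ)) (norm_nonneg _) ENNReal.toReal_nonneg

/-- The family of adjoints. -/
def famStar (r : MatFam d S) : MatFam d S := fun σ => (r σ)ᴴ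

/-- The (i, j) entry is ∑_k ∫ φ_ik φ̄_jk, that is d_σ equal terms 1/d_σ when i = j. Only the
relations within a single σ enter. -/
theorem IsUBQOS.integral_mul_star (hφ : IsUBQOS μ φ) :
    ∫ ω, famVec (sysFam S φ ω * famStar (sysFam S φ ω)) ∂μ = famVec (1 : MatFam d S) := by
  have hint : ∀ k : (σ : S) × (Fin (d σ) × Fin (d σ)), Integrable (fun ω =>
      famVec (sysFam S φ ω * famStar (sysFam S φ ω)) k) μ := by
    rintro ⟨σ, i, j⟩
    have : (fun ω => famVec (sysFam S φ ω * famStar (sysFam S φ ω)) ⟨σ, i, j⟩) =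
        fun ω => ∑ k, φ σ ω i k * star (φ σ ω j k) := rfl
    rw [this]
    exact integrable_finsetSum _ fun k _ => hφ.integrable_mul_star σ i k j k
  ext k
  rw [eval_integral hint]
  obtain ⟨σ, i, j⟩ := k
  have : (fun ω => famVec (sysFam S φ ω * famStar (sysFam S φ ω)) ⟨σ, i, j⟩) =
      fun ω => ∑ k, φ σ ω i k * star (φ σ ω j k) := rfl
  rw [this, integral_finsetSum _ fun k _ => hφ.integrable_mul_star σ i k j k]
  simp only [hφ.orthonormal_self]
  have hd : (d σ : ℂ) ≠ 0 := by exact_mod_cast (hφ.size_pos σ).ne'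
  have h1 : famVec (1 : MatFam d S) ⟨σ, i, j⟩ = if i = j then 1 else 0 := one_apply
  rw [h1]
  by_cases hij : i = j
  · simp [hij, hd]
  · simp [hij]

theorem measurable_famVec {X : Type*} [MeasurableSpace X] {r : X → MatFam d S}
    (hr : ∀ σ i j, Measurable fun x => r x σ i j) : Measurable fun x => famVec (r x) :=
  measurable_pi_lambda _ fun k => hr k.1 k.2.1 k.2.2

/-- Jensen's inequality for the reproducing formula `1 = ∫ φ φ*`. -/
theorem IsUBQOS.seminorm_one_le (hφ : IsUBQOS μ φ) (N : Seminorm ℂ (MatFam d S)) :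
    ENNReal.ofReal (N 1) ≤
      ∫⁻ ω, ENNReal.ofReal (N (sysFam S φ ω * famStar (sysFam S φ ω))) ∂μ := by
  have := hφ.isProbabilityMeasure
  have hm : ∀ σ i j, Measurable fun ω => (sysFam S φ ω * famStar (sysFam S φ ω)) σ i j :=
    fun σ => measurable_mul_apply (hφ.measurable σ) fun i j => continuous_star.measurable.comp (hφ.measurable σ j i)
  have hmv := measurable_famVec hm
  obtain ⟨C, hC, hN⟩ := exists_seminorm_fam_le N
  have hbd : ∀ᵐ ω ∂μ, ∀ σ, opNorm ((sysFam S φ ω * famStar (sysFam S φ ω)) σ) ≤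
      (uniformBound μ φ).toReal * (uniformBound μ φ).toReal := by
    filter_upwards [hφ.ae_opNorm_le S] with ω hω σ
    refine (opNorm_mul_le _ _).trans (mul_le_mul (hω σ) ?_ (opNorm_nonneg _)
      ENNReal.toReal_nonneg)
    exact (opNorm_conjTranspose _).le.trans (hω σ)
  have hi1 : Integrable (fun ω => famVec (sysFam S φ ω * famStar (sysFam S φ ω))) μ := by
    refine Integrable.of_bound hmv.aestronglyMeasurable
      ((uniformBound μ φ).toReal * (uniformBound μ φ).toReal) ?_
    filter_upwards [hbd] with ω hω
    exact (pi_norm_le_iff_of_nonneg (by positivity)).2 fun k =>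
      (norm_apply_le_opNorm ((sysFam S φ ω * famStar (sysFam S φ ω)) k.1) _ _).trans (hω k.1)
  have hi2 : Integrable (fun ω => N (sysFam S φ ω * famStar (sysFam S φ ω))) μ := by
    refine Integrable.of_bound (measurable_seminorm_fam N hm).aestronglyMeasurable
      (C * ((uniformBound μ φ).toReal * (uniformBound μ φ).toReal)) ?_
    filter_upwards [hbd] with ω hω
    rw [Real.norm_of_nonneg (apply_nonneg N _)]
    exact hN _ _ (by positivity) hω
  have hj := (N.comp famOfVec).convexOn.map_integral_le (μ := μ)
    (continuous_seminorm_pi (N.comp famOfVec)).continuousOn isClosed_univ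
    (Filter.Eventually.of_forall fun _ => Set.mem_univ _) hi1 hi2
  rw [hφ.integral_mul_star] at hj
  rw [← ofReal_integral_eq_lintegral_ofReal hi2
    (Filter.Eventually.of_forall fun _ => apply_nonneg N _)]
  exact ENNReal.ofReal_le_ofReal hj

end ubqos

end

section

/-! ### Transfer of type -/

section type

variable {Ω : Type*} [MeasurableSpace Ω] {μ : Measure Ω} {I : Type*} {d : I → ℕ} {φ : System Ω d}
  {S : Finset I} {ρ : ∀ σ : I, Ω → Matrix.orthogonalGroup (Fin (d σ)) ℝ}

/-- Left multiplication by a family of matrices. -/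
def famMulLeft (x : MatFam d S) : MatFam d S →ₗ[ℂ] MatFam d S where
  toFun y := x * y
  map_add' y z := mul_add x y z
  map_smul' c y := by
    ext σ : 1
    exact Matrix.mul_smul (x σ) c (y σ)

/-- After Jensen's inequality, M(φφ*ρ) is the seminorm y ↦ M(φy) at φ*ρ, and the contraction
principle removes φ*. That seminorm varies with ω, which is why the hypothesis quantifies over M
inside the almost everywhere statement. -/
theorem ofReal_rhoSeminorm_one_le (hφ : IsUBQOS μ φ) (hρ : IsQuantizedRademacher μ ρ)
    {q : ℝ≥0∞} (h1 : 1 ≤ q) {c : ℝ} (hc : 0 ≤ c)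
    (hcontr : ∀ᵐ ω ∂μ, ∀ M : Seminorm ℂ (MatFam d S),
      rhoSeminorm hρ h1 M (famStar (sysFam S φ ω)) ≤ c * rhoSeminorm hρ h1 M 1)
    (M : Seminorm ℂ (MatFam d S)) :
    ENNReal.ofReal (rhoSeminorm hρ h1 M 1) ≤
      ENNReal.ofReal c * ∫⁻ ω, ENNReal.ofReal (rhoSeminorm hρ h1 M (sysFam S φ ω)) ∂μ := by
  refine (hφ.seminorm_one_le (rhoSeminorm hρ h1 M)).trans ?_
  rw [← lintegral_const_mul' _ _ ENNReal.ofReal_ne_top]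
  refine lintegral_mono_ae (hcontr.mono fun ω hω => ?_)
  have h2 := hω (M.comp (famMulLeft (sysFam S φ ω)))
  have e1 : rhoSeminorm hρ h1 (M.comp (famMulLeft (sysFam S φ ω))) (famStar (sysFam S φ ω)) =
      rhoSeminorm hρ h1 M (sysFam S φ ω * famStar (sysFam S φ ω)) := by
    refine congrArg ENNReal.toReal (congrArg (fun f => eLpNorm f q μ) ?_)
    ext ω'
    exact congrArg M (mul_assoc _ _ _).symm
  have e2 : rhoSeminorm hρ h1 (M.comp (famMulLeft (sysFam S φ ω))) 1 =
      rhoSeminorm hρ h1 M (sysFam S φ ω) := by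
    refine congrArg ENNReal.toReal (congrArg (fun f => eLpNorm f q μ) ?_)
    ext ω'
    exact congrArg (fun x => M (sysFam S φ ω * x)) (one_mul _)
  rw [e1, e2] at h2
  rw [← ENNReal.ofReal_mul hc]
  exact ENNReal.ofReal_le_ofReal h2

theorem measurable_seminorm_mul (hφ : IsUBQOS μ φ) (hρ : IsQuantizedRademacher μ ρ)
    (M : Seminorm ℂ (MatFam d S)) :
    Measurable (Function.uncurry fun ω ω' => M (sysFam S φ ω' * rhoFam S ρ ω)) := by
  refine measurable_seminorm_fam M fun σ => measurable_mul_apply (fun i j => ?_) fun i j => ?_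
  · exact (hφ.measurable σ i j).comp measurable_snd
  · exact (measurable_rhoFam_apply hρ σ i j).comp measurable_fst

variable {E : Type*} [NormedAddCommGroup E] [NormedSpace ℂ E] [OperatorSpace E]

theorem pairSeminorm_mul {ι : Type*} [Fintype ι] {q : ℝ≥0∞} (h1 : 1 ≤ q) (a b : Matrix ι ι ℂ)
    (A : Matrix ι ι (CoeffSpace d E S)) (x y : MatFam d S) :
    pairSeminorm h1 a b A (x * y) = pairSeminorm h1 a b (A.map (lmul y)) x := by
  rw [pairSeminorm_apply, pairSeminorm_apply, pairMap_mul]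

theorem coeffGauge_rotate_le {q : ℝ≥0∞} (h1 : 1 ≤ q) {n : ℕ}
    (A : Matrix (Fin n) (Fin n) (CoeffSpace d E S)) (ω : Ω) :
    coeffGauge d E S q n (A.map (lmul (rhoFam S ρ ω))) ≤ coeffGauge d E S q n A :=
  coeffGauge_map_lmul_le h1 (fun σ => complexify_conjTranspose_mul_self (ρ σ ω)) A

theorem polyGauge_le_typeConst {p : ℝ≥0∞} {n : ℕ}
    {A : Matrix (Fin n) (Fin n) (CoeffSpace d E S)} (hA : coeffGauge d E S p n A ≤ 1) :
    polyGauge μ E φ S p.conjExponent n (A.map (inverseTransform E φ S)) ≤ typeConst μ E φ p :=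
  le_iSup_of_le S (le_iSup₂_of_le n A (le_iSup_of_le hA le_rfl))

theorem coeffGauge_le_cotypeConst {p : ℝ≥0∞} {n : ℕ}
    {f : Matrix (Fin n) (Fin n) (polySpace E φ S)} (hf : polyGauge μ E φ S p n f ≤ 1) :
    coeffGauge d E S p.conjExponent n (f.map (transform μ E φ S)) ≤ cotypeConst μ E φ p :=
  le_iSup_of_le S (le_iSup₂_of_le n f (le_iSup_of_le hf le_rfl))

theorem typeConst_le_of_contraction (hφ : IsUBQOS μ φ) (hρ : IsQuantizedRademacher μ ρ)
    {p : ℝ≥0∞} (hp : 1 ≤ p) (hq : 1 ≤ p.conjExponent) {c : ℝ} (hc : 0 ≤ c)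
    (hcontr : ∀ S : Finset I, ∀ᵐ ω ∂μ, ∀ M : Seminorm ℂ (MatFam d S),
      rhoSeminorm hρ hq M (famStar (sysFam S φ ω)) ≤ c * rhoSeminorm hρ hq M 1) :
    typeConst μ E (orthogonalSystem ρ) p ≤ ENNReal.ofReal c * typeConst μ E φ p := by
  have := hφ.isProbabilityMeasure
  refine iSup_le fun S => iSup₂_le fun n A => iSup_le fun hA => ?_
  refine polyGauge_inverseTransform_le hq _ fun a b ha hb => ?_
  set M := pairSeminorm hq a b A with hM
  have e : (fun ω => M (sysFam S (orthogonalSystem ρ) ω)) =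
      fun ω => M (1 * rhoFam S ρ ω) := by
    ext ω
    rw [one_mul]
    rfl
  rw [e, ← ofReal_rhoSeminorm hρ hq]
  refine (ofReal_rhoSeminorm_one_le hφ hρ hq hc (hcontr S) M).trans ?_
  gcongr
  simp only [ofReal_rhoSeminorm]
  -- The bound has to hold for each frozen value of ρ. There the function is the Φ-polynomial of the
  -- rotated coefficients ρA, which still lie in the unit ball.
  refine lintegral_eLpNorm_le hq (measurable_seminorm_mul hφ hρ M) fun ω => ?_
  simp only [hM, pairSeminorm_mul]
  exact (eLpNorm_pairSeminorm_le_polyGauge hq φ ha hb _).trans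
    (polyGauge_le_typeConst ((coeffGauge_rotate_le hp A ω).trans hA))

end type

/-! ### Haar moments: quantized Rademacher systems are orthonormal -/

section haar

variable {Ω : Type*} [MeasurableSpace Ω] {μ : Measure Ω} {I : Type*} {d : I → ℕ}
  {ρ : ∀ σ : I, Ω → Matrix.orthogonalGroup (Fin (d σ)) ℝ}

/-- The diagonal sign matrices. -/
def signDiag {n : ℕ} (k : Fin n) : orthogonalGroup (Fin n) ℝ :=
  ⟨diagonal fun i => if i = k then -1 else 1, (mem_orthogonalGroup_iff (Fin n) ℝ).2 (by
    rw [diagonal_transpose, diagonal_mul_diagonal, ← diagonal_one]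
    congr 1
    ext i
    by_cases h : i = k <;> simp [h])⟩

/-- Permutation matrices. -/
def permOrth {n : ℕ} (π : Equiv.Perm (Fin n)) : orthogonalGroup (Fin n) ℝ :=
  ⟨(1 : Matrix (Fin n) (Fin n) ℝ).submatrix π id, (mem_orthogonalGroup_iff (Fin n) ℝ).2 (by
    ext i j
    simp [mul_apply, one_apply])⟩

variable {n : ℕ} (ν : Measure (orthogonalGroup (Fin n) ℝ)) [ν.IsMulLeftInvariant]
  [IsProbabilityMeasure ν]

theorem signDiag_mul_apply (k : Fin n) (u : orthogonalGroup (Fin n) ℝ) (i j : Fin n) :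
    ((signDiag k * u : orthogonalGroup (Fin n) ℝ) : Matrix (Fin n) (Fin n) ℝ) i j =
      (if i = k then -1 else 1) * (u : Matrix (Fin n) (Fin n) ℝ) i j := by
  exact diagonal_mul _ _ _ _

theorem permOrth_mul_apply (π : Equiv.Perm (Fin n)) (u : orthogonalGroup (Fin n) ℝ) (i j : Fin n) :
    ((permOrth π * u : orthogonalGroup (Fin n) ℝ) : Matrix (Fin n) (Fin n) ℝ) i j =
      (u : Matrix (Fin n) (Fin n) ℝ) (π i) j := by
  change (((1 : Matrix (Fin n) (Fin n) ℝ).submatrix π id) * (u : Matrix (Fin n) (Fin n) ℝ)) i j = _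
  simp [mul_apply, one_apply]

theorem integral_orthogonal_apply (i j : Fin n) :
    ∫ u, (u : Matrix (Fin n) (Fin n) ℝ) i j ∂ν = 0 := by
  have h := integral_mul_left_eq_self (μ := ν)
    (fun u : orthogonalGroup (Fin n) ℝ => (u : Matrix (Fin n) (Fin n) ℝ) i j) (signDiag i)
  simp only [signDiag_mul_apply, if_true, neg_mul, one_mul, integral_neg] at h
  linarith

/-- Changing the sign of row i preserves the invariant measure and negates the integrand. -/
theorem integral_orthogonal_mul_of_ne {i k : Fin n} (h : i ≠ k) (j l : Fin n) :
    ∫ u, (u : Matrix (Fin n) (Fin n) ℝ) i j * (u : Matrix (Fin n) (Fin n) ℝ) k l ∂ν = 0 := by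
  have h := integral_mul_left_eq_self (μ := ν) (fun u : orthogonalGroup (Fin n) ℝ =>
    (u : Matrix (Fin n) (Fin n) ℝ) i j * (u : Matrix (Fin n) (Fin n) ℝ) k l) (signDiag i)
  simp only [signDiag_mul_apply, if_true, neg_mul, one_mul, integral_neg, if_neg (Ne.symm ‹i ≠ k›)] at h
  linarith

theorem measurable_orthogonal_apply (i j : Fin n) :
    Measurable fun u : orthogonalGroup (Fin n) ℝ => (u : Matrix (Fin n) (Fin n) ℝ) i j :=
  have : Continuous fun u : orthogonalGroup (Fin n) ℝ => (u : Matrix (Fin n) (Fin n) ℝ) i j :=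
    (continuous_apply_apply i j).comp continuous_subtype_val
  this.measurable

theorem norm_orthogonal_apply_le (u : orthogonalGroup (Fin n) ℝ) (i j : Fin n) :
    ‖(u : Matrix (Fin n) (Fin n) ℝ) i j‖ ≤ 1 := by
  have h := (norm_apply_le_opNorm (complexify (u : Matrix (Fin n) (Fin n) ℝ)) i j).trans
    (opNorm_complexify_le_one u)
  simpa [complexify] using h

theorem integrable_orthogonal_mul (i j k l : Fin n) :
    Integrable (fun u : orthogonalGroup (Fin n) ℝ =>
      (u : Matrix (Fin n) (Fin n) ℝ) i j * (u : Matrix (Fin n) (Fin n) ℝ) k l) ν := by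
  refine Integrable.of_bound (C := 1) ((measurable_orthogonal_apply i j).mul
    (measurable_orthogonal_apply k l)).aestronglyMeasurable
    (Filter.Eventually.of_forall fun u => ?_)
  rw [norm_mul]
  exact mul_le_one₀ (norm_orthogonal_apply_le u i j) (norm_nonneg _)
    (norm_orthogonal_apply_le u k l)

/-- Row permutations show that the integral does not depend on the row, and the sum over the n rows
is an entry of uᵀu = 1. -/
theorem integral_orthogonal_mul_same (i j l : Fin n) :
    ∫ u, (u : Matrix (Fin n) (Fin n) ℝ) i j * (u : Matrix (Fin n) (Fin n) ℝ) i l ∂ν =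
      if j = l then 1 / (n : ℝ) else 0 := by
  have hk : ∀ k : Fin n,
      ∫ u, (u : Matrix (Fin n) (Fin n) ℝ) k j * (u : Matrix (Fin n) (Fin n) ℝ) k l ∂ν =
      ∫ u, (u : Matrix (Fin n) (Fin n) ℝ) i j * (u : Matrix (Fin n) (Fin n) ℝ) i l ∂ν := by
    intro k
    have h := integral_mul_left_eq_self (μ := ν) (fun u : orthogonalGroup (Fin n) ℝ =>
      (u : Matrix (Fin n) (Fin n) ℝ) i j * (u : Matrix (Fin n) (Fin n) ℝ) i l)
      (permOrth (Equiv.swap i k))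
    simpa only [permOrth_mul_apply, Equiv.swap_apply_left] using h
  have hs : ∑ k, ∫ u, (u : Matrix (Fin n) (Fin n) ℝ) k j * (u : Matrix (Fin n) (Fin n) ℝ) k l ∂ν =
      if j = l then 1 else 0 := by
    rw [← integral_finsetSum _ fun k _ => integrable_orthogonal_mul ν k j k l]
    have : ∀ u : orthogonalGroup (Fin n) ℝ, ∑ k, (u : Matrix (Fin n) (Fin n) ℝ) k j *
        (u : Matrix (Fin n) (Fin n) ℝ) k l = if j = l then 1 else 0 := by
      intro u
      have h2 : (u : Matrix (Fin n) (Fin n) ℝ)ᵀ * (u : Matrix (Fin n) (Fin n) ℝ) = 1 :=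
        (mem_orthogonalGroup_iff' (Fin n) ℝ).1 u.2
      have h3 := congrFun (congrFun h2 j) l
      rwa [mul_apply, one_apply] at h3
    simp [this]
  simp only [hk, Finset.sum_const, Finset.card_univ, Fintype.card_fin, nsmul_eq_mul] at hs
  have hn : (n : ℝ) ≠ 0 := by
    have := i.pos
    positivity
  rw [eq_div_of_mul_eq hn ((mul_comm _ _).trans hs)]
  split_ifs <;> simp

theorem orthogonalSystem_mul_star (σ τ : I) (ω : Ω) (i j : Fin (d σ)) (k l : Fin (d τ)) :
    orthogonalSystem ρ σ ω i j * star (orthogonalSystem ρ τ ω k l) =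
      (((ρ σ ω : Matrix (Fin (d σ)) (Fin (d σ)) ℝ) i j *
        (ρ τ ω : Matrix (Fin (d τ)) (Fin (d τ)) ℝ) k l : ℝ) : ℂ) := by
  simp [orthogonalSystem]

/-- Quantized Rademacher systems are uniformly bounded quantized orthonormal systems. -/
theorem IsQuantizedRademacher.isUBQOS (hρ : IsQuantizedRademacher μ ρ) (hμ : HasNoAtoms μ)
    (hd : ∀ σ, 0 < d σ) : IsUBQOS μ (orthogonalSystem ρ) := by
  have := hρ.isProbabilityMeasure
  have h1 : ∀ σ, (μ.map (ρ σ)).IsMulLeftInvariant := fun σ => (hρ.haar σ).toIsMulLeftInvariant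
  have h2 : ∀ σ, IsProbabilityMeasure (μ.map (ρ σ)) := fun σ =>
    Measure.isProbabilityMeasure_map (hρ.measurable σ).aemeasurable
  refine ⟨this, hμ, hd, fun σ i j => ?_, fun σ i j k l => ?_, fun σ τ hστ i j k l => ?_, ?_⟩
  · exact (measurable_complexify_apply i j).comp (hρ.measurable σ)
  · simp only [orthogonalSystem_mul_star]
    rw [integral_complex_ofReal]
    have h3 := integral_map (μ := μ) (hρ.measurable σ).aemeasurable (f := fun u =>
      (u : Matrix (Fin (d σ)) (Fin (d σ)) ℝ) i j * (u : Matrix (Fin (d σ)) (Fin (d σ)) ℝ) k l)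
      ((measurable_orthogonal_apply i j).mul
        (measurable_orthogonal_apply k l)).aestronglyMeasurable
    rw [← h3]
    by_cases hik : i = k
    · subst hik
      rw [integral_orthogonal_mul_same]
      by_cases hjl : j = l <;> simp [hjl]
    · rw [integral_orthogonal_mul_of_ne _ hik]
      simp [hik]
  · simp only [orthogonalSystem_mul_star]
    rw [integral_complex_ofReal]
    have h3 := ((hρ.indep.indepFun hστ).comp (measurable_orthogonal_apply i j)
      (measurable_orthogonal_apply k l)).integral_fun_mul_eq_mul_integral
      ((measurable_orthogonal_apply i j).comp (hρ.measurable σ)).aestronglyMeasurable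
      ((measurable_orthogonal_apply k l).comp (hρ.measurable τ)).aestronglyMeasurable
    simp only [Function.comp_apply] at h3
    have h4 := integral_map (μ := μ) (hρ.measurable σ).aemeasurable (f := fun u =>
      (u : Matrix (Fin (d σ)) (Fin (d σ)) ℝ) i j)
      (measurable_orthogonal_apply i j).aestronglyMeasurable
    rw [integral_orthogonal_apply] at h4
    rw [h3, ← h4]
    simp
  · refine lt_of_le_of_lt (iSup_le fun σ => essSup_le_of_ae_le 1 ?_) ENNReal.one_lt_top
    refine Filter.Eventually.of_forall fun ω => ?_
    exact ENNReal.ofReal_le_one.2 (opNorm_complexify_le_one (ρ σ ω))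

end haar

/-! ### Inversion of the transform -/

section inversion

variable {Ω : Type*} [MeasurableSpace Ω] {μ : Measure Ω} {I : Type*} {d : I → ℕ} {φ : System Ω d}
  {S : Finset I} {E : Type*} [NormedAddCommGroup E] [NormedSpace ℂ E]

theorem IsUBQOS.integrable_star_mul (hφ : IsUBQOS μ φ) (σ τ : I) (i j : Fin (d σ))
    (k l : Fin (d τ)) : Integrable (fun ω => star (φ σ ω i j) * φ τ ω k l) μ := by
  classical
  have := hφ.isProbabilityMeasure
  refine Integrable.of_bound (C := (uniformBound μ φ).toReal * (uniformBound μ φ).toReal)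
    ((continuous_star.measurable.comp (hφ.measurable σ i j)).mul
      (hφ.measurable τ k l)).aestronglyMeasurable ?_
  filter_upwards [hφ.ae_opNorm_le {σ, τ}] with ω hω
  rw [norm_mul, norm_star]
  exact mul_le_mul ((norm_apply_le_opNorm _ _ _).trans (hω ⟨σ, by simp⟩))
    ((norm_apply_le_opNorm _ _ _).trans (hω ⟨τ, by simp⟩)) (norm_nonneg _) ENNReal.toReal_nonneg

/-- Expanding the finite sums leaves scalar orthonormality integrals; the factor d_σ in the inverse
transform cancels their value 1/d_σ. -/
theorem IsUBQOS.transform_inverseTransform [CompleteSpace E] (hφ : IsUBQOS μ φ)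
    (A : CoeffSpace d E S) : transform μ E φ S (inverseTransform E φ S A) = A := by
  classical
  ext σ i j
  have hd : (d σ : ℂ) ≠ 0 := by exact_mod_cast (hφ.size_pos σ).ne'
  have e1 : transform μ E φ S (inverseTransform E φ S A) σ i j =
      ∫ ω, ∑ τ : S, ∑ k, ∑ l, ((star (φ σ ω j i) * φ τ ω l k) • ((d τ : ℂ) • A τ k l)) ∂μ := by
    refine integral_congr_ae (Filter.Eventually.of_forall fun ω => ?_)
    simp only [inverseTransform, Finset.smul_sum, smul_smul]
    refine Finset.sum_congr rfl fun τ _ => Finset.sum_congr rfl fun k _ =>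
      Finset.sum_congr rfl fun l _ => ?_
    congr 1
    ring
  have hint : ∀ (τ : S) (k l), Integrable
      (fun ω => (star (φ σ ω j i) * φ τ ω l k) • ((d τ : ℂ) • A τ k l)) μ := fun τ k l =>
    (hφ.integrable_star_mul σ τ j i l k).smul_const _
  have e2 : ∀ (τ : S) (k l), ∫ ω, star (φ σ ω j i) * φ τ ω l k ∂μ =
      ∫ ω, φ τ ω l k * star (φ σ ω j i) ∂μ := fun τ k l => by
    simp only [mul_comm]
  rw [e1, integral_finsetSum _ fun τ _ => integrable_finsetSum _ fun k _ =>
    integrable_finsetSum _ fun l _ => hint τ k l]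
  rw [Finset.sum_eq_single σ]
  · rw [integral_finsetSum _ fun k _ => integrable_finsetSum _ fun l _ => hint σ k l,
      Finset.sum_eq_single i]
    · rw [integral_finsetSum _ fun l _ => hint σ i l, Finset.sum_eq_single j]
      · rw [integral_smul_const, e2, hφ.orthonormal_self, smul_smul]
        simp [hd]
      · intro l _ hl
        rw [integral_smul_const, e2, hφ.orthonormal_self]
        simp [hl]
      · simp
    · intro k _ hk
      rw [integral_finsetSum _ fun l _ => hint σ k l]
      refine Finset.sum_eq_zero fun l _ => ?_
      rw [integral_smul_const, e2, hφ.orthonormal_self]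
      simp [hk]
    · simp
  · intro τ _ hτ
    rw [integral_finsetSum _ fun k _ => integrable_finsetSum _ fun l _ => hint τ k l]
    refine Finset.sum_eq_zero fun k _ => ?_
    rw [integral_finsetSum _ fun l _ => hint τ k l]
    refine Finset.sum_eq_zero fun l _ => ?_
    rw [integral_smul_const, e2, hφ.orthogonal τ σ fun h => hτ (Subtype.ext h), zero_smul]
  · simp

/-- The generator φ_ij e comes from the coefficient with the single entry d_σ⁻¹ e in position (j,
i). Cotype estimates may thus be stated for coefficients instead of functions. -/
theorem inverseTransform_surjective (φ : System Ω d) (hd : ∀ σ, 0 < d σ) :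
    Function.Surjective (inverseTransform E φ S) := by
  classical
  rintro ⟨f, hf⟩
  suffices ∃ A : CoeffSpace d E S, (inverseTransform E φ S A : Ω → E) = f by
    obtain ⟨A, hA⟩ := this
    exact ⟨A, Subtype.ext hA⟩
  induction hf using Submodule.span_induction with
  | mem f hf =>
    obtain ⟨σ, hσ, i, j, e, rfl⟩ := hf
    have hdσ : (d σ : ℂ) ≠ 0 := by exact_mod_cast (hd σ).ne'
    refine ⟨Pi.single ⟨σ, hσ⟩ (Matrix.single j i ((d σ : ℂ)⁻¹ • e)), ?_⟩
    ext ω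
    simp only [inverseTransform]
    rw [Finset.sum_eq_single ⟨σ, hσ⟩, Finset.sum_eq_single j, Finset.sum_eq_single i]
    · rw [Pi.single_eq_same, Matrix.single_apply_same, smul_comm]
      change φ σ ω i j • (d σ : ℂ) • (d σ : ℂ)⁻¹ • e = φ σ ω i j • e
      rw [smul_inv_smul₀ hdσ]
    · intro l _ hl
      rw [Pi.single_eq_same, Matrix.single_apply_of_ne _ _ _ _ _ (fun h => hl h.2.symm), smul_zero]
    · simp
    · intro k _ hk
      refine Finset.sum_eq_zero fun l _ => ?_
      rw [Pi.single_eq_same, Matrix.single_apply_of_ne _ _ _ _ _ (fun h => hk h.1.symm), smul_zero]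
    · simp
    · intro τ _ hτ
      rw [Pi.single_eq_of_ne hτ]
      simp
    · simp
  | zero => exact ⟨0, by ext ω; simp [inverseTransform]⟩
  | add f g _ _ hf hg =>
    obtain ⟨A, hA⟩ := hf
    obtain ⟨B, hB⟩ := hg
    refine ⟨A + B, ?_⟩
    rw [← hA, ← hB]
    ext ω
    simp [inverseTransform, Finset.sum_add_distrib, smul_add]
  | smul c f _ hf =>
    obtain ⟨A, hA⟩ := hf
    refine ⟨c • A, ?_⟩
    rw [← hA]
    ext ω
    simp only [inverseTransform, Pi.smul_apply, Matrix.smul_apply, Finset.smul_sum]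
    refine Finset.sum_congr rfl fun σ _ => Finset.sum_congr rfl fun k _ =>
      Finset.sum_congr rfl fun l _ => ?_
    simp only [smul_smul]
    congr 1
    ring

end inversion

end

section

/-! ### Weights relative to a faithful state -/

section weights

variable {ι : Type*} [Fintype ι]

theorem mfun_rpow_mul {P : Matrix ι ι ℂ} (hP : P.PosDef) (u v : ℝ) :
    mfun P (fun x => x ^ u) * mfun P (fun x => x ^ v) = mfun P (fun x => x ^ (u + v)) := by
  rw [mfun_mul]
  exact mfun_congr_pos hP fun x hx => (Real.rpow_add hx u v).symm

theorem mfun_rpow_one {P : Matrix ι ι ℂ} (hP : P.PosDef) : mfun P (fun x => x ^ (1 : ℝ)) = P := by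
  simp only [Real.rpow_one]
  exact mfun_id hP.isHermitian

theorem mfun_rpow_mul_neg [DecidableEq ι] {P : Matrix ι ι ℂ} (hP : P.PosDef) (u : ℝ) :
    mfun P (fun x => x ^ u) * mfun P (fun x => x ^ (-u)) = 1 := by
  rw [mfun_rpow_mul hP]
  simp only [add_neg_cancel, Real.rpow_zero]
  exact mfun_one hP.isHermitian

theorem mfun_rpow_neg_mul [DecidableEq ι] {P : Matrix ι ι ℂ} (hP : P.PosDef) (u : ℝ) :
    mfun P (fun x => x ^ (-u)) * mfun P (fun x => x ^ u) = 1 := by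
  rw [mfun_rpow_mul hP]
  simp only [neg_add_cancel, Real.rpow_zero]
  exact mfun_one hP.isHermitian

/-- The weight `k P^{-s/2} Z^{s/2}`. -/
def weight (k s : ℝ) (P Z : Matrix ι ι ℂ) : Matrix ι ι ℂ :=
  (k : ℂ) • (mfun P (fun x => x ^ (-(s / 2))) * mfun Z (fun x => x ^ (s / 2)))

/-- The two factors P^{-s/2} combine with P under the trace, leaving k² tr(Z^s P^{1−s}), and Young's
trace inequality applies. -/
theorem re_trace_weight_le {s : ℝ} (hs0 : 0 < s) (hs1 : s ≤ 1) {P Z : Matrix ι ι ℂ}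
    (hP : P.PosDef) (hZ : Z.PosDef) (hP1 : P.trace.re = 1) {δ : ℝ} (hδ : 0 ≤ δ)
    (hZ1 : Z.trace.re ≤ 1 + δ) (k : ℝ) :
    (P * (weight k s P Z * (weight k s P Z)ᴴ)).trace.re ≤ k ^ 2 * (1 + δ) := by
  have e1 : weight k s P Z * (weight k s P Z)ᴴ = ((k ^ 2 : ℝ) : ℂ) •
      (mfun P (fun x => x ^ (-(s / 2))) * mfun Z (fun x => x ^ s) *
        mfun P (fun x => x ^ (-(s / 2)))) := by
    rw [weight, conjTranspose_smul, conjTranspose_mul, (mfun_isHermitian Z _).eq,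
      (mfun_isHermitian P _).eq, Matrix.smul_mul, Matrix.mul_smul, smul_smul,
      ← mfun_rpow_half_sq hZ.posSemidef s hs0.ne']
    simp only [Matrix.mul_assoc]
    congr 1
    simp [sq]
  have e2 : (P * (mfun P (fun x => x ^ (-(s / 2))) * mfun Z (fun x => x ^ s) *
        mfun P (fun x => x ^ (-(s / 2))))).trace =
      (mfun Z (fun x => x ^ s) * mfun P (fun x => x ^ (1 - s))).trace := by
    have e3 : mfun P (fun x => x ^ (-(s / 2))) * (P * mfun P (fun x => x ^ (-(s / 2)))) =
        mfun P (fun x => x ^ (1 - s)) := by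
      nth_rewrite 2 [← mfun_rpow_one hP]
      rw [mfun_rpow_mul hP, mfun_rpow_mul hP]
      congr 1
      ext x
      congr 1
      ring
    rw [← e3, trace_mul_comm, Matrix.mul_assoc, Matrix.mul_assoc, trace_mul_comm]
    simp only [Matrix.mul_assoc]
  rw [e1, Matrix.mul_smul, trace_smul, e2, smul_eq_mul, Complex.re_ofReal_mul]
  refine mul_le_mul_of_nonneg_left ?_ (sq_nonneg k)
  refine (re_trace_young hs0 hs1 hZ.posSemidef hP.posSemidef).trans ?_
  rw [hP1]
  nlinarith

theorem weight_mul [DecidableEq ι] (k s : ℝ) {P Z : Matrix ι ι ℂ} (hP : P.PosDef) (hZ : Z.PosDef) :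
    weight k s P Z * (mfun Z (fun x => x ^ (-(s / 2))) * mfun P (fun x => x ^ (s / 2))) =
      (k : ℂ) • 1 := by
  rw [weight, Matrix.smul_mul, Matrix.mul_assoc, ← Matrix.mul_assoc (mfun Z _),
    mfun_rpow_mul_neg hZ, Matrix.one_mul, mfun_rpow_neg_mul hP]

theorem mul_weight_conjTranspose [DecidableEq ι] (k s : ℝ) {P Z : Matrix ι ι ℂ} (hP : P.PosDef)
    (hZ : Z.PosDef) :
    mfun P (fun x => x ^ (s / 2)) * mfun Z (fun x => x ^ (-(s / 2))) * (weight k s P Z)ᴴ =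
      (k : ℂ) • 1 := by
  have h := congrArg conjTranspose (weight_mul k s hP hZ)
  rw [conjTranspose_mul, conjTranspose_mul, (mfun_isHermitian Z _).eq,
    (mfun_isHermitian P _).eq, conjTranspose_smul, conjTranspose_one] at h
  simpa using h

theorem rs_mfun_rpow_le_one {p : ℝ≥0∞} (h1 : 1 ≤ p) (ht : p ≠ ∞) {P : Matrix ι ι ℂ}
    (hP : P.PosDef) (hP1 : P.trace.re = 1) : rs p (mfun P fun x => x ^ (1 / p.toReal)) ≤ 1 := by
  have hr := one_le_toReal h1 ht
  have hr0 : 0 < p.toReal := by positivity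
  have hpsd := mfun_posSemidef hP.posSemidef (f := fun x => x ^ (1 / p.toReal))
    fun x hx => Real.rpow_nonneg hx _
  have h2 := rs_rpow h1 ht hpsd
  have h4 : mfun P (fun x => (x ^ (1 / p.toReal)) ^ p.toReal) = mfun P (fun x => x) :=
    mfun_congr hP.posSemidef fun x hx => by
      rw [← Real.rpow_mul hx, one_div_mul_cancel hr0.ne', Real.rpow_one]
  rw [mfun_mfun hP.isHermitian, h4, mfun_id hP.isHermitian, hP1] at h2
  refine le_of_not_gt fun h3 => ?_
  exact (Real.one_lt_rpow h3 hr0).ne' h2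

theorem schattenNorm_mfun_rpow_le_one {p : ℝ≥0∞} (h1 : 1 ≤ p) (ht : p ≠ ∞) {P : Matrix ι ι ℂ}
    (hP : P.PosDef) (hP1 : P.trace.re = 1) :
    schattenNorm (2 * p) (mfun P fun x => x ^ (1 / p.toReal / 2)) ≤ 1 := by
  have hr := one_le_toReal h1 ht
  rw [schattenNorm_two_mul' h1, sqrt_le_one_iff, (mfun_isHermitian P _).eq,
    mfun_rpow_half_sq hP.posSemidef _ (by positivity)]
  exact rs_mfun_rpow_le_one h1 ht hP hP1

end weights

/-! ### Transfer of cotype -/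

section cotype

variable {Ω : Type*} [MeasurableSpace Ω] {μ : Measure Ω} {I : Type*} {d : I → ℕ} {φ : System Ω d}
  {S : Finset I} {ρ : ∀ σ : I, Ω → Matrix.orthogonalGroup (Fin (d σ)) ℝ}

/-- Some value is at most the mean. The mean of the p-th powers over ω is computed by Tonelli with
φ(ω') held fixed, where the contraction principle bounds the inner norm. -/
theorem exists_rotation_le (hφ : IsUBQOS μ φ) (hρ : IsQuantizedRademacher μ ρ)
    {p : ℝ≥0∞} (h1 : 1 ≤ p) (ht : p ≠ ∞) {c : ℝ} (hc : 0 ≤ c)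
    (hcontr : ∀ᵐ ω ∂μ, ∀ M : Seminorm ℂ (MatFam d S),
      rhoSeminorm hρ h1 M (sysFam S φ ω) ≤ c * rhoSeminorm hρ h1 M 1)
    (M : Seminorm ℂ (MatFam d S)) :
    ∃ ω, eLpNorm (fun ω' => M (sysFam S φ ω' * rhoFam S ρ ω)) p μ ≤
      ENNReal.ofReal c * eLpNorm (fun ω => M (rhoFam S ρ ω)) p μ := by
  have := hφ.isProbabilityMeasure
  have hr := one_le_toReal h1 ht
  have hr0 : 0 < p.toReal := by positivity
  have hF := measurable_seminorm_mul (S := S) hφ hρ M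
  have hm : Measurable fun ω => eLpNorm (fun ω' => M (sysFam S φ ω' * rhoFam S ρ ω)) p μ :=
    measurable_eLpNorm_left (F := fun ω' ω => M (sysFam S φ ω' * rhoFam S ρ ω)) h1 ht
      (hF.comp measurable_swap)
  obtain ⟨ω, hω⟩ := exists_le_lintegral (μ := μ) (hm.pow_const p.toReal).aemeasurable
  refine ⟨ω, ?_⟩
  rw [← ENNReal.rpow_le_rpow_iff hr0]
  refine hω.trans ?_
  rw [lintegral_eLpNorm_rpow_swap h1 ht hF]
  calc _ ≤ ∫⁻ _, (ENNReal.ofReal c * eLpNorm (fun ω => M (rhoFam S ρ ω)) p μ) ^ p.toReal ∂μ := by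
        refine lintegral_mono_ae (hcontr.mono fun ω' hω' => ENNReal.rpow_le_rpow ?_ hr0.le)
        rw [← ofReal_rhoSeminorm hρ h1]
        refine (ENNReal.ofReal_le_ofReal (hω' M)).trans (le_of_eq ?_)
        rw [ENNReal.ofReal_mul hc, ofReal_rhoSeminorm]
        simp only [one_mul]
    _ = _ := by simp

variable {E : Type*} [NormedAddCommGroup E] [NormedSpace ℂ E]

theorem sandwich_map {V W m k l n : Type*} [Fintype k] [Fintype l] [AddCommGroup V] [Module ℂ V]
    [AddCommGroup W] [Module ℂ W] (T : V →ₗ[ℂ] W) (a : Matrix m k ℂ) (x : Matrix k l V)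
    (b : Matrix l n ℂ) : (sandwich a x b).map T = sandwich a (x.map T) b := by
  ext i j
  simp [sandwich_apply, map_sum]

/-- The functional `A ↦ ∑ d_σ tr(A^σ r^σ)`. -/
def pairFun (E : Type*) [NormedAddCommGroup E] [NormedSpace ℂ E] (r : MatFam d S) :
    CoeffSpace d E S →ₗ[ℂ] E where
  toFun A := ∑ σ : S, (d σ : ℂ) • ∑ k, ∑ l, r σ l k • A σ k l
  map_add' A B := by
    simp only [Pi.add_apply, Matrix.add_apply, smul_add, Finset.sum_add_distrib]
  map_smul' c A := by
    simp only [Pi.smul_apply, Matrix.smul_apply, Finset.smul_sum, RingHom.id_apply]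
    refine Finset.sum_congr rfl fun σ _ => Finset.sum_congr rfl fun k _ =>
      Finset.sum_congr rfl fun l _ => ?_
    simp only [smul_smul]
    congr 1
    ring

theorem pairMap_eq_map {ι : Type*} (A : Matrix ι ι (CoeffSpace d E S)) (r : MatFam d S) :
    pairMap A r = A.map (pairFun E r) := rfl

theorem pairMap_smul_sandwich {ι : Type*} [Fintype ι] (c : ℂ) (a b : Matrix ι ι ℂ)
    (A : Matrix ι ι (CoeffSpace d E S)) (r : MatFam d S) :
    pairMap (c • sandwich a A b) r = c • sandwich a (pairMap A r) b := by
  rw [pairMap_eq_map, pairMap_eq_map, ← sandwich_map]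
  ext i j
  simp

variable [OperatorSpace E]

theorem memLp_famVec (hφ : IsUBQOS μ φ) (p : ℝ≥0∞) :
    MemLp (fun ω => famVec (sysFam S φ ω)) p μ := by
  have := hφ.isProbabilityMeasure
  refine MemLp.of_bound (C := (uniformBound μ φ).toReal)
    (measurable_famVec fun σ => hφ.measurable σ).aestronglyMeasurable ?_
  filter_upwards [hφ.ae_opNorm_le S] with ω hω
  exact (pi_norm_le_iff_of_nonneg ENNReal.toReal_nonneg).2 fun k =>
    (norm_apply_le_opNorm (sysFam S φ ω k.1) _ _).trans (hω k.1)

/-- The weighted function, divided by B, lies in the unit ball of L^p(S^p(E)), so weights Z^{-s/2},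
Z'^{-s/2} bring it into the unit ball of M_n(L_E^p) up to 1 + δ; Φ-cotype bounds the coefficients g
of the result. The factors α and β undo the weights, and their size is measured against the states P
and Q that entered. -/
theorem exists_factor_coeff [CompleteSpace E] (hφ : IsUBQOS μ φ) {p : ℝ≥0∞} (h1 : 1 ≤ p)
    (ht : p ≠ ∞) {n : ℕ} (A : Matrix (Fin n) (Fin n) (CoeffSpace d E S))
    {P Q : Matrix (Fin n) (Fin n) ℂ} (hP : P.PosDef) (hQ : Q.PosDef) (hP1 : P.trace.re = 1)
    (hQ1 : Q.trace.re = 1) {B δ : ℝ} (hB : 0 < B) (hδ : 0 < δ)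
    (hA : eLpNorm (fun ω => pairSeminorm h1 (mfun P fun x => x ^ (1 / p.toReal / 2))
      (mfun Q fun x => x ^ (1 / p.toReal / 2)) A (sysFam S φ ω)) p μ ≤ ENNReal.ofReal B) :
    ∃ α g β, A = sandwich α g β ∧
      coeffGauge d E S p.conjExponent n g ≤ cotypeConst μ E φ p ∧
      (P * (α * αᴴ)).trace.re ≤ B * (1 + δ) ^ 2 ∧ (Q * (βᴴ * β)).trace.re ≤ B * (1 + δ) ^ 2 := by
  have := hφ.isProbabilityMeasure
  have hr := one_le_toReal h1 ht
  have hr0 : 0 < p.toReal := by positivity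
  set s := 1 / p.toReal with hs
  have hs0 : 0 < s := by positivity
  have hs1 : s ≤ 1 := (div_le_one hr0).2 hr
  set a := mfun P fun x => x ^ (s / 2) with ha
  set b := mfun Q fun x => x ^ (s / 2) with hb
  set L : (((σ : S) × (Fin (d σ) × Fin (d σ))) → ℂ) →ₗ[ℂ] Matrix (Fin n) (Fin n) E :=
    ((B⁻¹ : ℝ) : ℂ) • (sandwichLin a b ∘ₗ pairMap A ∘ₗ famOfVec) with hL
  have hLv : ∀ ω, L (famVec (sysFam S φ ω)) =
      ((B⁻¹ : ℝ) : ℂ) • sandwich a (pairMap A (sysFam S φ ω)) b := fun ω => rfl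
  have hL1 : eLpNorm (fun ω => vectorSchattenNorm p (L (famVec (sysFam S φ ω)))) p μ ≤ 1 := by
    refine (eLpNorm_le_ofReal_mul_eLpNorm (C := B⁻¹) (fun ω => vsn_nonneg h1 _)
      (g := fun ω => pairSeminorm h1 a b A (sysFam S φ ω)) fun ω => ?_).trans ?_
    · rw [hLv, vsn_smul h1, Complex.norm_real, Real.norm_of_nonneg (inv_nonneg.2 hB.le),
        pairSeminorm_apply, Real.norm_of_nonneg (vsn_nonneg h1 _)]
    · refine (mul_le_mul_right hA _).trans (le_of_eq ?_)
      rw [← ENNReal.ofReal_mul (inv_nonneg.2 hB.le), inv_mul_cancel₀ hB.ne', ENNReal.ofReal_one]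
  obtain ⟨Z, Z', hZ, hZ', hZ1, hZ1', hw⟩ :=
    exists_weights_of_eLpNorm_le_one h1 ht L (memLp_famVec hφ p) hL1 hδ
  have hk0 : 0 < B * (1 + δ) := by positivity
  -- The scalar B(1 + δ) is shared equally between α and β. The second factor 1 + δ in the final
  -- bound comes from the traces of Z and Z'.
  set k := √(B * (1 + δ)) with hk
  have hk2 : k ^ 2 = B * (1 + δ) := Real.sq_sqrt hk0.le
  set g : Matrix (Fin n) (Fin n) (CoeffSpace d E S) := (((B * (1 + δ))⁻¹ : ℝ) : ℂ) •
    sandwich (mfun Z (fun x => x ^ (-(s / 2))) * a) A (b * mfun Z' (fun x => x ^ (-(s / 2))))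
    with hg
  refine ⟨weight k s P Z, g, (weight k s Q Z')ᴴ, ?_, ?_, ?_, ?_⟩
  · rw [hg, sandwich_smul, sandwich_sandwich, weight_mul k s hP hZ,
      mul_weight_conjTranspose k s hQ hZ', sandwich_smul_left, sandwich_smul_right, sandwich_one,
      smul_smul, smul_smul, ← Complex.ofReal_mul, ← Complex.ofReal_mul, mul_assoc, ← sq, hk2,
      inv_mul_cancel₀ hk0.ne', Complex.ofReal_one, one_smul]
  · have hgp : polyGauge μ E φ S p n (g.map (inverseTransform E φ S)) ≤ 1 := by
      refine polyGauge_inverseTransform_le h1 φ fun c e hc he => ?_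
      rw [schattenNorm_two_mul' h1, sqrt_le_one_iff] at hc
      rw [schattenNorm_two_mul h1, sqrt_le_one_iff] at he
      refine (eLpNorm_le_ofReal_mul_eLpNorm (C := (1 + δ)⁻¹) (fun ω => apply_nonneg _ _)
        (g := fun ω => vectorSchattenNorm p (sandwich (c * mfun Z (fun x => x ^ (-(s / 2))))
          (L (famVec (sysFam S φ ω))) (mfun Z' (fun x => x ^ (-(s / 2))) * e)))
        fun ω => ?_).trans ?_
      · rw [Real.norm_of_nonneg (vsn_nonneg h1 _), pairSeminorm_apply, hLv, hg,
          pairMap_smul_sandwich, sandwich_smul, sandwich_smul, sandwich_sandwich,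
          sandwich_sandwich, vsn_smul h1, vsn_smul h1, Complex.norm_real, Complex.norm_real,
          Real.norm_of_nonneg (by positivity), Real.norm_of_nonneg (by positivity), mul_inv,
          mul_comm B⁻¹, mul_assoc]
        simp only [Matrix.mul_assoc, le_refl]
      · refine (mul_le_mul_right (hw c e hc he) _).trans (le_of_eq ?_)
        rw [← ENNReal.ofReal_mul (by positivity), inv_mul_cancel₀ (by positivity),
          ENNReal.ofReal_one]
    have h2 := coeffGauge_le_cotypeConst hgp
    have e : (g.map (inverseTransform E φ S)).map (transform μ E φ S) = g :=
      Matrix.ext fun i j => hφ.transform_inverseTransform (g i j)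
    rwa [e] at h2
  · refine (re_trace_weight_le hs0 hs1 hP hZ hP1 hδ.le hZ1 k).trans (le_of_eq ?_)
    rw [hk2]; ring
  · rw [conjTranspose_conjTranspose]
    refine (re_trace_weight_le hs0 hs1 hQ hZ' hQ1 hδ.le hZ1' k).trans (le_of_eq ?_)
    rw [hk2]; ring

/-- The available rotation depends on the testing states P and Q, so no single rotation bounds the
coefficient norm directly. For each pair of states a factorization of A is produced instead, and the
minimax principle makes it uniform. -/
theorem cotypeConst_le_of_contraction [CompleteSpace E] (hφ : IsUBQOS μ φ)
    (hρ : IsQuantizedRademacher μ ρ) {p : ℝ≥0∞} (h1 : 1 ≤ p) (ht : p ≠ ∞)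
    (hq : 1 ≤ p.conjExponent) (hK : cotypeConst μ E φ p ≠ ∞) {c : ℝ} (hc : 0 ≤ c)
    (hcontr : ∀ S : Finset I, ∀ᵐ ω ∂μ, ∀ M : Seminorm ℂ (MatFam d S),
      rhoSeminorm hρ h1 M (sysFam S φ ω) ≤ c * rhoSeminorm hρ h1 M 1) :
    cotypeConst μ E (orthogonalSystem ρ) p ≤ ENNReal.ofReal c * cotypeConst μ E φ p := by
  have hρφ := hρ.isUBQOS hφ.hasNoAtoms hφ.size_pos
  refine iSup_le fun S => iSup₂_le fun n f => iSup_le fun hf => ?_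
  choose A hA using fun i j => inverseTransform_surjective (orthogonalSystem ρ) hφ.size_pos
    (E := E) (S := S) (f i j)
  have hfA : f = (of A).map (inverseTransform E (orthogonalSystem ρ) S) :=
    Matrix.ext fun i j => (hA i j).symm
  have e : f.map (transform μ E (orthogonalSystem ρ) S) = of A := by
    rw [hfA]
    exact Matrix.ext fun i j => hρφ.transform_inverseTransform (A i j)
  rw [e]
  rw [hfA] at hf
  -- B exceeds c strictly because the factorization divides by B, while c may be 0. Both losses
  -- disappear in the limit δ → 0 taken with B = c + δ.
  have key : ∀ B δ : ℝ, c < B → 0 < δ → coeffGauge d E S p.conjExponent n (of A) ≤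
      ENNReal.ofReal (B * (1 + δ) ^ 2) * cotypeConst μ E φ p := by
    intro B δ hB hδ
    have hB0 : 0 < B := hc.trans_lt hB
    refine coeffGauge_le_of_forall_posDef hq hK _ (by positivity) fun P Q hP hQ hP1 hQ1 => ?_
    set M := pairSeminorm h1 (mfun P fun x => x ^ (1 / p.toReal / 2))
      (mfun Q fun x => x ^ (1 / p.toReal / 2)) (of A) with hM
    have hM1 : eLpNorm (fun ω => M (rhoFam S ρ ω)) p μ ≤ 1 :=
      (eLpNorm_pairSeminorm_le_polyGauge h1 (orthogonalSystem ρ)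
        (schattenNorm_mfun_rpow_le_one h1 ht hP hP1) (schattenNorm_mfun_rpow_le_one h1 ht hQ hQ1)
        (of A)).trans hf
    obtain ⟨ω, hω⟩ := exists_rotation_le hφ hρ h1 ht hc (hcontr S) M
    have hω2 := hω.trans ((mul_le_mul_right hM1 _).trans ((mul_one _).le.trans
      (ENNReal.ofReal_le_ofReal hB.le)))
    simp only [hM, pairSeminorm_mul] at hω2
    obtain ⟨α, g, β, hg, hgK, hα, hβ⟩ :=
      exists_factor_coeff hφ h1 ht _ hP hQ hP1 hQ1 hB0 hδ hω2
    have hu : ∀ σ, rhoFam S ρ ω σ * (rhoFam S ρ ω σ)ᴴ = 1 := fun σ =>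
      mul_eq_one_comm.1 (complexify_conjTranspose_mul_self (ρ σ ω))
    -- The factorization was obtained for the rotated coefficients; left multiplication by the
    -- adjoint rotation commutes with α and β and keeps the bound on g.
    refine ⟨α, g.map (lmul fun σ => (rhoFam S ρ ω σ)ᴴ), β, ?_, ?_, hα, hβ⟩
    · rw [sandwich_map_lmul, ← hg]
      ext i j σ : 3
      simp only [map_apply, lmul]
      rw [sandwich_sandwich, mul_eq_one_comm.1 (hu σ), Matrix.one_mul, sandwich_one]
    · refine (coeffGauge_map_lmul_le hq (fun σ => ?_) g).trans hgK
      rw [conjTranspose_conjTranspose, hu]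
  have hlim : Filter.Tendsto (fun δ : ℝ => ENNReal.ofReal ((c + δ) * (1 + δ) ^ 2) *
      cotypeConst μ E φ p) (nhdsWithin 0 (Set.Ioi 0))
      (nhds (ENNReal.ofReal c * cotypeConst μ E φ p)) := by
    refine ENNReal.Tendsto.mul_const ?_ (Or.inr hK)
    refine ENNReal.tendsto_ofReal (Filter.Tendsto.mono_left ?_ nhdsWithin_le_nhds)
    have : Continuous fun δ : ℝ => (c + δ) * (1 + δ) ^ 2 := by fun_prop
    simpa using this.tendsto 0
  refine ge_of_tendsto hlim ?_
  filter_upwards [self_mem_nhdsWithin] with δ hδ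
  have hδ' : 0 < δ := hδ
  exact key (c + δ) δ (by linarith) hδ'

end cotype

/-! ### Assembly and degenerate cases -/

section main

variable {Ω : Type*} [MeasurableSpace Ω] {μ : Measure Ω} {I : Type*} {d : I → ℕ} {φ : System Ω d}
  {ρ : ∀ σ : I, Ω → Matrix.orthogonalGroup (Fin (d σ)) ℝ}
  {E : Type*} [NormedAddCommGroup E] [NormedSpace ℂ E] [OperatorSpace E]

theorem opNorm_famStar {S : Finset I} (r : MatFam d S) (σ : S) :
    opNorm (famStar r σ) = opNorm (r σ) := opNorm_conjTranspose _

/-- If the bound were 0, the system would vanish almost everywhere, contradicting the normalization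
1/d_σ. -/
theorem uniformBound_ne_zero [Nonempty I] (hφ : IsUBQOS μ φ) : uniformBound μ φ ≠ 0 := by
  intro h0
  obtain ⟨σ⟩ := ‹Nonempty I›
  have h1 := hφ.ae_opNorm_le {σ}
  rw [h0, ENNReal.toReal_zero] at h1
  have h2 := hφ.orthonormal_self σ ⟨0, hφ.size_pos σ⟩ ⟨0, hφ.size_pos σ⟩ ⟨0, hφ.size_pos σ⟩
    ⟨0, hφ.size_pos σ⟩
  rw [integral_eq_zero_of_ae] at h2
  · have hd : (d σ : ℂ) ≠ 0 := by exact_mod_cast (hφ.size_pos σ).ne'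
    simp only [and_self, if_true, one_div] at h2
    exact inv_ne_zero hd h2.symm
  · filter_upwards [h1] with ω hω
    have h3 := eq_zero_of_opNorm_le_zero (hω ⟨σ, by simp⟩)
    have h4 : φ σ ω = 0 := h3
    simp [h4]

theorem cotypeConst_eq_zero_of_isEmpty [IsEmpty I] {p : ℝ≥0∞} (hq : 1 ≤ p.conjExponent) :
    cotypeConst μ E φ p = 0 := by
  refine le_antisymm (iSup_le fun S => iSup₂_le fun n f => iSup_le fun _ => ?_) zero_le
  have : f.map (transform μ E φ S) = 0 := by
    ext i j σ
    exact isEmptyElim (σ : I)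
  rw [this]
  refine matrixGauge_le fun a b _ _ => ?_
  rw [sandwich_zero_mid, coeffSchattenGauge_zero hq]

theorem type_and_cotype_le (hφ : IsUBQOS μ φ) (hρ : IsQuantizedRademacher μ ρ) [CompleteSpace E]
    {p : ℝ≥0∞} (h1 : 1 ≤ p) (h2 : p ≤ 2) {k : ℝ} (hk : 0 < k)
    (hcontr : ∀ S : Finset I, ∀ᵐ ω ∂μ, ∀ {q : ℝ≥0∞} (hq : 1 ≤ q) (M : Seminorm ℂ (MatFam d S)),
      rhoSeminorm hρ hq M (sysFam S φ ω) ≤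
        k * (uniformBound μ φ).toReal * rhoSeminorm hρ hq M 1 ∧
      rhoSeminorm hρ hq M (famStar (sysFam S φ ω)) ≤
        k * (uniformBound μ φ).toReal * rhoSeminorm hρ hq M 1) :
    typeConst μ E (orthogonalSystem ρ) p ≤
      ENNReal.ofReal k * uniformBound μ φ * typeConst μ E φ p ∧
    cotypeConst μ E (orthogonalSystem ρ) p ≤
      ENNReal.ofReal k * uniformBound μ φ * cotypeConst μ E φ p := by
  have hq : 1 ≤ p.conjExponent := le_self_add
  have hc : 0 ≤ k * (uniformBound μ φ).toReal := mul_nonneg hk.le ENNReal.toReal_nonneg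
  have e : ENNReal.ofReal k * uniformBound μ φ =
      ENNReal.ofReal (k * (uniformBound μ φ).toReal) := by
    rw [ENNReal.ofReal_mul hk.le, ENNReal.ofReal_toReal hφ.bounded.ne]
  have ht : p ≠ ∞ := (h2.trans_lt (by simp)).ne
  refine ⟨?_, ?_⟩
  · rw [e]
    exact typeConst_le_of_contraction hφ hρ h1 hq hc fun S =>
      (hcontr S).mono fun ω hω M => (hω hq M).2
  -- The limit argument needs a finite constant. If it is infinite the right side must be infinite
  -- too, despite `0 * ∞ = 0`: the bound M_Φ is nonzero unless the index set is empty, and then both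
  -- cotype constants are 0.
  · by_cases hK : cotypeConst μ E φ p = ∞
    · rcases isEmpty_or_nonempty I with hI | hI
      · rw [cotypeConst_eq_zero_of_isEmpty hq]
        exact zero_le
      · rw [hK, ENNReal.mul_top]
        · exact le_top
        · exact mul_ne_zero (by simpa using hk) (uniformBound_ne_zero hφ)
    · rw [e]
      exact cotypeConst_le_of_contraction hφ hρ h1 ht hq hK hc fun S =>
        (hcontr S).mono fun ω hω M => (hω h1 M).1

end main

end

end QuantizedSystem

end

theorem proposition3p3 {Ω : Type*} [MeasurableSpace Ω] (μ : Measure Ω) {I : Type*} {d : I → ℕ}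
    (φ : System Ω d) (hφ : IsUBQOS μ φ)
    (ρ : ∀ σ : I, Ω → Matrix.orthogonalGroup (Fin (d σ)) ℝ)
    (hρ : IsQuantizedRademacher μ ρ)
    (E : Type*) [NormedAddCommGroup E] [NormedSpace ℂ E] [CompleteSpace E]
    [OperatorSpace E] (p : ℝ≥0∞) (hp1 : 1 ≤ p) (hp2 : p ≤ 2) :
    (HasType μ E φ p →
      HasType μ E (orthogonalSystem ρ) p) ∧
    (HasConjCotype μ E φ p →
      HasConjCotype μ E (orthogonalSystem ρ) p) ∧
    typeConst μ E (orthogonalSystem ρ) p ≤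
      2 * uniformBound μ φ * typeConst μ E φ p ∧
    cotypeConst μ E (orthogonalSystem ρ) p ≤
      2 * uniformBound μ φ * cotypeConst μ E φ p ∧
    ((∀ σ, ∀ᵐ ω ∂μ, ∀ i j, (φ σ ω i j).im = 0) →
      typeConst μ E (orthogonalSystem ρ) p ≤
        uniformBound μ φ * typeConst μ E φ p ∧
      cotypeConst μ E (orthogonalSystem ρ) p ≤
        uniformBound μ φ * cotypeConst μ E φ p) := by
  have hM : 0 ≤ (uniformBound μ φ).toReal := ENNReal.toReal_nonneg
  have h := type_and_cotype_le (E := E) hφ hρ hp1 hp2 (k := 2) two_pos fun S =>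
    (hφ.ae_opNorm_le S).mono fun ω hω q hq M =>
      ⟨rhoSeminorm_le hρ hq M hM hω, rhoSeminorm_le hρ hq M hM fun σ =>
        (opNorm_famStar _ σ).le.trans (hω σ)⟩
  rw [ENNReal.ofReal_ofNat] at h
  have hfin : (2 : ℝ≥0∞) * uniformBound μ φ < ∞ := ENNReal.mul_lt_top (by simp) hφ.bounded
  refine ⟨fun hT => h.1.trans_lt (ENNReal.mul_lt_top hfin hT),
    fun hT => h.2.trans_lt (ENNReal.mul_lt_top hfin hT), h.1, h.2, fun him => ?_⟩
  -- For real φ the adjoint is real as well, so the real contraction principle serves both for type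
  -- and for cotype and no splitting is needed.
  have h' := type_and_cotype_le (E := E) hφ hρ hp1 hp2 (k := 1) one_pos fun S => by
    have hi : ∀ᵐ ω ∂μ, ∀ σ : S, ∀ i j, (φ σ ω i j).im = 0 := ae_all_iff.2 fun σ => him σ
    filter_upwards [hφ.ae_opNorm_le S, hi] with ω hω hiω q hq M
    rw [one_mul]
    exact ⟨rhoSeminorm_le_of_real hρ hq M hM hω hiω, rhoSeminorm_le_of_real hρ hq M hM
      (fun σ => (opNorm_famStar _ σ).le.trans (hω σ)) fun σ i j => by
        change (star (φ σ ω j i)).im = 0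
        rw [Complex.star_def, Complex.conj_im, hiω, neg_zero]⟩
  rwa [ENNReal.ofReal_one, one_mul] at h'
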